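/- Let $(V,Y,\mathbf 1,\omega)$ be a vertex operator algebra over $\mathbb C$, with $Y(\omega,x)=\sum_{n\in\mathbb Z}L(n)x^{-n-2}$ and $V=\coprod_{n\in\mathbb Z}V_{(n)}$ its decomposition into $L(0)$-eigenspaces, so that $\dim V_{(n)}<\infty$ for all $n$ and $V_{(n)}=0$ for $n$ sufficiently negative. Let $g$ be any automorphism of $V$, not necessarily of finite order or semisimple. For $a\in\mathbb C$ with $0\le\Re a<1$ let $V^{[a+\mathbb Z]}$ be the generalized eigenspace of $g$ with eigenvalue $e^{2\pi i a}$; $V$ is the direct sum of these spaces. Define linear operators on $V$ as follows. * $\mathbf A_V$ is multiplication by $a$ on $V^{[a+\mathbb Z]}$. * $\mathbf L$ acts on $u\in V_{(n)}\cap V^{[a+\mathbb Z]}$ as multiplication by $n+a$ if $\Re a=0$, and by $n+a-1$ if $0<\Re a<1$. Thus $L(0)-\mathbf L+\mathbf A_V$ is semisimple with eigenvalues in $\{0,1\}$. * $\mathcal N=\frac1{2\pi i}\log g_u=\frac1{2\pi i}\sum_{j\ge1}\frac{(-1)^{j+1}}{j}(g_u-1)^j$, where $g=\sigma g_u$ is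 the multiplicative Jordan–Chevalley decomposition of $g$, with $\sigma$ semisimple (multiplication by $e^{2\pi i a}$ on $V^{[a+\mathbb Z]}$) and $g_u$ locally unipotent. * $\mathcal U(1)=(2\pi i)^{L(0)}e^{-L_+(A)}$, where $L_+(A)=\sum_{j\ge1}A_jL(j)$ and the numbers $A_j\in\mathbb C$ are uniquely determined by $$\frac1{2\pi i}\left(e^{2\pi i y}-1\right)=\left(\exp\Bigl(-\sum_{j\ge1}A_jy^{j+1}\frac{\partial}{\partial y}\Bigr)\right)y .$$ Here $(1+x)^B=\sum_{j\ge0}\binom Bj x^j$ for an operator $B$. For $u,v\in V$ put $$u*_gv=\operatorname{Res}_x x^{-1}Y\left((1+x)^{\mathbf L+\mathcal N}u,x\right)v,\qquad u\bullet_gv=\operatorname{Res}_y y^{-1}Y\left((1+y)^{\mathbf L-L(0)+\mathcal N}u,\tfrac1{2\pi i}\log(1+y)\right)v .$$ Let $O_g(V)$ be the linear span of the elements $$\operatorname{Res}_x x^{-n}Y\left(x^{L(0)-\mathbf L+\mathbf A_V}(1+x)^{\mathbf L+\mathcal N}u,x\right)v,$$ and $\tilde O_g(V)$ the linear span of the elements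 $$\operatorname{Res}_y y^{-n}Y\left(y^{L(0)-\mathbf L+\mathbf A_V}(1+y)^{\mathbf L-L(0)+\mathcal N}u,\tfrac1{2\pi i}\log(1+y)\right)v,$$ in both cases for all integers $n>1$ and all $u,v\in V$. Put $A_g(V)=V/O_g(V)$ and $\tilde A_g(V)=V/\tilde O_g(V)$. Then $*_g$ induces a well-defined product on $A_g(V)$ and $\bullet_g$ induces a well-defined product on $\tilde A_g(V)$. With these products, $A_g(V)$ and $\tilde A_g(V)$ are associative algebras over $\mathbb C$ with identities $\mathbf 1+O_g(V)$ and $\mathbf 1+\tilde O_g(V)$ respectively. Moreover, $\mathcal U(1)$ induces a well-defined map $$\tilde A_g(V)\to A_g(V),\qquad u+\tilde O_g(V)\mapsto \mathcal U(1)u+O_g(V),$$ and this map is an isomorphism of associative algebras with identity. -/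

import Mathlib

open scoped PowerSeries

noncomputable section

namespace TwistedZhu

/-! ### Vertex operator algebras and their automorphisms -/

section VOA

variable (V : Type*) [AddCommGroup V] [Module ℂ V]

/-- A vertex operator algebra `(V, Y, 1, ω)` over `ℂ`.  For `u : V`, `ncoeff (Y u) n` is the mode
`u_n` of `Y(u, x) = ∑ u_n x^{-n-1}`, and `Y(u, x) v` is a Laurent series (lower truncation).
The weight spaces `V_(n)` are the eigenspaces of `L(0)`, where `Y(ω, x) = ∑ L(n) x^{-n-2}`, i.e.
`L(n) = ω_{n+1}`. -/
structure VertexOperatorAlgebra where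
  /-- the vertex operator map -/
  Y : V →ₗ[ℂ] VertexOperator ℂ V
  /-- the vacuum `1` -/
  vac : V
  /-- the conformal vector `ω` -/
  conf : V
  /-- the central charge -/
  centralCharge : ℂ
  /-- `Y(1, x) = id` -/
  vacuum : ∀ (n : ℤ) (v : V),
    VertexOperator.ncoeff (Y vac) n v = if n = -1 then v else 0
  /-- `Y(v, x) 1` is a power series with constant term `v` -/
  creation : ∀ v : V, VertexOperator.ncoeff (Y v) (-1) vac = v ∧
    ∀ n : ℤ, 0 ≤ n → VertexOperator.ncoeff (Y v) n vac = 0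
  /-- the Jacobi identity, in components -/
  jacobi : ∀ (u v w : V) (l m n : ℤ),
    ∑ᶠ i : ℕ, Ring.choose m i •
        VertexOperator.ncoeff (Y (VertexOperator.ncoeff (Y u) (l + i) v)) (m + n - i) w =
      ∑ᶠ i : ℕ, ((-1 : ℤ) ^ i * Ring.choose l i) •
        (VertexOperator.ncoeff (Y u) (m + l - i) (VertexOperator.ncoeff (Y v) (n + i) w) -
          (-1 : ℂ) ^ l •
            VertexOperator.ncoeff (Y v) (n + l - i) (VertexOperator.ncoeff (Y u) (m + i) w))
  /-- the Virasoro relations -/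
  virasoro : ∀ (m n : ℤ) (v : V),
    VertexOperator.ncoeff (Y conf) (m + 1) (VertexOperator.ncoeff (Y conf) (n + 1) v) -
        VertexOperator.ncoeff (Y conf) (n + 1) (VertexOperator.ncoeff (Y conf) (m + 1) v) =
      ((m : ℂ) - n) • VertexOperator.ncoeff (Y conf) (m + n + 1) v +
        if m + n = 0 then (((m : ℂ) ^ 3 - m) / 12 * centralCharge) • v else 0
  /-- `Y(L(-1) v, x) = d/dx Y(v, x)` -/
  derivative : ∀ (v w : V) (n : ℤ),
    VertexOperator.ncoeff (Y (VertexOperator.ncoeff (Y conf) 0 v)) n w =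
      -(n : ℂ) • VertexOperator.ncoeff (Y v) (n - 1) w
  /-- `V = ⨁_{n ∈ ℤ} V_(n)` with `L(0) = n` on `V_(n)` -/
  grading : DirectSum.IsInternal fun n : ℤ =>
    Module.End.eigenspace (VertexOperator.ncoeff (Y conf) 1) (n : ℂ)
  /-- `dim V_(n) < ∞` -/
  finite_weight : ∀ n : ℤ, FiniteDimensional ℂ
    (Module.End.eigenspace (VertexOperator.ncoeff (Y conf) 1) (n : ℂ))
  /-- `V_(n) = 0` for `n` sufficiently negative -/
  bounded_below : ∃ N : ℤ, ∀ n : ℤ, n < N →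
    Module.End.eigenspace (VertexOperator.ncoeff (Y conf) 1) (n : ℂ) = ⊥

end VOA

variable {V : Type*} [AddCommGroup V] [Module ℂ V]

namespace VertexOperatorAlgebra

variable (𝒱 : VertexOperatorAlgebra V)

/-- The mode `u_n`, where `Y(u, x) = ∑ u_n x^{-n-1}`. -/
def mode (u : V) (n : ℤ) : Module.End ℂ V := VertexOperator.ncoeff (𝒱.Y u) n

/-- The Virasoro operator `L(n) = ω_{n+1}`. -/
def vir (n : ℤ) : Module.End ℂ V := 𝒱.mode 𝒱.conf (n + 1)

end VertexOperatorAlgebra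

/-- An automorphism of a vertex operator algebra: a linear automorphism with
`g Y(u, x) v = Y(g u, x) g v`, `g 1 = 1` and `g ω = ω`. -/
structure VOAAut (𝒱 : VertexOperatorAlgebra V) where
  toEquiv : V ≃ₗ[ℂ] V
  map_mode : ∀ (u v : V) (n : ℤ),
    toEquiv (𝒱.mode u n v) = 𝒱.mode (toEquiv u) n (toEquiv v)
  map_vac : toEquiv 𝒱.vac = 𝒱.vac
  map_conf : toEquiv 𝒱.conf = 𝒱.conf

/-! ### Operators on graded spaces, and power series of locally nilpotent operators -/

section Operators

/-- The operator acting as the scalar `f i` on the summand `W i` of `V = ⨁ W i`. -/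
def diagOp {ι : Type*} [DecidableEq ι] {W : ι → Submodule ℂ V} (h : DirectSum.IsInternal W)
    (f : ι → ℂ) : Module.End ℂ V :=
  (DirectSum.toModule ℂ ι V fun i => f i • (W i).subtype) ∘ₗ
    (LinearEquiv.ofBijective (DirectSum.coeLinearMap W)
      (id h : Function.Bijective (DirectSum.coeLinearMap W))).symm.toLinearMap

theorem diagOp_apply {ι : Type*} [DecidableEq ι] {W : ι → Submodule ℂ V}
    (h : DirectSum.IsInternal W) (f : ι → ℂ) {i : ι} {v : V} (hv : v ∈ W i) :
    diagOp h f v = f i • v := by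
  have : (LinearEquiv.ofBijective (DirectSum.coeLinearMap W)
      (id h : Function.Bijective (DirectSum.coeLinearMap W))).symm v = DirectSum.lof ℂ ι (fun i => W i) i ⟨v, hv⟩ := by
    rw [LinearEquiv.symm_apply_eq, LinearEquiv.ofBijective_apply, DirectSum.coeLinearMap_lof]
  rw [diagOp, LinearMap.comp_apply, LinearEquiv.coe_coe, this, DirectSum.toModule_lof]
  rfl

/-- `T` is locally nilpotent. -/
def LocallyNilpotent (T : Module.End ℂ V) : Prop := ∀ v : V, ∃ k : ℕ, (T ^ k) v = 0

theorem LocallyNilpotent.finite_support {T : Module.End ℂ V} (hT : LocallyNilpotent T)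
    (p : ℂ⟦X⟧) (v : V) :
    (Function.support fun k : ℕ => PowerSeries.coeff k p • (T ^ k) v).Finite := by
  obtain ⟨N, hN⟩ := hT v
  refine (Set.finite_lt_nat N).subset fun k hk => ?_
  by_contra hlt
  apply hk
  obtain ⟨d, rfl⟩ := Nat.exists_eq_add_of_le (not_lt.mp hlt)
  simp only
  rw [add_comm, pow_add, Module.End.mul_apply, hN, map_zero, smul_zero]

/-- `p(T) = ∑ p_k T^k` for a power series `p` and a locally nilpotent operator `T` (a finite sum
on every vector). -/
def evalSeries (p : ℂ⟦X⟧) (T : Module.End ℂ V) (hT : LocallyNilpotent T) : Module.End ℂ V where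
  toFun v := ∑ᶠ k : ℕ, PowerSeries.coeff k p • (T ^ k) v
  map_add' v w := by
    rw [← finsum_add_distrib (hT.finite_support p v) (hT.finite_support p w)]
    simp
  map_smul' c v := by
    rw [RingHom.id_apply, smul_finsum' c (hT.finite_support p v)]
    simp [smul_comm c]

theorem locallyNilpotent_of_iSup {ι : Type*} {W : ι → Submodule ℂ V} (hW : ⨆ i, W i = ⊤)
    {T : Module.End ℂ V} (h : ∀ i, ∀ v ∈ W i, ∃ k : ℕ, (T ^ k) v = 0) :
    LocallyNilpotent T := by
  have hle : ⨆ i, W i ≤ T.maxGenEigenspace 0 :=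
    iSup_le fun i v hv => by
      obtain ⟨k, hk⟩ := h i v hv
      exact (Module.End.mem_maxGenEigenspace T 0 v).2 ⟨k, by simpa using hk⟩
  intro v
  have hv : v ∈ T.maxGenEigenspace 0 := hle (hW ▸ Submodule.mem_top)
  obtain ⟨k, hk⟩ := (Module.End.mem_maxGenEigenspace T 0 v).1 hv
  exact ⟨k, by simpa using hk⟩

/-- `c^D` for an operator `D` that acts semisimply with integer eigenvalues. -/
def scalarPow (c : ℂ) (D : Module.End ℂ V)
    (hD : DirectSum.IsInternal fun k : ℤ => D.eigenspace (k : ℂ)) : Module.End ℂ V :=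
  diagOp hD fun k => c ^ k

/-- The projection of `V` onto the `e`-eigenspace of an operator `D` that acts semisimply with
integer eigenvalues, along the other eigenspaces. -/
def eigenProj (D : Module.End ℂ V)
    (hD : DirectSum.IsInternal fun k : ℤ => D.eigenspace (k : ℂ)) (e : ℤ) : Module.End ℂ V :=
  diagOp hD fun k => if k = e then 1 else 0

/-- The operator `binom(B, j) = B (B - 1) ⋯ (B - j + 1) / j!`. -/
def binomOp (B : Module.End ℂ V) (j : ℕ) : Module.End ℂ V :=
  (j.factorial : ℂ)⁻¹ • Polynomial.aeval B (descPochhammer ℂ j)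

end Operators

/-! ### Formal series with coefficients in `V`

A series `∑_{k ∈ ℤ} w_k y^k` is represented by the function `w : ℤ → V`. -/

section Series

/-- `(1 + y)^B u = ∑_j binom(B, j) u y^j`. -/
def onePlusPow (B : Module.End ℂ V) (u : V) : ℤ → V :=
  fun k => if 0 ≤ k then binomOp B k.toNat u else 0

/-- `y^s w(y)`. -/
def shift (s : ℤ) (w : ℤ → V) : ℤ → V := fun k => w (k - s)

/-- `y^D w(y)` for an operator `D` that acts semisimply with integer eigenvalues; `y^D` is `y^e` on
the `e`-eigenspace of `D`. -/
def varPow (D : Module.End ℂ V)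
    (hD : DirectSum.IsInternal fun k : ℤ => D.eigenspace (k : ℂ)) (w : ℤ → V) : ℤ → V :=
  fun k => ∑ᶠ e : ℤ, eigenProj D hD e (w (k - e))

/-- `Res_y Y(w(y), ℓ(y)) v`, the coefficient of `y^{-1}` in
`∑_{k, m} (w_k)_m v y^k ℓ(y)^{-m-1}`. -/
def resY (𝒱 : VertexOperatorAlgebra V) (ℓ : LaurentSeries ℂ) (w : ℤ → V) (v : V) : V :=
  ∑ᶠ p : ℤ × ℤ,
    (HahnSeries.single p.1 (1 : ℂ) * ℓ ^ (-p.2 - 1)).coeff (-1) • 𝒱.mode (w p.1) p.2 v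

/-- The constant `2 π √-1`. -/
def twoPiI : ℂ := 2 * Real.pi * Complex.I

/-- The variable `y`, as a Laurent series. -/
def varY : LaurentSeries ℂ := HahnSeries.single 1 1

/-- `(1 / 2 π √-1) log (1 + y)`, as a Laurent series in `y`. -/
def logY : LaurentSeries ℂ := ((twoPiI⁻¹ • PowerSeries.log ℂ : ℂ⟦X⟧) : LaurentSeries ℂ)

end Series

/-! ### The numbers `A_j` -/

section Flow

/-- The series `exp(a(y) ∂/∂y) y = ∑_k (1 / k!) (a(y) ∂/∂y)^k y`, for `a ∈ y² ℂ[[y]]`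
(every coefficient is a finite sum). -/
def flow (a : ℂ⟦X⟧) : ℂ⟦X⟧ :=
  PowerSeries.mk fun n => ∑ᶠ k : ℕ, (k.factorial : ℂ)⁻¹ *
    PowerSeries.coeff n ((fun f : ℂ⟦X⟧ => a * PowerSeries.derivative ℂ f)^[k] PowerSeries.X)

/-- `(1 / 2 π √-1) (e^{2 π √-1 y} - 1)` -/
def expCoord : ℂ⟦X⟧ :=
  twoPiI⁻¹ • (PowerSeries.rescale twoPiI (PowerSeries.exp ℂ) - 1)

theorem X_pow_dvd_derivative {f : ℂ⟦X⟧} {n : ℕ} (h : (PowerSeries.X : ℂ⟦X⟧) ^ (n + 1) ∣ f) :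
    (PowerSeries.X : ℂ⟦X⟧) ^ n ∣ PowerSeries.derivative ℂ f := by
  rw [PowerSeries.X_pow_dvd_iff] at h ⊢
  intro m hm
  rw [PowerSeries.coeff_derivative, h (m + 1) (by omega), zero_mul]

theorem X_pow_dvd_iterate {a : ℂ⟦X⟧} (ha : (PowerSeries.X : ℂ⟦X⟧) ^ 2 ∣ a) (k : ℕ) :
    (PowerSeries.X : ℂ⟦X⟧) ^ (k + 1) ∣
      (fun f : ℂ⟦X⟧ => a * PowerSeries.derivative ℂ f)^[k] PowerSeries.X := by
  induction k with
  | zero => simp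
  | succ k ih =>
    rw [Function.iterate_succ_apply']
    have := mul_dvd_mul ha (X_pow_dvd_derivative ih)
    rw [← pow_add] at this
    convert this using 2
    omega

theorem X_pow_dvd_iterate_sub {a b : ℂ⟦X⟧} (ha : (PowerSeries.X : ℂ⟦X⟧) ^ 2 ∣ a)
    (hb : (PowerSeries.X : ℂ⟦X⟧) ^ 2 ∣ b) {n : ℕ} (hab : (PowerSeries.X : ℂ⟦X⟧) ^ n ∣ a - b)
    (hn : 1 ≤ n) (k : ℕ) :
    (PowerSeries.X : ℂ⟦X⟧) ^ (n + k) ∣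
      (fun f : ℂ⟦X⟧ => a * PowerSeries.derivative ℂ f)^[k + 1] PowerSeries.X -
      (fun f : ℂ⟦X⟧ => b * PowerSeries.derivative ℂ f)^[k + 1] PowerSeries.X := by
  induction k with
  | zero => simpa using hab
  | succ k ih =>
    rw [Function.iterate_succ_apply', Function.iterate_succ_apply' _ (k + 1) PowerSeries.X]
    set F := (fun f : ℂ⟦X⟧ => a * PowerSeries.derivative ℂ f)^[k + 1] PowerSeries.X
    set G := (fun f : ℂ⟦X⟧ => b * PowerSeries.derivative ℂ f)^[k + 1] PowerSeries.X with hG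
    have e : a * PowerSeries.derivative ℂ F - b * PowerSeries.derivative ℂ G =
        a * PowerSeries.derivative ℂ (F - G) + (a - b) * PowerSeries.derivative ℂ G := by
      rw [map_sub]; ring
    show _ ∣ a * PowerSeries.derivative ℂ F - b * PowerSeries.derivative ℂ G
    rw [e]
    apply dvd_add
    · obtain ⟨m, hm⟩ : ∃ m, n + k = m + 1 := ⟨n + k - 1, by omega⟩
      rw [hm] at ih
      have := mul_dvd_mul ha (X_pow_dvd_derivative ih)
      rw [← pow_add] at this
      convert this using 2
      omega
    · have := mul_dvd_mul hab (X_pow_dvd_derivative (X_pow_dvd_iterate hb (k + 1)))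
      rwa [← pow_add] at this

/-- The part of the `n`-th coefficient of `exp(a ∂/∂y) y` of degree at least two in `a`. -/
def flowTail (n : ℕ) (a : ℂ⟦X⟧) : ℂ :=
  ∑ k ∈ Finset.Ico 2 (n + 2), (k.factorial : ℂ)⁻¹ *
    PowerSeries.coeff n ((fun f : ℂ⟦X⟧ => a * PowerSeries.derivative ℂ f)^[k] PowerSeries.X)

theorem coeff_flow {a : ℂ⟦X⟧} (ha : (PowerSeries.X : ℂ⟦X⟧) ^ 2 ∣ a) (n : ℕ) :
    PowerSeries.coeff n (flow a) =
      PowerSeries.coeff n PowerSeries.X + PowerSeries.coeff n a + flowTail n a := by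
  rw [flow, PowerSeries.coeff_mk, finsum_eq_sum_of_support_subset (s := Finset.range (n + 2)),
    Finset.range_eq_Ico, Finset.sum_eq_sum_Ico_succ_bot (by omega),
    Finset.sum_eq_sum_Ico_succ_bot (by omega), flowTail]
  · simp [add_assoc]
  · intro k hk
    by_contra hlt
    apply hk
    have := PowerSeries.X_pow_dvd_iff.1 (X_pow_dvd_iterate ha k) n (by simp at hlt; omega)
    simp only [this, mul_zero]

theorem flowTail_congr {a b : ℂ⟦X⟧} (ha : (PowerSeries.X : ℂ⟦X⟧) ^ 2 ∣ a)
    (hb : (PowerSeries.X : ℂ⟦X⟧) ^ 2 ∣ b) {n : ℕ}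
    (hab : ∀ m < n, PowerSeries.coeff m a = PowerSeries.coeff m b) :
    flowTail n a = flowTail n b := by
  rcases Nat.eq_zero_or_pos n with rfl | hn
  · simp [flowTail]
  refine Finset.sum_congr rfl fun k hk => ?_
  rw [Finset.mem_Ico] at hk
  obtain ⟨j, rfl⟩ : ∃ j, k = j + 1 := ⟨k - 1, by omega⟩
  have h : (PowerSeries.X : ℂ⟦X⟧) ^ n ∣ a - b :=
    PowerSeries.X_pow_dvd_iff.2 fun m hm => by rw [map_sub, hab m hm, sub_self]
  have := PowerSeries.X_pow_dvd_iff.1 (X_pow_dvd_iterate_sub ha hb h hn j) n (by omega)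
  rw [map_sub, sub_eq_zero] at this
  rw [this]

/-- The coefficients of the series `a` with `exp(a ∂/∂y) y = t`, by recursion. -/
def flowCoeff (t : ℂ⟦X⟧) (n : ℕ) : ℂ :=
  if n < 2 then 0
  else PowerSeries.coeff n t -
    flowTail n (PowerSeries.mk fun i => if _h : i < n then flowCoeff t i else 0)
termination_by n

theorem existsUnique_flow {t : ℂ⟦X⟧} (h0 : PowerSeries.coeff 0 t = 0)
    (h1 : PowerSeries.coeff 1 t = 1) :
    ∃! a : ℂ⟦X⟧, (PowerSeries.X : ℂ⟦X⟧) ^ 2 ∣ a ∧ flow a = t := by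
  have hb : (PowerSeries.X : ℂ⟦X⟧) ^ 2 ∣ PowerSeries.mk (flowCoeff t) :=
    PowerSeries.X_pow_dvd_iff.2 fun m hm => by
      rw [PowerSeries.coeff_mk, flowCoeff, if_pos hm]
  refine ⟨PowerSeries.mk (flowCoeff t), ⟨hb, ?_⟩, ?_⟩
  · ext n
    rw [coeff_flow hb]
    by_cases hn : n < 2
    · rw [PowerSeries.X_pow_dvd_iff.1 hb n hn]
      have : n = 0 ∨ n = 1 := by omega
      rcases this with rfl | rfl
      · simp [flowTail, h0]
      · have h2 := PowerSeries.X_pow_dvd_iff.1 (X_pow_dvd_iterate hb 2) 1 (by omega)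
        have : flowTail 1 (PowerSeries.mk (flowCoeff t)) = 0 := by
          rw [flowTail, show Finset.Ico 2 (1 + 2) = {2} from rfl, Finset.sum_singleton, h2,
            mul_zero]
        rw [this, h1, PowerSeries.coeff_one_X]
        simp
    · have hc : (PowerSeries.X : ℂ⟦X⟧) ^ 2 ∣
          PowerSeries.mk fun i => if _h : i < n then flowCoeff t i else 0 :=
        PowerSeries.X_pow_dvd_iff.2 fun m hm => by
          rw [PowerSeries.coeff_mk, dif_pos (by omega), flowCoeff, if_pos hm]
      rw [flowTail_congr hb hc (n := n) fun m hm => by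
        rw [PowerSeries.coeff_mk, PowerSeries.coeff_mk, dif_pos hm]]
      rw [PowerSeries.coeff_mk, flowCoeff, if_neg hn, PowerSeries.coeff_X, if_neg (by omega)]
      ring
  · rintro a ⟨ha, hat⟩
    ext n
    induction n using Nat.strong_induction_on with
    | _ n ih =>
      rw [PowerSeries.coeff_mk, flowCoeff]
      split_ifs with hn
      · exact PowerSeries.X_pow_dvd_iff.1 ha n hn
      · have hc : (PowerSeries.X : ℂ⟦X⟧) ^ 2 ∣
            PowerSeries.mk fun i => if _h : i < n then flowCoeff t i else 0 :=
          PowerSeries.X_pow_dvd_iff.2 fun m hm => by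
            rw [PowerSeries.coeff_mk, dif_pos (by omega), flowCoeff, if_pos hm]
        have := coeff_flow ha n
        rw [hat, PowerSeries.coeff_X, if_neg (by omega), zero_add,
          flowTail_congr ha hc (n := n) fun m hm => by
            rw [PowerSeries.coeff_mk, dif_pos hm, ih m hm, PowerSeries.coeff_mk]] at this
        rw [this]
        ring

theorem twoPiI_ne_zero : twoPiI ≠ 0 := Complex.two_pi_I_ne_zero

/-- There is a unique series `a(y) = ∑_{j ≥ 1} A_j y^{j+1}` with
`(1 / 2 π √-1) (e^{2 π √-1 y} - 1) = exp(-a(y) ∂/∂y) y`. -/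
theorem existsUnique_vectorField :
    ∃! a : ℂ⟦X⟧, (PowerSeries.X : ℂ⟦X⟧) ^ 2 ∣ a ∧ flow (-a) = expCoord := by
  obtain ⟨b, ⟨hb, hbt⟩, hu⟩ := existsUnique_flow (t := expCoord)
    (by rw [expCoord, PowerSeries.coeff_smul, map_sub, PowerSeries.coeff_rescale]
        simp [PowerSeries.coeff_exp, -PowerSeries.coeff_zero_eq_constantCoeff])
    (by simp [expCoord, PowerSeries.coeff_rescale, PowerSeries.coeff_exp,
      PowerSeries.coeff_one, twoPiI_ne_zero])
  refine ⟨-b, ⟨(dvd_neg).2 hb, by rwa [neg_neg]⟩, ?_⟩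
  rintro a ⟨ha, hat⟩
  rw [← hu (-a) ⟨(dvd_neg).2 ha, hat⟩, neg_neg]

/-- The unique complex numbers `A_j`, `j ≥ 1`, with
`(1 / 2 π √-1) (e^{2 π √-1 y} - 1) = exp(-∑_{j ≥ 1} A_j y^{j+1} ∂/∂y) y`. -/
def coordCoeff (j : ℕ) : ℂ :=
  PowerSeries.coeff (j + 1) existsUnique_vectorField.choose

end Flow

namespace VertexOperatorAlgebra

variable (𝒱 : VertexOperatorAlgebra V)

theorem isInternal_vir_zero :
    DirectSum.IsInternal fun k : ℤ => (𝒱.vir 0).eigenspace (k : ℂ) := by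
  have := 𝒱.grading
  simpa [vir, mode] using this

theorem exists_mode_eq_zero (u v : V) : ∃ N : ℤ, ∀ n : ℤ, N ≤ n → 𝒱.mode u n v = 0 := by
  refine ⟨-((HahnModule.of ℂ).symm (𝒱.Y u v)).order, fun n hn => ?_⟩
  exact VertexOperator.ncoeff_eq_zero_of_lt_order (𝒱.Y u) n v (by omega)

theorem finite_support_vir (A : ℕ → ℂ) (v : V) :
    (Function.support fun j : ℕ => A j • 𝒱.vir (j + 1) v).Finite := by
  obtain ⟨N, hN⟩ := 𝒱.exists_mode_eq_zero 𝒱.conf v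
  refine (Set.finite_lt_nat N.toNat).subset fun j hj => ?_
  by_contra hlt
  apply hj
  have hlt : N.toNat ≤ j := by simpa using hlt
  simp only [vir]
  rw [hN _ (by omega), smul_zero]

/-- `L_+(A) = ∑_{j ≥ 1} A_j L(j)` (a finite sum on every vector); `j + 1` runs over the positive
integers. -/
def virPlus : Module.End ℂ V where
  toFun v := ∑ᶠ j : ℕ, coordCoeff (j + 1) • 𝒱.vir (j + 1) v
  map_add' v w := by
    rw [← finsum_add_distrib (𝒱.finite_support_vir (fun j => coordCoeff (j + 1)) v)
      (𝒱.finite_support_vir (fun j => coordCoeff (j + 1)) w)]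
    simp
  map_smul' c v := by
    rw [RingHom.id_apply, smul_finsum' c (𝒱.finite_support_vir (fun j => coordCoeff (j + 1)) v)]
    simp [smul_comm c]

theorem vir_mem_eigenspace (j n : ℤ) {v : V} (hv : v ∈ (𝒱.vir 0).eigenspace (n : ℂ)) :
    𝒱.vir j v ∈ (𝒱.vir 0).eigenspace ((n - j : ℤ) : ℂ) := by
  rw [Module.End.mem_eigenspace_iff] at hv ⊢
  have h : 𝒱.vir 0 (𝒱.vir j v) - 𝒱.vir j (𝒱.vir 0 v) = -(j : ℂ) • 𝒱.vir j v := by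
    have := 𝒱.virasoro 0 j v
    simp only [zero_add, Int.cast_zero, zero_sub] at this
    simp only [vir, mode, zero_add]
    rw [this]
    simp
  rw [hv, map_smul, sub_eq_iff_eq_add] at h
  rw [h, ← add_smul]
  congr 1
  push_cast
  ring

theorem locallyNilpotent_neg_virPlus : LocallyNilpotent (-𝒱.virPlus) := by
  refine locallyNilpotent_of_iSup 𝒱.isInternal_vir_zero.submodule_iSup_eq_top ?_
  obtain ⟨N, hN⟩ := 𝒱.bounded_below
  have key : ∀ (d : ℕ) (n : ℤ), n < N + d → ∀ v ∈ (𝒱.vir 0).eigenspace (n : ℂ),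
      v ∈ (-𝒱.virPlus).maxGenEigenspace 0 := by
    intro d
    induction d with
    | zero =>
      intro n hn v hv
      have h0 := hN n (by simpa using hn)
      have : v ∈ (⊥ : Submodule ℂ V) := by
        rw [← h0]; simpa [vir, mode] using hv
      rw [(Submodule.mem_bot ℂ).1 this]
      exact Submodule.zero_mem _
    | succ d ih =>
      intro n hn v hv
      have h1 : (-𝒱.virPlus) v ∈ (-𝒱.virPlus).maxGenEigenspace 0 := by
        rw [LinearMap.neg_apply]
        refine Submodule.neg_mem _ ?_
        show ∑ᶠ j : ℕ, coordCoeff (j + 1) • 𝒱.vir (j + 1) v ∈ _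
        refine finsum_induction (· ∈ (-𝒱.virPlus).maxGenEigenspace 0)
          (Submodule.zero_mem _) (fun _ _ => Submodule.add_mem _) fun j => ?_
        refine Submodule.smul_mem _ _ (ih (n - (j + 1)) (by push_cast at hn; omega) _ ?_)
        exact 𝒱.vir_mem_eigenspace (j + 1) n hv
      obtain ⟨k, hk⟩ := (Module.End.mem_maxGenEigenspace _ _ _).1 h1
      refine (Module.End.mem_maxGenEigenspace _ _ _).2 ⟨k + 1, ?_⟩
      rw [zero_smul, sub_zero] at hk ⊢
      rw [pow_succ, Module.End.mul_apply, hk]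
  intro n v hv
  obtain ⟨k, hk⟩ := (Module.End.mem_maxGenEigenspace _ _ _).1
    (key (n - N + 1).toNat n (by omega) v hv)
  exact ⟨k, by simpa using hk⟩

/-- `𝒰(1) = (2 π √-1)^{L(0)} e^{-L_+(A)}` -/
def opU : Module.End ℂ V :=
  scalarPow twoPiI (𝒱.vir 0) 𝒱.isInternal_vir_zero *
    evalSeries (PowerSeries.exp ℂ) (-𝒱.virPlus) 𝒱.locallyNilpotent_neg_virPlus

end VertexOperatorAlgebra

/-! ### The operators attached to an automorphism -/

/-- For `μ ≠ 0`, the unique `a` with `e^{2 π √-1 a} = μ` and `0 ≤ Re a < 1`. -/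
def gWeight (μ : ℂ) : ℂ :=
  Complex.log μ / twoPiI - (⌊(Complex.log μ / twoPiI).re⌋ : ℂ)

namespace VOAAut

variable {𝒱 : VertexOperatorAlgebra V} (g : VOAAut 𝒱)

/-- `g` as a linear operator on `V`. -/
def op : Module.End ℂ V := g.toEquiv.toLinearMap

theorem op_vir (n : ℤ) (v : V) : g.op (𝒱.vir n v) = 𝒱.vir n (g.op v) := by
  simp only [op, VertexOperatorAlgebra.vir, LinearEquiv.coe_coe, g.map_mode, g.map_conf]

/-- `V` is the direct sum of the generalized eigenspaces of `g`.  The space `V^{[α]}` is the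
generalized eigenspace of `g` with eigenvalue `e^{2 π √-1 α}`. -/
theorem isInternal_genEigenspace :
    DirectSum.IsInternal fun μ : ℂ => g.op.maxGenEigenspace μ := by
  apply DirectSum.isInternal_submodule_of_iSupIndep_of_iSup_eq_top
    (Module.End.independent_maxGenEigenspace _)
  rw [eq_top_iff, ← 𝒱.isInternal_vir_zero.submodule_iSup_eq_top]
  refine iSup_le fun n => ?_
  have hinv : ∀ v ∈ (𝒱.vir 0).eigenspace (n : ℂ), g.op v ∈ (𝒱.vir 0).eigenspace (n : ℂ) := by
    intro v hv
    rw [Module.End.mem_eigenspace_iff] at hv ⊢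
    rw [← g.op_vir, hv, map_smul]
  have hfin : FiniteDimensional ℂ ((𝒱.vir 0).eigenspace (n : ℂ)) := by
    have := 𝒱.finite_weight n
    have e : 𝒱.vir 0 = VertexOperator.ncoeff (𝒱.Y 𝒱.conf) 1 := rfl
    rw [e]
    exact this
  have htop := Module.End.iSup_maxGenEigenspace_eq_top (g.op.restrict hinv)
  intro v hv
  have hmap := congrArg (Submodule.map ((𝒱.vir 0).eigenspace (n : ℂ)).subtype) htop
  rw [Submodule.map_top, Submodule.range_subtype, Submodule.map_iSup] at hmap
  rw [← hmap] at hv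
  refine (iSup_mono fun μ => ?_ : _ ≤ ⨆ μ : ℂ, g.op.maxGenEigenspace μ) hv
  rintro _ ⟨x, hx, rfl⟩
  obtain ⟨k, hk⟩ := (Module.End.mem_maxGenEigenspace _ _ _).1 hx
  refine (Module.End.mem_maxGenEigenspace _ _ _).2 ⟨k, ?_⟩
  have hpow : ∀ (k : ℕ) (y : (𝒱.vir 0).eigenspace (n : ℂ)),
      ((((g.op.restrict hinv : Module.End ℂ ((𝒱.vir 0).eigenspace (n : ℂ))) -
        μ • (1 : Module.End ℂ ((𝒱.vir 0).eigenspace (n : ℂ)))) ^ k) y : V) =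
        ((g.op - μ • (1 : Module.End ℂ V)) ^ k) (y : V) := by
    intro k
    induction k with
    | zero => intro y; simp
    | succ k ih => intro y; rw [pow_succ, pow_succ, Module.End.mul_apply, ih]; simp
  have := hpow k x
  rw [hk] at this
  simpa using this.symm

/-- The operator `𝐀_V`: multiplication by `a` on `V^{[a + ℤ]}`, where `0 ≤ Re a < 1`. -/
def opA : Module.End ℂ V := diagOp g.isInternal_genEigenspace gWeight

/-- The unipotent part `g_u = σ⁻¹ g` of `g`, where the semisimple part `σ` of `g` is
multiplication by `μ` on the generalized eigenspace of `g` with eigenvalue `μ`. -/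
def unipotentPart : Module.End ℂ V :=
  diagOp g.isInternal_genEigenspace (fun μ => μ⁻¹) * g.op

theorem locallyNilpotent_unipotentPart_sub_one : LocallyNilpotent (g.unipotentPart - 1) := by
  refine locallyNilpotent_of_iSup g.isInternal_genEigenspace.submodule_iSup_eq_top ?_
  intro μ v hv
  obtain ⟨k, hk⟩ := (Module.End.mem_maxGenEigenspace _ _ _).1 hv
  by_cases hμ : μ = 0
  · subst hμ
    rw [zero_smul, sub_zero] at hk
    have hinj : Function.Injective (g.op ^ k) := by
      rw [Module.End.coe_pow]
      exact g.toEquiv.injective.iterate k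
    refine ⟨0, ?_⟩
    rw [pow_zero, Module.End.one_apply]
    exact hinj (by rw [hk, map_zero])
  · refine ⟨k, ?_⟩
    have step : ∀ w ∈ g.op.maxGenEigenspace μ, (g.unipotentPart - 1) w =
        μ⁻¹ • (g.op - μ • (1 : Module.End ℂ V)) w := by
      intro w hw
      have hgw : g.op w ∈ g.op.maxGenEigenspace μ :=
        Module.End.mapsTo_maxGenEigenspace_of_comm (Commute.refl g.op) μ hw
      rw [unipotentPart, LinearMap.sub_apply, Module.End.mul_apply, diagOp_apply _ _ hgw]
      simp [smul_sub, smul_smul, hμ]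
    have hmem : ∀ m : ℕ, ((g.op - μ • (1 : Module.End ℂ V)) ^ m) v ∈ g.op.maxGenEigenspace μ := by
      intro m
      refine Module.End.mapsTo_maxGenEigenspace_of_comm ?_ μ hv
      exact ((Commute.refl g.op).sub_right ((Commute.one_right g.op).smul_right μ)).pow_right m
    have hpow : ∀ m : ℕ, ((g.unipotentPart - 1) ^ m) v =
        (μ⁻¹) ^ m • ((g.op - μ • (1 : Module.End ℂ V)) ^ m) v := by
      intro m
      induction m with
      | zero => simp
      | succ m ih =>
        rw [pow_succ', Module.End.mul_apply, ih, map_smul, step _ (hmem m), smul_smul,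
          ← Module.End.mul_apply, ← pow_succ', ← pow_succ]
    rw [hpow, hk, smul_zero]

/-- `𝒩 = (1 / 2 π √-1) log g_u = (1 / 2 π √-1) ∑_{j ≥ 1} (-1)^{j+1} (g_u - 1)^j / j` -/
def opN : Module.End ℂ V :=
  twoPiI⁻¹ • evalSeries (PowerSeries.log ℂ) (g.unipotentPart - 1)
    g.locallyNilpotent_unipotentPart_sub_one

/-- The operator `𝐋`: on homogeneous `u ∈ V^{[a + ℤ]}`, with `0 ≤ Re a < 1`, it is multiplication
by `wt u + a` if `Re a = 0`, and by `wt u + a - 1` if `0 < Re a < 1`. -/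
def opL : Module.End ℂ V :=
  𝒱.vir 0 + diagOp g.isInternal_genEigenspace fun μ =>
    if (gWeight μ).re = 0 then gWeight μ else gWeight μ - 1

theorem opL_sub_apply {μ : ℂ} {v : V} (hv : v ∈ g.op.maxGenEigenspace μ) :
    (𝒱.vir 0 - g.opL + g.opA) v = if (gWeight μ).re = 0 then 0 else v := by
  rw [opL, opA, LinearMap.add_apply, LinearMap.sub_apply, LinearMap.add_apply,
    diagOp_apply _ _ hv, diagOp_apply _ _ hv]
  split_ifs <;> simp [sub_smul]

/-- `L(0) - 𝐋 + 𝐀_V` acts semisimply with integer eigenvalues (which are `0` and `1`). -/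
theorem isInternal_opL_sub :
    DirectSum.IsInternal fun k : ℤ => (𝒱.vir 0 - g.opL + g.opA).eigenspace (k : ℂ) := by
  apply DirectSum.isInternal_submodule_of_iSupIndep_of_iSup_eq_top
  · exact (Module.End.eigenspaces_iSupIndep _).comp Int.cast_injective
  · rw [eq_top_iff, ← g.isInternal_genEigenspace.submodule_iSup_eq_top]
    refine iSup_le fun μ v hv => ?_
    have h := g.opL_sub_apply hv
    split_ifs at h with hμ
    · exact Submodule.mem_iSup_of_mem (0 : ℤ) (Module.End.mem_eigenspace_iff.2 (by simpa using h))
    · exact Submodule.mem_iSup_of_mem (1 : ℤ) (Module.End.mem_eigenspace_iff.2 (by simpa using h))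

/-! ### The two products and the two quotients -/

/-- `u •_g v = Res_y y⁻¹ Y((1 + y)^{𝐋 - L(0) + 𝒩} u, (1 / 2 π √-1) log (1 + y)) v` -/
def bullet (u v : V) : V :=
  resY 𝒱 logY (shift (-1) (onePlusPow (g.opL - 𝒱.vir 0 + g.opN) u)) v

/-- `Õ_g(V)`, the span of
`Res_y y⁻ⁿ Y(y^{L(0) - 𝐋 + 𝐀} (1 + y)^{𝐋 - L(0) + 𝒩} u, (1 / 2 π √-1) log (1 + y)) v`
for `n > 1`. -/
def tildeO : Submodule ℂ V :=
  Submodule.span ℂ {z | ∃ (n : ℤ) (u v : V), 1 < n ∧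
    z = resY 𝒱 logY (shift (-n) (varPow (𝒱.vir 0 - g.opL + g.opA) g.isInternal_opL_sub
      (onePlusPow (g.opL - 𝒱.vir 0 + g.opN) u))) v}

/-- `u *_g v = Res_x x⁻¹ Y((1 + x)^{𝐋 + 𝒩} u, x) v` -/
def star (u v : V) : V :=
  resY 𝒱 varY (shift (-1) (onePlusPow (g.opL + g.opN) u)) v

/-- `O_g(V)`, the span of `Res_x x⁻ⁿ Y(x^{L(0) - 𝐋 + 𝐀} (1 + x)^{𝐋 + 𝒩} u, x) v` for `n > 1`. -/
def ordO : Submodule ℂ V :=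
  Submodule.span ℂ {z | ∃ (n : ℤ) (u v : V), 1 < n ∧
    z = resY 𝒱 varY (shift (-n) (varPow (𝒱.vir 0 - g.opL + g.opA) g.isInternal_opL_sub
      (onePlusPow (g.opL + g.opN) u))) v}

/-- `Ã_g(V) = V / Õ_g(V)` -/
abbrev TildeA : Type _ := V ⧸ g.tildeO

/-- `A_g(V) = V / O_g(V)` -/
abbrev OrdA : Type _ := V ⧸ g.ordO

end VOAAut

/-- A bilinear product `m` on a complex vector space `M` together with an element `e` makes `M` an
associative algebra with identity `e`. -/
structure IsAssociativeAlgebra {M : Type*} [AddCommGroup M] [Module ℂ M]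
    (m : M →ₗ[ℂ] M →ₗ[ℂ] M) (e : M) : Prop where
  assoc : ∀ x y z : M, m (m x y) z = m x (m y z)
  one_mul : ∀ x : M, m e x = x
  mul_one : ∀ x : M, m x e = x

end TwistedZhu

end

/-!
The proof makes `A_g(V)` an algebra by means of a Jacobi identity for twisted modes, and then
recognizes `𝒰(1)` as a change of coordinate that turns `•_g` into `*_g` and the generators of
`Õ_g(V)` into those of `O_g(V)`; the structure of `Ã_g(V)` is transported along `𝒰(1)`.

**The algebra `A_g(V)`.**  The operator `𝐋 + 𝒩` is `L(0) + P`, where `P` is a logarithm of `g`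
divided by `2 π √-1`.  Since `log` of the unipotent part of `g` is a derivation of all products
`u_m v` (`evalSeries_log_bilinear`), and since the eigenvalues of `𝐋 - L(0)` are additive up to an
integer `k`, the operator `B = 𝐋 + 𝒩` satisfies `B (u_m v) = (B u)_m v + u_m (B v) + (k - m - 1)
u_m v` for `u`, `v` in generalized eigenspaces of `g` (`opL_add_opN_mode`).  Its integrated form,
conjugation of `Y(u, z)` by `(1 + x)^B`, turns the Jacobi identity of `V` into one for the twisted
modes `Res_x x^m Y((1 + x)^B u, x) v` (`twisted_jacobi`).  Because `L(0) - 𝐋 + 𝐀` is a projection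
that commutes with `B`, the space `O_g(V)` is spanned by the twisted modes with
`m ≤ -poleOrder μ`, where `u` runs over the generalized eigenspace for `μ` and `poleOrder μ` is
`2` or `1` according as `Re a = 0` or not (`tm_mem_ordO`, `ordO_le`).  Special cases of the twisted
Jacobi identity now show that `O_g(V)` is a two-sided ideal for `*_g` (`star_mem_ordO_right`,
`star_mem_ordO_left`) and that `*_g` is associative modulo `O_g(V)` (`star_assoc`).

**The change of coordinate.**  In the coordinate `x = 2 π √-1 y` the vector field `∑ A_j y^{j+1}
d/dy` becomes some `a(x) d/dx` such that the flow of `-a d/dx` at time one is `e^x - 1`, and `𝒰(1) =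
e^{-L_a} (2 π √-1)^{L(0)}` for the corresponding sum `L_a` of Virasoro operators.  The operators
`Res_x h(x) Y(u, x)` depend linearly on `h ⊗ u ∈ ℂ((x)) ⊗ V`, and the commutator with `L_a` comes
from an operator `ρ_a` on `ℂ((x)) ⊗ V` (`virSeries_vop`, `vop_rho`).  A correction by a total
derivative arranges that `b ↦ -ρ_b` is a representation of the Lie algebra of vector fields and
`-ρ_a` acts on coefficients by `a d/dx` (`rho_bracket`, `rho_smul`).  Hence conjugation by
`e^{-L_a}` sends `h ⊗ u` to `h(log(1 + x)) exp(-ρ_a)(1 ⊗ u)`.  Now `ρ_1 (1 ⊗ u) = 0`, and the flow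
carries `d/dx` to `(1 + x) d/dx`, so `exp(-ρ_a)(1 ⊗ u)` is killed by `ρ_{1 + x}`.  This is a
differential equation, whose solution is `(1 + x)^{L(0) - 1} e^{-L_a} u` (`tcoeff_flowElt_sub_mem`).
Altogether `𝒰(1)` turns `Y(u, (1 / 2 π √-1) log(1 + y))` into `Y((1 + y)^{L(0)} 𝒰(1) u, y)`
(`exists_expTrunc_mode`, `exists_opU_mode`).  All exponentials are truncated; what is dropped lies
deep in the filtration of `ℂ((x)) ⊗ V` by order minus weight and does not matter, since the weights
of `V` are bounded below.

**The isomorphism.**  As `𝒰(1)` commutes with `P`, inserting `(1 + y)^P` and expanding residues in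
powers of `(1 / 2 π √-1) log(1 + y)` (`apply_eq_sum_residue`) shows that `𝒰(1)` maps the residues
that define `•_g` and `Õ_g(V)` to twisted modes (`opU_resY`).  So `𝒰(1)` is a bijection of
`V` that fixes the vacuum, carries `•_g` to `*_g` (`opU_bullet`) and `Õ_g(V)` onto `O_g(V)`
(`map_opU_tildeO`).
-/

noncomputable section

namespace TwistedZhu

open Finset.HasAntidiagonal (antidiagonal mem_antidiagonal)

/-! ### Finite sums over triangles and squares -/

section Sums

open Finset (range mem_range mem_sigma mem_filter mem_product)

/-- A sum over the triangle `i + j < M` as a sum over a square, if the summand vanishes outside the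
triangle.  This is how truncated products of series are compared throughout. -/
theorem sum_range_antidiagonal {E : Type*} [AddCommMonoid E] {M : ℕ} {G : ℕ → ℕ → E}
    (h : ∀ i j, M ≤ i + j → G i j = 0) :
    ∑ n ∈ range M, ∑ p ∈ antidiagonal n, G p.1 p.2 = ∑ i ∈ range M, ∑ j ∈ range M, G i j := by
  rw [← Finset.sum_product', Finset.sum_sigma',
    ← Finset.sum_filter_of_ne (s := range M ×ˢ range M) (p := fun q => q.1 + q.2 < M)]
  · refine Finset.sum_bij' (fun x _ => x.2) (fun q _ => ⟨q.1 + q.2, q⟩) ?_ ?_ ?_ ?_ ?_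
    · rintro ⟨n, a, b⟩ hx
      simp only [mem_sigma, mem_range, mem_antidiagonal] at hx
      simp only [mem_filter, mem_product, mem_range]
      omega
    · rintro ⟨a, b⟩ hx
      simp only [mem_filter, mem_product, mem_range] at hx
      simp only [mem_sigma, mem_range, mem_antidiagonal, and_true]
      omega
    · rintro ⟨n, a, b⟩ hx
      simp only [mem_sigma, mem_range, mem_antidiagonal] at hx
      obtain ⟨_, rfl⟩ := hx
      rfl
    · intro _ _; rfl
    · intro _ _; rfl
  · rintro ⟨a, b⟩ _ hne
    by_contra hlt
    exact hne (h a b (not_lt.mp hlt))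

theorem sum_range_choose {E : Type*} [AddCommMonoid E] {M : ℕ} {H : ℕ → E}
    (h : ∀ j, M ≤ j → H j = 0) (t : ℕ) :
    ∑ j ∈ range M, j.choose t • H j = ∑ d ∈ range M, (t + d).choose t • H (t + d) := by
  by_cases ht : t ≤ M
  · obtain ⟨r, rfl⟩ := Nat.exists_eq_add_of_le ht
    rw [Finset.sum_range_add, Finset.sum_eq_zero, zero_add, add_comm t r, Finset.sum_range_add]
    · rw [Finset.sum_eq_zero (s := range t), add_zero]
      exact fun x _ => by rw [h _ (by omega), smul_zero]
    · intro x hx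
      rw [Nat.choose_eq_zero_of_lt (mem_range.mp hx), zero_smul]
  · rw [Finset.sum_eq_zero, Finset.sum_eq_zero]
    · intro x _
      rw [h _ (by omega), smul_zero]
    · intro x hx
      rw [Nat.choose_eq_zero_of_lt (by have := mem_range.mp hx; omega), zero_smul]

/-- Reindexing of the sum that expresses multiplication by `x₁ + x₂` on divided powers. -/
theorem sum_antidiagonal_succ_smul {E : Type*} [AddCommGroup E] [Module ℂ E] (G : ℕ → ℕ → E)
    (n : ℕ) :
    ∑ p ∈ antidiagonal n, (((p.1 : ℂ) + 1) • G (p.1 + 1) p.2 + ((p.2 : ℂ) + 1) • G p.1 (p.2 + 1)) =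
      ((n : ℂ) + 1) • ∑ p ∈ antidiagonal (n + 1), G p.1 p.2 := by
  have e : ((n : ℂ) + 1) • ∑ p ∈ antidiagonal (n + 1), G p.1 p.2 =
      ∑ p ∈ antidiagonal (n + 1), (p.1 : ℂ) • G p.1 p.2 +
        ∑ p ∈ antidiagonal (n + 1), (p.2 : ℂ) • G p.1 p.2 := by
    rw [← Finset.sum_add_distrib, Finset.smul_sum]
    refine Finset.sum_congr rfl fun p hp => ?_
    rw [← add_smul]
    congr 1
    have := mem_antidiagonal.mp hp
    exact_mod_cast this.symm
  rw [e, Finset.sum_add_distrib, Finset.Nat.sum_antidiagonal_succ,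
    Finset.Nat.sum_antidiagonal_succ' (n := n) (f := fun p => (p.2 : ℂ) • G p.1 p.2)]
  simp

theorem sum_comm_three {E : Type*} [AddCommMonoid E] {α β γ : Type*} (s : Finset α) (t : Finset β)
    (r : Finset γ) (F : α → β → γ → E) :
    ∑ i ∈ s, ∑ j ∈ t, ∑ k ∈ r, F i j k = ∑ k ∈ r, ∑ i ∈ s, ∑ j ∈ t, F i j k :=
  (Finset.sum_congr rfl fun _ _ => Finset.sum_comm).trans Finset.sum_comm

/-- Reindexing of a sum with the structure constants `i - j` of the Lie algebra of vector fields. -/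
theorem sum_antidiagonal_succ_sub_smul {E : Type*} [AddCommGroup E] [Module ℂ E] (G : ℕ → ℕ → E)
    (n : ℕ) :
    ∑ p ∈ antidiagonal (n + 1), ((p.1 : ℂ) - p.2) • G p.1 p.2 =
      ∑ p ∈ antidiagonal n,
        (((p.1 : ℂ) + 1) • G (p.1 + 1) p.2 - ((p.2 : ℂ) + 1) • G p.1 (p.2 + 1)) := by
  simp only [sub_smul]
  rw [Finset.sum_sub_distrib, Finset.sum_sub_distrib,
    Finset.Nat.sum_antidiagonal_succ (f := fun p => (p.1 : ℂ) • G p.1 p.2),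
    Finset.Nat.sum_antidiagonal_succ' (f := fun p => (p.2 : ℂ) • G p.1 p.2)]
  simp

end Sums

/-! ### Binomial operators -/

section Binomial

variable {V : Type*} [AddCommGroup V] [Module ℂ V]

theorem binomOp_zero (B : Module.End ℂ V) : binomOp B 0 = 1 := by simp [binomOp]

theorem binomOp_succ (B : Module.End ℂ V) (n : ℕ) (v : V) :
    ((n : ℂ) + 1) • binomOp B (n + 1) v = B (binomOp B n v) - (n : ℂ) • binomOp B n v := by
  have hn : ((n : ℂ) + 1) ≠ 0 := by exact_mod_cast Nat.succ_ne_zero n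
  have hc : descPochhammer ℂ (n + 1) = (Polynomial.X - (n : Polynomial ℂ)) * descPochhammer ℂ n := by
    rw [descPochhammer_succ_right, mul_comm]
  rw [binomOp, binomOp, hc, map_mul, Nat.factorial_succ]
  simp only [Nat.cast_mul, Nat.cast_add, Nat.cast_one, mul_inv, map_sub, Polynomial.aeval_X,
    map_natCast, LinearMap.smul_apply, Module.End.mul_apply, LinearMap.sub_apply, smul_smul]
  rw [mul_inv_cancel_left₀ hn, smul_sub, map_smul, mul_comm, ← smul_smul]
  congr 1
  rw [Module.End.natCast_apply, Nat.cast_smul_eq_nsmul, smul_comm]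

theorem binomOp_succ_apply (B : Module.End ℂ V) (n : ℕ) (v : V) :
    binomOp B (n + 1) v = ((n : ℂ) + 1)⁻¹ • (B (binomOp B n v) - (n : ℂ) • binomOp B n v) := by
  have hn : ((n : ℂ) + 1) ≠ 0 := by exact_mod_cast Nat.succ_ne_zero n
  rw [← binomOp_succ, inv_smul_smul₀ hn]

theorem apply_binomOp (B : Module.End ℂ V) (n : ℕ) (v : V) :
    B (binomOp B n v) = ((n : ℂ) + 1) • binomOp B (n + 1) v + (n : ℂ) • binomOp B n v := by
  rw [binomOp_succ, sub_add_cancel]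

theorem binomOp_mem {B : Module.End ℂ V} {W : Submodule ℂ V} (hW : ∀ u ∈ W, B u ∈ W) (n : ℕ)
    {u : V} (hu : u ∈ W) : binomOp B n u ∈ W := by
  induction n with
  | zero => simpa [binomOp_zero] using hu
  | succ n ih =>
    rw [binomOp_succ_apply]
    exact W.smul_mem _ (W.sub_mem (hW _ ih) (W.smul_mem _ ih))

theorem binomOp_intertwine {V' : Type*} [AddCommGroup V'] [Module ℂ V'] {B : Module.End ℂ V}
    {B' : Module.End ℂ V'} (T : V →ₗ[ℂ] V') (h : ∀ u, T (B u) = B' (T u)) (n : ℕ) (u : V) :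
    T (binomOp B n u) = binomOp B' n (T u) := by
  induction n with
  | zero => simp [binomOp_zero]
  | succ n ih => rw [binomOp_succ_apply, binomOp_succ_apply, map_smul, map_sub, h, ih, map_smul, ih]

/-- The common source of the Vandermonde identities: if `C` acts on the family `G i j` as `X + Y`
acts on `binom(X, i) binom(Y, j)`, then `binom(C, n) (G 0 0)` is the sum of the `G i j` with
`i + j = n`. -/
theorem binomOp_eq_sum_antidiagonal {C : Module.End ℂ V} {G : ℕ → ℕ → V}
    (h : ∀ i j, C (G i j) = ((i : ℂ) + 1) • G (i + 1) j + ((j : ℂ) + 1) • G i (j + 1) +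
      ((i : ℂ) + j) • G i j) (n : ℕ) :
    binomOp C n (G 0 0) = ∑ p ∈ antidiagonal n, G p.1 p.2 := by
  induction n with
  | zero => simp [binomOp_zero]
  | succ n ih =>
    have hn : ((n : ℂ) + 1) ≠ 0 := by exact_mod_cast Nat.succ_ne_zero n
    rw [binomOp_succ_apply, ih, map_sum, Finset.smul_sum, ← Finset.sum_sub_distrib,
      inv_smul_eq_iff₀ hn, ← sum_antidiagonal_succ_smul]
    refine Finset.sum_congr rfl fun p hp => ?_
    rw [h]
    have : (n : ℂ) = (p.1 : ℂ) + p.2 := by exact_mod_cast (mem_antidiagonal.mp hp).symm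
    rw [this, add_sub_cancel_right]

/-- Vandermonde identity for derivations: if `C β(u, v) = β(A u, v) + β(u, B v)`, then `(1 + x)^C
β(u, v) = β((1 + x)^A u, (1 + x)^B v)`. -/
theorem binomOp_bilinear {V₁ V₂ : Type*} [AddCommGroup V₁] [Module ℂ V₁] [AddCommGroup V₂]
    [Module ℂ V₂] (β : V₁ →ₗ[ℂ] V₂ →ₗ[ℂ] V) {A : Module.End ℂ V₁} {B : Module.End ℂ V₂}
    {C : Module.End ℂ V} {W₁ : Submodule ℂ V₁} {W₂ : Submodule ℂ V₂}
    (hA : ∀ u ∈ W₁, A u ∈ W₁) (hB : ∀ v ∈ W₂, B v ∈ W₂)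
    (h : ∀ u ∈ W₁, ∀ v ∈ W₂, C (β u v) = β (A u) v + β u (B v)) (n : ℕ) {u : V₁} (hu : u ∈ W₁)
    {v : V₂} (hv : v ∈ W₂) :
    binomOp C n (β u v) =
      ∑ p ∈ antidiagonal n, β (binomOp A p.1 u) (binomOp B p.2 v) := by
  have := binomOp_eq_sum_antidiagonal (C := C)
    (G := fun i j => β (binomOp A i u) (binomOp B j v)) (fun i j => ?_) n
  · simpa [binomOp_zero] using this
  · rw [h _ (binomOp_mem hA i hu) _ (binomOp_mem hB j hv), apply_binomOp, apply_binomOp]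
    simp only [map_add, map_smul, LinearMap.add_apply, LinearMap.smul_apply, add_smul]
    abel

theorem binomOp_add {X Y : Module.End ℂ V} (h : ∀ v, X (Y v) = Y (X v)) (n : ℕ) (v : V) :
    binomOp (X + Y) n v = ∑ p ∈ antidiagonal n, binomOp X p.1 (binomOp Y p.2 v) := by
  have := binomOp_eq_sum_antidiagonal (C := X + Y)
    (G := fun i j => binomOp X i (binomOp Y j v)) (fun i j => ?_) n
  · simpa [binomOp_zero] using this
  · rw [LinearMap.add_apply, apply_binomOp,
      binomOp_intertwine Y (B' := X) (fun u => (h u).symm), apply_binomOp Y]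
    simp only [map_add, map_smul, add_smul]
    abel

theorem choose_succ_int (r : ℤ) (n : ℕ) :
    ((n : ℤ) + 1) * Ring.choose r (n + 1) = (r - n) * Ring.choose r n := by
  have h1 := Ring.descPochhammer_eq_factorial_smul_choose r (n + 1)
  have h2 := Ring.descPochhammer_eq_factorial_smul_choose r n
  rw [descPochhammer_succ_right, mul_comm, Polynomial.smeval_mul, h2, Nat.factorial_succ] at h1
  simp only [Polynomial.smeval_sub, Polynomial.smeval_X, pow_one, Polynomial.smeval_natCast,
    pow_zero, nsmul_eq_mul, mul_one] at h1
  have hf : (n.factorial : ℤ) ≠ 0 := by exact_mod_cast Nat.factorial_ne_zero n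
  apply mul_left_cancel₀ hf
  push_cast at h1
  linear_combination -h1

/-- On an eigenvector for an integer `r`, `binom(B, n)` is the number `binom(r, n)`. -/
theorem binomOp_eigen {B : Module.End ℂ V} {r : ℤ} {v : V} (h : B v = (r : ℂ) • v) (n : ℕ) :
    binomOp B n v = Ring.choose r n • v := by
  induction n with
  | zero => simp [binomOp_zero]
  | succ n ih =>
    have hn : ((n : ℂ) + 1) ≠ 0 := by exact_mod_cast Nat.succ_ne_zero n
    rw [binomOp_succ_apply, ih, map_zsmul, h, inv_smul_eq_iff₀ hn]
    simp only [← Int.cast_smul_eq_zsmul ℂ, smul_smul, ← sub_smul]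
    congr 1
    have := congrArg (Int.cast : ℤ → ℂ) (choose_succ_int r n)
    push_cast at this
    linear_combination -this

/-- `binom(B - t, d) binom(B, t) = binom(t + d, t) binom(B, t + d)`. -/
theorem binomOp_sub_natCast (B : Module.End ℂ V) (t d : ℕ) (v : V) :
    binomOp (B - (t : ℂ) • 1) d (binomOp B t v) = (t + d).choose t • binomOp B (t + d) v := by
  induction d with
  | zero => simp [binomOp_zero]
  | succ d ih =>
    have hn : ((d : ℂ) + 1) ≠ 0 := by exact_mod_cast Nat.succ_ne_zero d
    have hc : ((d : ℂ) + 1) * ((t + (d + 1)).choose t : ℂ) =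
        ((t : ℂ) + d + 1) * ((t + d).choose t : ℂ) := by
      have := Nat.add_one_mul_choose_eq (t + d) d
      have e1 : (t + (d + 1)).choose t = (t + d + 1).choose (d + 1) := by
        rw [← add_assoc, ← Nat.choose_symm_of_eq_add]; omega
      have e2 : (t + d).choose t = (t + d).choose d := by
        rw [← Nat.choose_symm_of_eq_add]; omega
      rw [e1, e2]
      exact_mod_cast (by linarith : (d + 1) * (t + d + 1).choose (d + 1) =
        (t + d + 1) * (t + d).choose d)
    rw [binomOp_succ_apply, ih, inv_smul_eq_iff₀ hn]
    simp only [LinearMap.sub_apply, LinearMap.smul_apply, Module.End.one_apply, map_nsmul,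
      apply_binomOp]
    simp only [← Nat.cast_smul_eq_nsmul ℂ, smul_smul, ← add_assoc]
    rw [← add_assoc] at hc
    rw [hc]
    push_cast
    module

/-- `binom(B + c, n) = ∑ binom(c, s) binom(B, r)` over `s + r = n`, for an integer `c`. -/
theorem binomOp_add_intCast (B : Module.End ℂ V) (c : ℤ) (n : ℕ) (v : V) :
    binomOp (B + (c : ℂ) • 1) n v =
      ∑ p ∈ antidiagonal n, Ring.choose c p.1 • binomOp B p.2 v := by
  rw [add_comm B, binomOp_add (by intro v; simp)]
  refine Finset.sum_congr rfl fun p _ => ?_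
  rw [binomOp_eigen (r := c) (by simp)]

theorem choose_add_natCast (m : ℤ) (j n : ℕ) :
    Ring.choose (m + j) n =
      ∑ p ∈ antidiagonal n, Ring.choose m p.1 * (j.choose p.2 : ℤ) := by
  rw [Ring.add_choose_eq n (Commute.all _ _)]
  simp [Ring.choose_natCast]

end Binomial

/-! ### Modes and weights -/

namespace VertexOperatorAlgebra

variable {V : Type*} [AddCommGroup V] [Module ℂ V] (𝒱 : VertexOperatorAlgebra V)

/-- The bilinear map `(u, v) ↦ u_m v`. -/
def modeBilin (m : ℤ) : V →ₗ[ℂ] V →ₗ[ℂ] V :=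
  LinearMap.proj m ∘ₗ VertexOperator.ncoeff ∘ₗ 𝒱.Y

theorem modeBilin_apply (m : ℤ) (u v : V) : 𝒱.modeBilin m u v = 𝒱.mode u m v := rfl

theorem mode_add (u u' : V) (m : ℤ) (v : V) :
    𝒱.mode (u + u') m v = 𝒱.mode u m v + 𝒱.mode u' m v := by
  simp only [← modeBilin_apply, map_add, LinearMap.add_apply]

theorem mode_smul (c : ℂ) (u : V) (m : ℤ) (v : V) :
    𝒱.mode (c • u) m v = c • 𝒱.mode u m v := by
  simp only [← modeBilin_apply, map_smul, LinearMap.smul_apply]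

theorem mode_zsmul (c : ℤ) (u : V) (m : ℤ) (v : V) :
    𝒱.mode (c • u) m v = c • 𝒱.mode u m v := by
  simp only [← modeBilin_apply, map_zsmul, LinearMap.smul_apply]

theorem mode_nsmul (c : ℕ) (u : V) (m : ℤ) (v : V) :
    𝒱.mode (c • u) m v = c • 𝒱.mode u m v := by
  simp only [← modeBilin_apply, map_nsmul, LinearMap.smul_apply]

theorem mode_zero (m : ℤ) (v : V) : 𝒱.mode 0 m v = 0 := by
  simp only [← modeBilin_apply, map_zero, LinearMap.zero_apply]

theorem mode_sum {ι : Type*} (s : Finset ι) (f : ι → V) (m : ℤ) (v : V) :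
    𝒱.mode (∑ i ∈ s, f i) m v = ∑ i ∈ s, 𝒱.mode (f i) m v := by
  simp only [← modeBilin_apply, map_sum, LinearMap.sum_apply]

/-- The commutator formula for a mode `ω_n` of the conformal vector with `n ≥ 0`, that is, for
`L(n - 1)`. -/
theorem conf_commutator (n : ℕ) (u : V) (m : ℤ) (v : V) :
    𝒱.mode 𝒱.conf n (𝒱.mode u m v) - 𝒱.mode u m (𝒱.mode 𝒱.conf n v) =
      ∑ i ∈ Finset.range (n + 1), n.choose i • 𝒱.mode (𝒱.mode 𝒱.conf i u) (m + n - i) v := by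
  have h := 𝒱.jacobi 𝒱.conf u v 0 n m
  rw [finsum_eq_sum_of_support_subset (s := Finset.range (n + 1)),
    finsum_eq_single _ 0] at h
  · simp only [zero_add, Nat.cast_zero, add_zero, sub_zero, pow_zero, Ring.choose_zero_right,
      one_mul, one_smul, zpow_zero] at h
    rw [show 𝒱.mode = fun u n => VertexOperator.ncoeff (𝒱.Y u) n from rfl]
    simp only
    rw [← h]
    refine Finset.sum_congr rfl fun i _ => ?_
    rw [Ring.choose_natCast, add_comm m]
    simp
  · intro i hi
    rw [Ring.choose_zero_pos ℤ (Nat.pos_of_ne_zero hi), mul_zero, zero_smul]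
  · intro i hi
    by_contra hlt
    apply hi
    simp only [Finset.coe_range, Set.mem_Iio, not_lt] at hlt
    simp only [Ring.choose_natCast]
    rw [Nat.choose_eq_zero_of_lt (by omega)]
    simp

theorem vir_neg_one_mode (u : V) (m : ℤ) (v : V) :
    𝒱.mode (𝒱.vir (-1) u) m v = -(m : ℂ) • 𝒱.mode u (m - 1) v :=
  𝒱.derivative u v m

/-- `L(0)` is a derivation of each product `u_m v`, up to the shift of weight `-m - 1`. -/
theorem vir_zero_mode (u : V) (m : ℤ) (v : V) :
    𝒱.vir 0 (𝒱.mode u m v) =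
      𝒱.mode (𝒱.vir 0 u) m v + 𝒱.mode u m (𝒱.vir 0 v) + ((-m - 1 : ℤ) : ℂ) • 𝒱.mode u m v := by
  have h := 𝒱.conf_commutator 1 u m v
  rw [Finset.sum_range_succ, Finset.sum_range_one] at h
  have h1 := 𝒱.vir_neg_one_mode u (m + 1) v
  simp only [vir, neg_add_cancel, zero_add, Nat.cast_one, Nat.choose_zero_right, one_smul,
    Nat.cast_zero, sub_zero, Nat.choose_self, add_sub_cancel_right] at h h1 ⊢
  rw [h1, sub_eq_iff_eq_add] at h
  rw [h]
  push_cast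
  module

theorem mode_mem_eigenspace {p q : ℤ} {u v : V} (hu : u ∈ (𝒱.vir 0).eigenspace (p : ℂ))
    (hv : v ∈ (𝒱.vir 0).eigenspace (q : ℂ)) (m : ℤ) :
    𝒱.mode u m v ∈ (𝒱.vir 0).eigenspace ((p + q - m - 1 : ℤ) : ℂ) := by
  rw [Module.End.mem_eigenspace_iff] at *
  rw [vir_zero_mode, hu, hv, mode_smul, map_smul]
  push_cast
  module

/-- The sum of the weight spaces `V_(k)` with `k ≤ n`. -/
def wtLE (n : ℤ) : Submodule ℂ V :=
  ⨆ k : {k : ℤ // k ≤ n}, (𝒱.vir 0).eigenspace ((k : ℤ) : ℂ)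

theorem eigenspace_le_wtLE {k n : ℤ} (h : k ≤ n) :
    (𝒱.vir 0).eigenspace (k : ℂ) ≤ 𝒱.wtLE n :=
  le_iSup (fun k : {k : ℤ // k ≤ n} => (𝒱.vir 0).eigenspace ((k : ℤ) : ℂ)) ⟨k, h⟩

theorem wtLE_le {n : ℤ} {W : Submodule ℂ V}
    (h : ∀ k ≤ n, (𝒱.vir 0).eigenspace (k : ℂ) ≤ W) : 𝒱.wtLE n ≤ W :=
  iSup_le fun k => h k k.2

theorem wtLE_mono {m n : ℤ} (h : m ≤ n) : 𝒱.wtLE m ≤ 𝒱.wtLE n :=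
  𝒱.wtLE_le fun _ hk => 𝒱.eigenspace_le_wtLE (hk.trans h)

theorem exists_mem_wtLE (v : V) : ∃ n : ℤ, v ∈ 𝒱.wtLE n := by
  have hv : v ∈ ⨆ k : ℤ, (𝒱.vir 0).eigenspace (k : ℂ) :=
    𝒱.isInternal_vir_zero.submodule_iSup_eq_top ▸ Submodule.mem_top
  refine Submodule.iSup_induction _ (motive := fun v => ∃ n : ℤ, v ∈ 𝒱.wtLE n) hv
    (fun k x hx => ⟨k, 𝒱.eigenspace_le_wtLE le_rfl hx⟩) ⟨0, Submodule.zero_mem _⟩ ?_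
  rintro x y ⟨a, ha⟩ ⟨b, hb⟩
  exact ⟨max a b, Submodule.add_mem _ (𝒱.wtLE_mono (le_max_left _ _) ha)
    (𝒱.wtLE_mono (le_max_right _ _) hb)⟩

/-- A lower bound for the weights of `V`. -/
def minWt : ℤ := 𝒱.bounded_below.choose

theorem eq_zero_of_mem_wtLE {n : ℤ} (hn : n < 𝒱.minWt) {v : V} (hv : v ∈ 𝒱.wtLE n) : v = 0 := by
  have : 𝒱.wtLE n ≤ ⊥ := 𝒱.wtLE_le fun k hk => by
    have := 𝒱.bounded_below.choose_spec k (lt_of_le_of_lt hk hn)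
    exact le_of_eq (by simpa [vir, mode] using this)
  simpa using this hv

/-- An operator that shifts weights by `d` shifts the filtration by `d`. -/
theorem map_mem_wtLE {T : V →ₗ[ℂ] V} {d : ℤ}
    (h : ∀ (k : ℤ), ∀ v ∈ (𝒱.vir 0).eigenspace (k : ℂ), T v ∈ (𝒱.vir 0).eigenspace ((k + d : ℤ) : ℂ))
    {n : ℤ} {v : V} (hv : v ∈ 𝒱.wtLE n) : T v ∈ 𝒱.wtLE (n + d) := by
  have : 𝒱.wtLE n ≤ (𝒱.wtLE (n + d)).comap T := 𝒱.wtLE_le fun k hk v hv =>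
    𝒱.eigenspace_le_wtLE (by omega) (h k v hv)
  exact this hv

theorem mode_mem_wtLE {p q : ℤ} {u v : V} (hu : u ∈ 𝒱.wtLE p) (hv : v ∈ 𝒱.wtLE q) (m : ℤ) :
    𝒱.mode u m v ∈ 𝒱.wtLE (p + q - m - 1) := by
  have : 𝒱.wtLE p ≤ (𝒱.wtLE (p + q - m - 1)).comap ((𝒱.modeBilin m).flip v) := by
    refine 𝒱.wtLE_le fun k hk u hu => ?_
    have := 𝒱.map_mem_wtLE (T := 𝒱.modeBilin m u) (d := k - m - 1) (fun j x hx => ?_) hv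
    · exact 𝒱.wtLE_mono (by omega) this
    · have := 𝒱.mode_mem_eigenspace hu hx m
      rwa [show k + j - m - 1 = j + (k - m - 1) by ring] at this
  exact this hu

theorem mode_eq_zero {p q : ℤ} {u v : V} (hu : u ∈ 𝒱.wtLE p) (hv : v ∈ 𝒱.wtLE q) {m : ℤ}
    (hm : p + q - m - 1 < 𝒱.minWt) : 𝒱.mode u m v = 0 :=
  𝒱.eq_zero_of_mem_wtLE hm (𝒱.mode_mem_wtLE hu hv m)

theorem vir_mem_wtLE (j : ℤ) {n : ℤ} {v : V} (hv : v ∈ 𝒱.wtLE n) : 𝒱.vir j v ∈ 𝒱.wtLE (n - j) := by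
  rw [sub_eq_add_neg]
  exact 𝒱.map_mem_wtLE (T := 𝒱.vir j)
    (fun k v hv => by rw [← sub_eq_add_neg]; exact 𝒱.vir_mem_eigenspace j k hv) hv

theorem mem_wtLE_of_commute {T : Module.End ℂ V} (h : ∀ v, T (𝒱.vir 0 v) = 𝒱.vir 0 (T v)) {n : ℤ}
    {v : V} (hv : v ∈ 𝒱.wtLE n) : T v ∈ 𝒱.wtLE n := by
  have := 𝒱.map_mem_wtLE (T := T) (d := 0) (fun k v hv => ?_) hv
  · simpa using this
  · rw [Module.End.mem_eigenspace_iff] at hv ⊢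
    rw [add_zero, ← h, hv, map_smul]

/-- The Jacobi identity with all sums cut off at `M`, where they have become zero. -/
theorem jacobi_range {p q r : ℤ} {u v w : V} (hu : u ∈ 𝒱.wtLE p) (hv : v ∈ 𝒱.wtLE q)
    (hw : w ∈ 𝒱.wtLE r) (l m n : ℤ) {M : ℕ} (h1 : p + q - (l + M) - 1 < 𝒱.minWt)
    (h2 : q + r - (n + M) - 1 < 𝒱.minWt) (h3 : p + r - (m + M) - 1 < 𝒱.minWt) :
    ∑ i ∈ Finset.range M, Ring.choose m i • 𝒱.mode (𝒱.mode u (l + i) v) (m + n - i) w =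
      ∑ i ∈ Finset.range M, ((-1 : ℤ) ^ i * Ring.choose l i) •
        (𝒱.mode u (m + l - i) (𝒱.mode v (n + i) w) -
          (-1 : ℂ) ^ l • 𝒱.mode v (n + l - i) (𝒱.mode u (m + i) w)) := by
  have h := 𝒱.jacobi u v w l m n
  rw [finsum_eq_sum_of_support_subset (s := Finset.range M),
    finsum_eq_sum_of_support_subset (s := Finset.range M)] at h
  · exact h
  · intro i hi
    by_contra hlt
    apply hi
    simp only [Finset.coe_range, Set.mem_Iio, not_lt] at hlt
    have e1 := 𝒱.mode_eq_zero hv hw (m := n + i) (by omega)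
    have e2 := 𝒱.mode_eq_zero hu hw (m := m + i) (by omega)
    simp only [mode] at e1 e2
    simp only [e1, e2, map_zero, smul_zero, sub_zero]
  · intro i hi
    by_contra hlt
    apply hi
    simp only [Finset.coe_range, Set.mem_Iio, not_lt] at hlt
    have e1 := 𝒱.mode_eq_zero hu hv (m := l + i) (by omega)
    simp only [mode] at e1
    simp only [e1, map_zero, LinearMap.zero_apply, Pi.zero_apply, smul_zero]

end VertexOperatorAlgebra

/-! ### Twisted modes and the twisted Jacobi identity -/

namespace VertexOperatorAlgebra

variable {V : Type*} [AddCommGroup V] [Module ℂ V] (𝒱 : VertexOperatorAlgebra V)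

/-- `B` preserves the filtration of `V` by weight. -/
def PreservesWt (B : Module.End ℂ V) : Prop := ∀ n : ℤ, ∀ v ∈ 𝒱.wtLE n, B v ∈ 𝒱.wtLE n

variable {𝒱}

theorem PreservesWt.binomOp_mem {B : Module.End ℂ V} (hB : 𝒱.PreservesWt B) (j : ℕ) {n : ℤ} {v : V}
    (hv : v ∈ 𝒱.wtLE n) : binomOp B j v ∈ 𝒱.wtLE n :=
  TwistedZhu.binomOp_mem (hB n) j hv

theorem finsum_mode_eq_sum {B : Module.End ℂ V} (hB : 𝒱.PreservesWt B) {p q : ℤ} {u v : V}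
    (hu : u ∈ 𝒱.wtLE p) (hv : v ∈ 𝒱.wtLE q) {m : ℤ} {M : ℕ}
    (hM : p + q - (m + M) - 1 < 𝒱.minWt) :
    ∑ᶠ j : ℕ, 𝒱.mode (binomOp B j u) (m + j) v =
      ∑ j ∈ Finset.range M, 𝒱.mode (binomOp B j u) (m + j) v := by
  refine finsum_eq_sum_of_support_subset _ fun j hj => ?_
  by_contra hlt
  simp only [Finset.coe_range, Set.mem_Iio, not_lt] at hlt
  exact hj (𝒱.mode_eq_zero (hB.binomOp_mem j hu) hv (by omega))

theorem exists_bound {u v : V} (m : ℤ) {p q : ℤ} (_ : u ∈ 𝒱.wtLE p) (_ : v ∈ 𝒱.wtLE q) :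
    ∃ M : ℕ, p + q - (m + M) - 1 < 𝒱.minWt :=
  ⟨(p + q - m - 𝒱.minWt).toNat, by omega⟩

/-- The twisted mode `Res_x x^m Y((1 + x)^B u, x) v`, as a bilinear map in `u` and `v`. -/
def tmode {B : Module.End ℂ V} (hB : 𝒱.PreservesWt B) (m : ℤ) : V →ₗ[ℂ] V →ₗ[ℂ] V :=
  LinearMap.mk₂ ℂ (fun u v => ∑ᶠ j : ℕ, 𝒱.mode (binomOp B j u) (m + j) v)
    (fun u u' v => by
      obtain ⟨p, hu⟩ := 𝒱.exists_mem_wtLE u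
      obtain ⟨p', hu'⟩ := 𝒱.exists_mem_wtLE u'
      obtain ⟨q, hv⟩ := 𝒱.exists_mem_wtLE v
      have hu := 𝒱.wtLE_mono (le_max_left p p') hu
      have hu' := 𝒱.wtLE_mono (le_max_right p p') hu'
      obtain ⟨M, hM⟩ := exists_bound m hu hv
      rw [finsum_mode_eq_sum hB hu hv hM, finsum_mode_eq_sum hB hu' hv hM,
        finsum_mode_eq_sum hB (add_mem hu hu') hv hM, ← Finset.sum_add_distrib]
      simp only [map_add, mode_add])
    (fun c u v => by
      obtain ⟨p, hu⟩ := 𝒱.exists_mem_wtLE u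
      obtain ⟨q, hv⟩ := 𝒱.exists_mem_wtLE v
      obtain ⟨M, hM⟩ := exists_bound m hu hv
      rw [finsum_mode_eq_sum hB hu hv hM,
        finsum_mode_eq_sum hB (Submodule.smul_mem _ c hu) hv hM, Finset.smul_sum]
      simp only [map_smul, mode_smul])
    (fun u v v' => by
      obtain ⟨p, hu⟩ := 𝒱.exists_mem_wtLE u
      obtain ⟨q, hv⟩ := 𝒱.exists_mem_wtLE v
      obtain ⟨q', hv'⟩ := 𝒱.exists_mem_wtLE v'
      have hv := 𝒱.wtLE_mono (le_max_left q q') hv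
      have hv' := 𝒱.wtLE_mono (le_max_right q q') hv'
      obtain ⟨M, hM⟩ := exists_bound m hu hv
      rw [finsum_mode_eq_sum hB hu hv hM, finsum_mode_eq_sum hB hu hv' hM,
        finsum_mode_eq_sum hB hu (add_mem hv hv') hM, ← Finset.sum_add_distrib]
      simp only [map_add])
    (fun c u v => by
      obtain ⟨p, hu⟩ := 𝒱.exists_mem_wtLE u
      obtain ⟨q, hv⟩ := 𝒱.exists_mem_wtLE v
      obtain ⟨M, hM⟩ := exists_bound m hu hv
      rw [finsum_mode_eq_sum hB hu hv hM,
        finsum_mode_eq_sum hB hu (Submodule.smul_mem _ c hv) hM, Finset.smul_sum]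
      simp only [map_smul])

theorem tmode_apply {B : Module.End ℂ V} (hB : 𝒱.PreservesWt B) (m : ℤ) (u v : V) :
    tmode hB m u v = ∑ᶠ j : ℕ, 𝒱.mode (binomOp B j u) (m + j) v := rfl

theorem tmode_eq_sum {B : Module.End ℂ V} (hB : 𝒱.PreservesWt B) {p q : ℤ} {u v : V}
    (hu : u ∈ 𝒱.wtLE p) (hv : v ∈ 𝒱.wtLE q) {m : ℤ} {M : ℕ}
    (hM : p + q - (m + M) - 1 < 𝒱.minWt) :
    tmode hB m u v = ∑ j ∈ Finset.range M, 𝒱.mode (binomOp B j u) (m + j) v :=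
  finsum_mode_eq_sum hB hu hv hM

theorem tmode_mem_wtLE {B : Module.End ℂ V} (hB : 𝒱.PreservesWt B) {p q : ℤ} {u v : V}
    (hu : u ∈ 𝒱.wtLE p) (hv : v ∈ 𝒱.wtLE q) (m : ℤ) :
    tmode hB m u v ∈ 𝒱.wtLE (p + q - m - 1) := by
  obtain ⟨M, hM⟩ := exists_bound m hu hv
  rw [tmode_eq_sum hB hu hv hM]
  exact Submodule.sum_mem _ fun j _ =>
    𝒱.wtLE_mono (by omega) (𝒱.mode_mem_wtLE (hB.binomOp_mem j hu) hv _)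

/-- A product of two twisted modes, with all sums cut off at `M`. -/
theorem tmode_tmode_eq_sum {B : Module.End ℂ V} (hB : 𝒱.PreservesWt B) {p q r : ℤ} {u v w : V}
    (hu : u ∈ 𝒱.wtLE p) (hv : v ∈ 𝒱.wtLE q) (hw : w ∈ 𝒱.wtLE r) {a b : ℤ} {M : ℕ}
    (h1 : q + r - (b + M) - 1 < 𝒱.minWt) (h2 : p + q + r - a - b - M - 2 < 𝒱.minWt) :
    tmode hB a u (tmode hB b v w) = ∑ j ∈ Finset.range M, ∑ j' ∈ Finset.range M,
      𝒱.mode (binomOp B j u) (a + j)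
        (𝒱.mode (binomOp B j' v) (b + j') w) := by
  rw [tmode_eq_sum hB hu (tmode_mem_wtLE hB hv hw b) (M := M) (by omega),
    tmode_eq_sum hB hv hw h1]
  simp only [map_sum]

/-- A twisted mode of a twisted mode, with all sums cut off at `M`. -/
theorem tmode_iterate_eq_sum {B : Module.End ℂ V} (hB : 𝒱.PreservesWt B) {p q r : ℤ} {u v w : V}
    (hu : u ∈ 𝒱.wtLE p) (hv : v ∈ 𝒱.wtLE q) (hw : w ∈ 𝒱.wtLE r) {a b : ℤ} {M : ℕ}
    (h1 : p + q - (a + M) - 1 < 𝒱.minWt) (h2 : p + q + r - a - b - M - 2 < 𝒱.minWt) :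
    tmode hB b (tmode hB a u v) w = ∑ t ∈ Finset.range M, ∑ j ∈ Finset.range M,
      𝒱.mode (binomOp B j (𝒱.mode (binomOp B t u) (a + t) v)) (b + j) w := by
  rw [tmode_eq_sum hB (tmode_mem_wtLE hB hu hv a) hw (M := M) (by omega),
    tmode_eq_sum hB hu hv h1, Finset.sum_comm]
  simp only [map_sum, mode_sum]

/-- If `B` is a derivation of the products `u_m v` up to the shift `k - m - 1`, then shifting `B`
by `l + 1 - k` turns `binom(B, e)` of an iterated mode into the coefficient of `y^e` in
`((1 + y)^{B - t} binom(B, t) u)_{l + t} (1 + y)^B v`. -/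
theorem binomOp_shift_mode {B : Module.End ℂ V} {W₁ W₂ : Submodule ℂ V}
    (hW₁ : ∀ u ∈ W₁, B u ∈ W₁) (hW₂ : ∀ v ∈ W₂, B v ∈ W₂) {k : ℤ}
    (hder : ∀ m : ℤ, ∀ u ∈ W₁, ∀ v ∈ W₂, B (𝒱.mode u m v) =
      𝒱.mode (B u) m v + 𝒱.mode u m (B v) + ((k - m - 1 : ℤ) : ℂ) • 𝒱.mode u m v)
    {u v : V} (hu : u ∈ W₁) (hv : v ∈ W₂) (l : ℤ) (t e : ℕ) :
    ∑ p ∈ antidiagonal e, (t + p.1).choose t •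
        𝒱.mode (binomOp B (t + p.1) u) (l + t) (binomOp B p.2 v) =
      ∑ p ∈ antidiagonal e, Ring.choose (l + 1 - k) p.1 •
        binomOp B p.2 (𝒱.mode (binomOp B t u) (l + t) v) := by
  rw [← binomOp_add_intCast]
  have := binomOp_bilinear (𝒱.modeBilin (l + t)) (A := B - (t : ℂ) • 1) (B := B)
    (C := B + ((l + 1 - k : ℤ) : ℂ) • 1) (W₁ := W₁) (W₂ := W₂)
    (fun u hu => by
      simpa using W₁.sub_mem (hW₁ u hu) (W₁.smul_mem (t : ℂ) hu)) hW₂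
    (fun u hu v hv => by
      simp only [modeBilin_apply, LinearMap.add_apply, LinearMap.smul_apply,
        Module.End.one_apply, LinearMap.sub_apply, map_sub, map_smul]
      rw [hder _ u hu v hv]
      push_cast
      module)
    e (binomOp_mem hW₁ t hu) hv
  simp only [modeBilin_apply] at this
  rw [this]
  simp only [binomOp_sub_natCast, mode_nsmul]

/-- The Jacobi identity for twisted modes.  It is the residue of the Jacobi identity for
`(1 + x₁)^B u` and `(1 + x₂)^B v`, rewritten with
`(1 + x₂)^B Y(u, z) v = (1 + x₂)^k Y((1 + x₂)^B u, (1 + x₂) z) (1 + x₂)^B v`,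
which is the integrated form of the derivation property of `B`. -/
theorem twisted_jacobi {B : Module.End ℂ V} (hB : 𝒱.PreservesWt B) {W₁ W₂ : Submodule ℂ V}
    (hW₁ : ∀ u ∈ W₁, B u ∈ W₁) (hW₂ : ∀ v ∈ W₂, B v ∈ W₂) {k : ℤ}
    (hder : ∀ m : ℤ, ∀ u ∈ W₁, ∀ v ∈ W₂, B (𝒱.mode u m v) =
      𝒱.mode (B u) m v + 𝒱.mode u m (B v) + ((k - m - 1 : ℤ) : ℂ) • 𝒱.mode u m v)
    {u v : V} (hu : u ∈ W₁) (hv : v ∈ W₂) (w : V) (l m n : ℤ) :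
    ∃ M₀ : ℕ, ∀ M : ℕ, M₀ ≤ M →
      ∑ i ∈ Finset.range M, Ring.choose m i • ∑ s ∈ Finset.range M,
        Ring.choose (l + i + 1 - k) s • tmode hB (m + n - i + s) (tmode hB (l + i) u v) w =
      ∑ i ∈ Finset.range M, ((-1 : ℤ) ^ i * Ring.choose l i) •
        (tmode hB (m + l - i) u (tmode hB (n + i) v w) -
          (-1 : ℂ) ^ l • tmode hB (n + l - i) v (tmode hB (m + i) u w)) := by
  obtain ⟨p, hp⟩ := 𝒱.exists_mem_wtLE u
  obtain ⟨q, hq⟩ := 𝒱.exists_mem_wtLE v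
  obtain ⟨r, hr⟩ := 𝒱.exists_mem_wtLE w
  refine ⟨(p + q - l - 𝒱.minWt).toNat + (q + r - n - 𝒱.minWt).toNat +
    (p + r - m - 𝒱.minWt).toNat + (p + q + r - l - m - n - 𝒱.minWt).toNat, fun M hM => ?_⟩
  -- the right side is a sum of right sides of Jacobi identities for untwisted modes
  have hR : ∑ i ∈ Finset.range M, ((-1 : ℤ) ^ i * Ring.choose l i) •
        (tmode hB (m + l - i) u (tmode hB (n + i) v w) -
          (-1 : ℂ) ^ l • tmode hB (n + l - i) v (tmode hB (m + i) u w)) =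
      ∑ j ∈ Finset.range M, ∑ j' ∈ Finset.range M, ∑ i ∈ Finset.range M,
        Ring.choose (m + j) i • 𝒱.mode (𝒱.mode (binomOp B j u) (l + i)
          (binomOp B j' v)) (m + n + j + j' - i) w := by
    have e1 : ∀ j ∈ Finset.range M, ∀ j' ∈ Finset.range M, ∑ i ∈ Finset.range M,
        Ring.choose (m + j) i • 𝒱.mode (𝒱.mode (binomOp B j u) (l + i)
          (binomOp B j' v)) (m + n + j + j' - i) w =
        ∑ i ∈ Finset.range M, ((-1 : ℤ) ^ i * Ring.choose l i) •
        (𝒱.mode (binomOp B j u) (m + l - i + j)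
            (𝒱.mode (binomOp B j' v) (n + i + j') w) -
          (-1 : ℂ) ^ l • 𝒱.mode (binomOp B j' v) (n + l - i + j')
            (𝒱.mode (binomOp B j u) (m + i + j) w)) := by
      intro j _ j' _
      have := 𝒱.jacobi_range (hB.binomOp_mem j hp) (hB.binomOp_mem j' hq) hr l (m + j) (n + j') (M := M)
        (by omega) (by omega) (by omega)
      rw [show m + n + (j : ℤ) + j' = m + j + (n + j') by ring, this]
      refine Finset.sum_congr rfl fun i _ => ?_
      rw [show m + (j : ℤ) + l - i = m + l - i + j by ring,
        show n + (j' : ℤ) + i = n + i + j' by ring,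
        show n + (j' : ℤ) + l - i = n + l - i + j' by ring,
        show m + (j : ℤ) + i = m + i + j by ring]
    rw [Finset.sum_congr rfl fun j hj => Finset.sum_congr rfl fun j' hj' => e1 j hj j' hj',
      sum_comm_three]
    refine Finset.sum_congr rfl fun i hi => ?_
    rw [tmode_tmode_eq_sum hB hp hq hr (M := M) (by omega) (by omega),
      tmode_tmode_eq_sum hB hq hp hr (a := n + l - i) (M := M) (by omega) (by omega),
      Finset.sum_comm
      (f := fun j' j => 𝒱.mode (binomOp B j' v) (n + l - i + j')
            (𝒱.mode (binomOp B j u) (m + i + j) w)), Finset.smul_sum,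
      ← Finset.sum_sub_distrib, Finset.smul_sum]
    refine Finset.sum_congr rfl fun j _ => ?_
    rw [Finset.smul_sum, ← Finset.sum_sub_distrib, Finset.smul_sum]
  -- vanishing of the untwisted terms
  have hX : ∀ (j j' i : ℕ), M ≤ i ∨ M ≤ j + j' →
      𝒱.mode (𝒱.mode (binomOp B j u) (l + i) (binomOp B j' v))
        (m + n + j + j' - i) w = 0 := by
    intro j j' i h
    rcases h with h | h
    · rw [𝒱.mode_eq_zero (hB.binomOp_mem j hp) (hB.binomOp_mem j' hq) (m := l + i) (by omega), mode_zero]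
    · exact 𝒱.mode_eq_zero (𝒱.mode_mem_wtLE (hB.binomOp_mem j hp) (hB.binomOp_mem j' hq) _) hr (by omega)
  -- Vandermonde for `binom(m + j, i)`: this separates `m` from the power `j` of `x₁`, where `x₁ =
  -- x₂ + z`.
  have hS : ∀ j ∈ Finset.range M, ∀ j' ∈ Finset.range M, ∑ i ∈ Finset.range M,
        Ring.choose (m + j) i • 𝒱.mode (𝒱.mode (binomOp B j u) (l + i)
          (binomOp B j' v)) (m + n + j + j' - i) w =
      ∑ i ∈ Finset.range M, ∑ t ∈ Finset.range M, Ring.choose m i • j.choose t •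
        𝒱.mode (𝒱.mode (binomOp B j u) (l + (i + t : ℕ)) (binomOp B j' v))
          (m + n + j + j' - (i + t : ℕ)) w := by
    intro j _ j' _
    rw [← sum_range_antidiagonal (M := M) (G := fun i t => Ring.choose m i • j.choose t •
        𝒱.mode (𝒱.mode (binomOp B j u) (l + (i + t : ℕ)) (binomOp B j' v))
          (m + n + j + j' - (i + t : ℕ)) w)
      (fun i t h => by rw [hX j j' (i + t) (Or.inl h), smul_zero, smul_zero])]
    refine Finset.sum_congr rfl fun i _ => ?_
    rw [choose_add_natCast, Finset.sum_smul]
    refine Finset.sum_congr rfl fun x hx => ?_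
    rw [mem_antidiagonal.mp hx, mul_smul, natCast_zsmul]
  rw [hR, Finset.sum_congr rfl fun j hj => Finset.sum_congr rfl fun j' hj' => hS j hj j' hj',
    sum_comm_three]
  refine Finset.sum_congr rfl fun i _ => ?_
  rw [sum_comm_three]
  simp only [← Finset.smul_sum]
  congr 1
  simp only [Finset.smul_sum]
  -- collect the coefficient of each `u_{l + i + t}`
  have key : ∀ t ∈ Finset.range M, ∑ j ∈ Finset.range M, ∑ j' ∈ Finset.range M, j.choose t •
        𝒱.mode (𝒱.mode (binomOp B j u) (l + (i + t : ℕ)) (binomOp B j' v))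
          (m + n + j + j' - (i + t : ℕ)) w =
      ∑ s ∈ Finset.range M, ∑ x ∈ Finset.range M, Ring.choose (l + i + 1 - k) s •
        𝒱.mode (binomOp B x (𝒱.mode (binomOp B t u) (l + i + t) v))
          (m + n - i + s + x) w := by
    intro t _
    rw [Finset.sum_comm, Finset.sum_congr rfl fun j' _ => sum_range_choose (M := M)
      (H := fun j => 𝒱.mode (𝒱.mode (binomOp B j u) (l + (i + t : ℕ))
        (binomOp B j' v)) (m + n + j + j' - (i + t : ℕ)) w)
      (fun j hj => hX j j' _ (Or.inr (by omega))) t, Finset.sum_comm,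
      ← sum_range_antidiagonal (fun d j' h => by
        rw [hX (t + d) j' _ (Or.inr (by omega)), smul_zero]),
      ← sum_range_antidiagonal (fun s x h => by
        rw [𝒱.mode_eq_zero (hB.binomOp_mem x (𝒱.mode_mem_wtLE (hB.binomOp_mem t hp) hq _)) hr (by omega),
          smul_zero])]
    refine Finset.sum_congr rfl fun e _ => ?_
    have h1 := congrArg (fun z => 𝒱.mode z (m + n - i + e) w)
      (binomOp_shift_mode hW₁ hW₂ hder hu hv (l + i) t e)
    simp only [mode_sum, mode_nsmul, mode_zsmul] at h1
    refine Eq.trans ?_ (h1.trans ?_)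
    · refine Finset.sum_congr rfl fun x hx => ?_
      rw [← mem_antidiagonal.mp hx]
      push_cast
      rw [show l + ((i : ℤ) + t) = l + i + t by ring,
        show m + n + ((t : ℤ) + x.1) + x.2 - (i + t) = m + n - i + (x.1 + x.2) by ring]
    · refine Finset.sum_congr rfl fun x hx => ?_
      rw [← mem_antidiagonal.mp hx]
      push_cast
      rw [show m + n - (i : ℤ) + (x.1 + x.2) = m + n - i + x.1 + x.2 by ring]
  rw [Finset.sum_congr rfl key, Finset.sum_comm]
  refine Finset.sum_congr rfl fun s _ => ?_
  rw [tmode_iterate_eq_sum hB hp hq hr (M := M) (by omega) (by omega), Finset.smul_sum]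
  simp only [Finset.smul_sum]

end VertexOperatorAlgebra

/-! ### Power series of locally nilpotent operators -/

section Operators

variable {V : Type*} [AddCommGroup V] [Module ℂ V]

theorem eq_of_iSup_eq_top {ι V' : Type*} [AddCommGroup V'] [Module ℂ V'] {W : ι → Submodule ℂ V}
    (hW : ⨆ i, W i = ⊤) {S T : V →ₗ[ℂ] V'} (h : ∀ i, ∀ v ∈ W i, S v = T v) (v : V) :
    S v = T v := by
  have : ⨆ i, W i ≤ LinearMap.eqLocus S T := iSup_le h
  exact this (hW ▸ Submodule.mem_top)

theorem diagOp_commute {ι : Type*} [DecidableEq ι] {W : ι → Submodule ℂ V}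
    (h : DirectSum.IsInternal W) (f : ι → ℂ) {S : Module.End ℂ V}
    (hS : ∀ i, ∀ v ∈ W i, S v ∈ W i) (v : V) : S (diagOp h f v) = diagOp h f (S v) := by
  refine eq_of_iSup_eq_top h.submodule_iSup_eq_top (S := S * diagOp h f) (T := diagOp h f * S)
    (fun i v hv => ?_) v
  rw [Module.End.mul_apply, Module.End.mul_apply, diagOp_apply h f hv, diagOp_apply h f (hS i v hv),
    map_smul]

theorem pow_apply_eq_zero_of_le {T : Module.End ℂ V} {v : V} {J K : ℕ} (hJ : (T ^ J) v = 0)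
    (h : J ≤ K) : (T ^ K) v = 0 := by
  obtain ⟨d, rfl⟩ := Nat.exists_eq_add_of_le h
  rw [add_comm, pow_add, Module.End.mul_apply, hJ, map_zero]

theorem evalSeries_eq_sum (p : ℂ⟦X⟧) {T : Module.End ℂ V} (hT : LocallyNilpotent T) {v : V} {J : ℕ}
    (hJ : (T ^ J) v = 0) :
    evalSeries p T hT v = ∑ k ∈ Finset.range J, PowerSeries.coeff k p • (T ^ k) v := by
  refine finsum_eq_sum_of_support_subset _ fun k hk => ?_
  by_contra hlt
  simp only [Finset.coe_range, Set.mem_Iio, not_lt] at hlt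
  exact hk (by simp only [pow_apply_eq_zero_of_le hJ hlt, smul_zero])

theorem pow_apply_comm {V' : Type*} [AddCommGroup V'] [Module ℂ V'] {T : Module.End ℂ V}
    {T' : Module.End ℂ V'} (S : V →ₗ[ℂ] V') (h : ∀ v, S (T v) = T' (S v)) (k : ℕ) (v : V) :
    S ((T ^ k) v) = (T' ^ k) (S v) := by
  induction k with
  | zero => simp
  | succ k ih => rw [pow_succ', pow_succ', Module.End.mul_apply, Module.End.mul_apply, h, ih]

/-- Power series of operators are natural for intertwining maps. -/
theorem evalSeries_intertwine (p : ℂ⟦X⟧) {T T' : Module.End ℂ V} (hT : LocallyNilpotent T)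
    (hT' : LocallyNilpotent T') {S : Module.End ℂ V} (h : ∀ v, S (T v) = T' (S v)) (v : V) :
    S (evalSeries p T hT v) = evalSeries p T' hT' (S v) := by
  obtain ⟨J, hJ⟩ := hT v
  rw [evalSeries_eq_sum p hT hJ,
    evalSeries_eq_sum p hT' (J := J) (by rw [← pow_apply_comm S h, hJ, map_zero]), map_sum]
  simp only [map_smul, pow_apply_comm S h]

/-- The polynomial `binom(X, j)`. -/
def binomPoly (j : ℕ) : Polynomial ℂ :=
  Polynomial.C (j.factorial : ℂ)⁻¹ * descPochhammer ℂ j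

theorem binomPoly_eval_natCast (j n : ℕ) : (binomPoly j).eval (n : ℂ) = n.choose j := by
  rw [binomPoly, Polynomial.eval_mul, Polynomial.eval_C, descPochhammer_eval_eq_descFactorial,
    Nat.descFactorial_eq_factorial_mul_choose, Nat.cast_mul,
    inv_mul_cancel_left₀ (by exact_mod_cast Nat.factorial_ne_zero j)]

theorem binomPoly_eval_zero (j : ℕ) : (binomPoly j).eval 0 = if j = 0 then 1 else 0 := by
  have := binomPoly_eval_natCast j 0
  rw [Nat.cast_zero] at this
  rw [this]
  rcases j with _ | j <;> simp

/-- The derivative of `(1 + x)^n` with respect to `n` at `n = 0` is `log(1 + x)`. -/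
theorem derivative_binomPoly_eval_zero (j : ℕ) :
    (Polynomial.derivative (binomPoly j)).eval 0 = PowerSeries.coeff j (PowerSeries.log ℂ) := by
  have hm : ∀ n : ℕ, (descPochhammer ℂ n).eval (-1) = (-1) ^ n * n.factorial := by
    intro n
    induction n with
    | zero => simp
    | succ n ih =>
      rw [descPochhammer_succ_eval, ih, Nat.factorial_succ, pow_succ]
      push_cast
      ring
  rw [PowerSeries.coeff_log]
  rcases j with _ | j
  · simp [binomPoly]
  · have hj : ((j : ℂ) + 1) ≠ 0 := by exact_mod_cast Nat.succ_ne_zero j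
    have hf : (j.factorial : ℂ) ≠ 0 := by exact_mod_cast Nat.factorial_ne_zero j
    rw [if_neg (Nat.succ_ne_zero j), binomPoly, descPochhammer_succ_left]
    simp only [Polynomial.derivative_mul, Polynomial.derivative_C, zero_mul, zero_add,
      Polynomial.derivative_X, one_mul, Polynomial.eval_mul, Polynomial.eval_C,
      Polynomial.eval_add, Polynomial.eval_comp, Polynomial.eval_sub, Polynomial.eval_X,
      Polynomial.eval_one, zero_sub, add_zero, hm, Nat.factorial_succ]
    simp only [map_div₀, map_pow, map_neg, map_one, map_natCast]
    push_cast
    field_simp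
    ring

theorem one_add_pow_apply {T : Module.End ℂ V} {v : V} {J : ℕ} (hJ : (T ^ J) v = 0) (n : ℕ) :
    ((1 + T) ^ n) v = ∑ j ∈ Finset.range J, (n.choose j : ℂ) • (T ^ j) v := by
  have h1 : ((1 + T) ^ n) v = ∑ j ∈ Finset.range (n + 1), (n.choose j : ℂ) • (T ^ j) v := by
    rw [add_comm, (Commute.one_right T).add_pow, LinearMap.sum_apply]
    refine Finset.sum_congr rfl fun j _ => ?_
    rw [one_pow, mul_one, Module.End.mul_apply, Module.End.natCast_apply, map_nsmul,
      Nat.cast_smul_eq_nsmul]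
  rw [h1]
  have hl : ∑ j ∈ Finset.range (n + 1), (n.choose j : ℂ) • (T ^ j) v =
      ∑ j ∈ Finset.range (max (n + 1) J), (n.choose j : ℂ) • (T ^ j) v := by
    refine Finset.sum_subset (Finset.range_mono (le_max_left _ _)) fun j _ hj => ?_
    rw [Nat.choose_eq_zero_of_lt (by simpa using hj), Nat.cast_zero, zero_smul]
  rw [hl]
  refine (Finset.sum_subset (Finset.range_mono (le_max_right _ _)) fun j _ hj => ?_).symm
  rw [pow_apply_eq_zero_of_le hJ (by simpa using hj), smul_zero]

/-- The logarithm of a locally unipotent automorphism of a bilinear product is a derivation.  Both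
sides are linear coefficients of vector-valued polynomials in `n` that agree for all `n ∈ ℕ`,
namely `(1 + T)^n β(u, v)` and `β((1 + T)^n u, (1 + T)^n v)`. -/
theorem evalSeries_log_bilinear {T : Module.End ℂ V} (hT : LocallyNilpotent T)
    (β : V →ₗ[ℂ] V →ₗ[ℂ] V) (hβ : ∀ u v, (1 + T) (β u v) = β ((1 + T) u) ((1 + T) v)) (u v : V) :
    evalSeries (PowerSeries.log ℂ) T hT (β u v) =
      β (evalSeries (PowerSeries.log ℂ) T hT u) v +
        β u (evalSeries (PowerSeries.log ℂ) T hT v) := by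
  obtain ⟨a, ha⟩ := hT u
  obtain ⟨b, hb⟩ := hT v
  obtain ⟨c, hc⟩ := hT (β u v)
  have ha := pow_apply_eq_zero_of_le ha (show a ≤ a + b + c + 1 by omega)
  have hb := pow_apply_eq_zero_of_le hb (show b ≤ a + b + c + 1 by omega)
  have hc := pow_apply_eq_zero_of_le hc (show c ≤ a + b + c + 1 by omega)
  generalize hJ : a + b + c + 1 = J at ha hb hc
  have hJ0 : 0 < J := by omega
  have hpow : ∀ n : ℕ, ((1 + T) ^ n) (β u v) = β (((1 + T) ^ n) u) (((1 + T) ^ n) v) := by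
    intro n
    induction n with
    | zero => simp
    | succ n ih => rw [pow_succ', Module.End.mul_apply, ih, hβ]; rfl
  rw [← sub_eq_zero]
  refine (Module.forall_dual_apply_eq_zero_iff ℂ _).1 fun φ => ?_
  have hPQ : ∑ j ∈ Finset.range J, Polynomial.C (φ ((T ^ j) (β u v))) * binomPoly j =
      ∑ i ∈ Finset.range J, ∑ j ∈ Finset.range J,
        Polynomial.C (φ (β ((T ^ i) u) ((T ^ j) v))) * (binomPoly i * binomPoly j) := by
    refine Polynomial.eq_of_infinite_eval_eq _ _
      ((Set.infinite_range_of_injective (Nat.cast_injective (R := ℂ))).mono ?_)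
    rintro _ ⟨n, rfl⟩
    have := congrArg φ (hpow n)
    rw [one_add_pow_apply ha, one_add_pow_apply hb, one_add_pow_apply hc] at this
    simp only [map_sum, map_smul, LinearMap.sum_apply, LinearMap.smul_apply, smul_eq_mul] at this
    simp only [Set.mem_ofPred_eq, Polynomial.eval_finsetSum, Polynomial.eval_mul,
      Polynomial.eval_C, binomPoly_eval_natCast]
    rw [Finset.sum_congr rfl fun j _ => mul_comm _ _, this, Finset.sum_comm]
    refine Finset.sum_congr rfl fun i _ => ?_
    rw [Finset.mul_sum]
    refine Finset.sum_congr rfl fun j _ => ?_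
    ring
  have hd := congrArg (fun p => (Polynomial.derivative p).eval 0) hPQ
  simp only [Polynomial.derivative_sum, Polynomial.derivative_mul, Polynomial.derivative_C,
    zero_mul, zero_add, Polynomial.eval_finsetSum, Polynomial.eval_add, Polynomial.eval_mul,
    Polynomial.eval_C, derivative_binomPoly_eval_zero, binomPoly_eval_zero] at hd
  rw [evalSeries_eq_sum _ hT ha, evalSeries_eq_sum _ hT hb, evalSeries_eq_sum _ hT hc, map_sub,
    sub_eq_zero]
  simp only [map_sum, map_add, map_smul, LinearMap.sum_apply, LinearMap.smul_apply, smul_eq_mul]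
  rw [Finset.sum_congr rfl fun j _ => mul_comm _ _, hd]
  simp only [mul_add, Finset.sum_add_distrib, mul_ite, mul_one, mul_zero, ite_mul, one_mul,
    zero_mul, Finset.sum_ite_eq', Finset.mem_range, hJ0, if_true, pow_zero, Module.End.one_apply]
  rw [Finset.sum_comm]
  simp only [Finset.sum_ite_eq', Finset.mem_range, hJ0, if_true, pow_zero, Module.End.one_apply,
    mul_comm]

end Operators

/-! ### The operators attached to an automorphism -/

theorem exp_gWeight {μ : ℂ} (hμ : μ ≠ 0) : Complex.exp (twoPiI * gWeight μ) = μ := by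
  rw [gWeight, mul_sub, mul_div_cancel₀ _ twoPiI_ne_zero, Complex.exp_sub, Complex.exp_log hμ,
    mul_comm twoPiI, twoPiI, Complex.exp_int_mul_two_pi_mul_I, div_one]

theorem gWeight_re_nonneg (μ : ℂ) : 0 ≤ (gWeight μ).re := by
  rw [gWeight, Complex.sub_re, Complex.intCast_re, sub_nonneg]
  exact Int.floor_le _

theorem gWeight_re_lt_one (μ : ℂ) : (gWeight μ).re < 1 := by
  rw [gWeight, Complex.sub_re, Complex.intCast_re, sub_lt_iff_lt_add]
  linarith [Int.lt_floor_add_one (Complex.log μ / twoPiI).re]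

/-- The weights `a` are additive up to integers, since the eigenvalues `e^{2 π √-1 a}` are
multiplicative. -/
theorem exists_gWeight_mul {μ ν : ℂ} (hμ : μ ≠ 0) (hν : ν ≠ 0) :
    ∃ n : ℤ, gWeight μ + gWeight ν = gWeight (μ * ν) + n := by
  have h : Complex.exp (twoPiI * (gWeight μ + gWeight ν)) =
      Complex.exp (twoPiI * gWeight (μ * ν)) := by
    rw [mul_add, Complex.exp_add, exp_gWeight hμ, exp_gWeight hν, exp_gWeight (mul_ne_zero hμ hν)]
  obtain ⟨n, hn⟩ := Complex.exp_eq_exp_iff_exists_int.1 h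
  refine ⟨n, mul_left_cancel₀ twoPiI_ne_zero ?_⟩
  rw [hn, mul_add, twoPiI]
  ring

theorem gWeight_mul_of_re_eq_zero {μ ν : ℂ} (hμ : μ ≠ 0) (hν : ν ≠ 0) (h : (gWeight μ).re = 0) :
    gWeight (μ * ν) = gWeight μ + gWeight ν := by
  obtain ⟨n, hn⟩ := exists_gWeight_mul hμ hν
  have hre := congrArg Complex.re hn
  rw [Complex.add_re, Complex.add_re, h, Complex.intCast_re] at hre
  have h1 := gWeight_re_nonneg ν
  have h2 := gWeight_re_lt_one ν
  have h3 := gWeight_re_nonneg (μ * ν)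
  have h4 := gWeight_re_lt_one (μ * ν)
  have : n = 0 := by
    have a : (n : ℝ) < 1 := by linarith
    have b : (-1 : ℝ) < n := by linarith
    have a' : n < 1 := by exact_mod_cast a
    have b' : -1 < n := by exact_mod_cast b
    omega
  rw [hn, this, Int.cast_zero, add_zero]

theorem gWeight_mul_of_re_ne_zero {μ ν : ℂ} (hμ : μ ≠ 0) (hν : ν ≠ 0) (h : (gWeight μ).re ≠ 0)
    (h' : (gWeight (μ * ν)).re = 0) : gWeight (μ * ν) = gWeight μ + gWeight ν - 1 := by
  obtain ⟨n, hn⟩ := exists_gWeight_mul hμ hν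
  have hre := congrArg Complex.re hn
  rw [Complex.add_re, Complex.add_re, h', Complex.intCast_re] at hre
  have h1 := gWeight_re_nonneg ν
  have h2 := gWeight_re_lt_one ν
  have h3 := lt_of_le_of_ne (gWeight_re_nonneg μ) h.symm
  have h4 := gWeight_re_lt_one μ
  have : n = 1 := by
    have a : (n : ℝ) < 2 := by linarith
    have b : (0 : ℝ) < n := by linarith
    have a' : n < 2 := by exact_mod_cast a
    have b' : 0 < n := by exact_mod_cast b
    omega
  rw [hn, this, Int.cast_one, add_sub_cancel_right]

namespace VOAAut

variable {V : Type*} [AddCommGroup V] [Module ℂ V] {𝒱 : VertexOperatorAlgebra V} (g : VOAAut 𝒱)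

/-- The generalized eigenspace of `g` with eigenvalue `μ`. -/
abbrev sector (μ : ℂ) : Submodule ℂ V := g.op.maxGenEigenspace μ

theorem eq_of_sector {V' : Type*} [AddCommGroup V'] [Module ℂ V'] {S T : V →ₗ[ℂ] V'}
    (h : ∀ μ, ∀ v ∈ g.sector μ, S v = T v) (v : V) : S v = T v :=
  eq_of_iSup_eq_top g.isInternal_genEigenspace.submodule_iSup_eq_top h v

theorem op_mode (u v : V) (m : ℤ) : g.op (𝒱.mode u m v) = 𝒱.mode (g.op u) m (g.op v) :=
  g.map_mode u v m

/-- As `g` is invertible, the eigenvalue `0` does not occur; the junk value of `gWeight 0` therefore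
plays no role. -/
theorem eq_zero_of_mem_sector_zero {v : V} (hv : v ∈ g.sector 0) : v = 0 := by
  obtain ⟨k, hk⟩ := (Module.End.mem_maxGenEigenspace _ _ _).1 hv
  rw [zero_smul, sub_zero] at hk
  have hinj : Function.Injective (g.op ^ k) := by
    rw [Module.End.coe_pow]
    exact g.toEquiv.injective.iterate k
  exact hinj (by rw [hk, map_zero])

/-- The generalized eigenspaces of `g` are multiplicative.  The induction is on the sum of the
nilpotency orders of `g - μ` on `u` and `g - ν` on `v`. -/
theorem mode_mem_sector {μ ν : ℂ} {u v : V} (hu : u ∈ g.sector μ) (hv : v ∈ g.sector ν) (m : ℤ) :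
    𝒱.mode u m v ∈ g.sector (μ * ν) := by
  obtain ⟨a, ha⟩ := (Module.End.mem_maxGenEigenspace _ _ _).1 hu
  obtain ⟨b, hb⟩ := (Module.End.mem_maxGenEigenspace _ _ _).1 hv
  suffices h : ∀ n a b : ℕ, a + b ≤ n → ∀ u v : V, ((g.op - μ • 1) ^ a) u = 0 →
      ((g.op - ν • 1) ^ b) v = 0 → 𝒱.mode u m v ∈ g.sector (μ * ν) from
    h _ a b le_rfl u v ha hb
  intro n
  induction n with
  | zero =>
    intro a b hab u v ha hb
    obtain rfl : a = 0 := by omega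
    rw [show u = 0 by simpa using ha, 𝒱.mode_zero]
    exact Submodule.zero_mem _
  | succ n ih =>
    intro a b hab u v ha hb
    rcases a with _ | a
    · rw [show u = 0 by simpa using ha, 𝒱.mode_zero]
      exact Submodule.zero_mem _
    rcases b with _ | b
    · rw [show v = 0 by simpa using hb, map_zero]
      exact Submodule.zero_mem _
    -- the Leibniz rule `g ⊗ g - μ ν = (g - μ) ⊗ g + μ (1 ⊗ (g - ν))`, which lowers the sum of the
    -- orders
    have e : (g.op - (μ * ν) • (1 : Module.End ℂ V)) (𝒱.mode u m v) =
        𝒱.mode ((g.op - μ • 1) u) m (g.op v) + μ • 𝒱.mode u m ((g.op - ν • 1) v) := by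
      simp only [LinearMap.sub_apply, LinearMap.smul_apply, Module.End.one_apply, map_sub, map_smul,
        ← 𝒱.modeBilin_apply]
      simp only [𝒱.modeBilin_apply, g.op_mode]
      module
    have h1 : 𝒱.mode ((g.op - μ • 1) u) m (g.op v) ∈ g.sector (μ * ν) := by
      refine ih a (b + 1) (by omega) _ _ ?_ ?_
      · rw [← Module.End.mul_apply, ← pow_succ, ha]
      · rw [← pow_apply_comm g.op (T := g.op - ν • 1) (fun v => by simp), hb, map_zero]
    have h2 : 𝒱.mode u m ((g.op - ν • 1) v) ∈ g.sector (μ * ν) := by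
      refine ih (a + 1) b (by omega) _ _ ha ?_
      rw [← Module.End.mul_apply, ← pow_succ, hb]
    obtain ⟨k, hk⟩ := (Module.End.mem_maxGenEigenspace _ _ _).1
      (e ▸ Submodule.add_mem _ h1 (Submodule.smul_mem _ μ h2))
    refine (Module.End.mem_maxGenEigenspace _ _ _).2 ⟨k + 1, ?_⟩
    rw [pow_succ, Module.End.mul_apply, hk]

theorem mem_sector_of_commute {S : Module.End ℂ V} (h : ∀ v, S (g.op v) = g.op (S v)) {μ : ℂ}
    {v : V} (hv : v ∈ g.sector μ) : S v ∈ g.sector μ :=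
  Module.End.mapsTo_maxGenEigenspace_of_comm (LinearMap.ext fun v => (h v).symm) μ hv

theorem op_mem_sector {μ : ℂ} {v : V} (hv : v ∈ g.sector μ) : g.op v ∈ g.sector μ :=
  g.mem_sector_of_commute (fun _ => rfl) hv

theorem vir_mem_sector (n : ℤ) {μ : ℂ} {v : V} (hv : v ∈ g.sector μ) : 𝒱.vir n v ∈ g.sector μ :=
  g.mem_sector_of_commute (fun v => (g.op_vir n v).symm) hv

theorem unipotentPart_apply {μ : ℂ} {v : V} (hv : v ∈ g.sector μ) :
    g.unipotentPart v = μ⁻¹ • g.op v := by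
  rw [unipotentPart, Module.End.mul_apply, diagOp_apply _ _ (g.op_mem_sector hv)]

theorem unipotentPart_commute {S : Module.End ℂ V} (h : ∀ v, S (g.op v) = g.op (S v)) (v : V) :
    S (g.unipotentPart v) = g.unipotentPart (S v) :=
  g.eq_of_sector (S := S * g.unipotentPart) (T := g.unipotentPart * S) (fun μ v hv => by
    rw [Module.End.mul_apply, Module.End.mul_apply, g.unipotentPart_apply hv,
      g.unipotentPart_apply (g.mem_sector_of_commute h hv), map_smul, h]) v

/-- The unipotent part of `g` preserves all products `u_m v`, because `g` does and the eigenvalues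
of `g` are multiplicative. -/
theorem unipotentPart_mode (m : ℤ) (u v : V) :
    g.unipotentPart (𝒱.mode u m v) = 𝒱.mode (g.unipotentPart u) m (g.unipotentPart v) := by
  refine g.eq_of_sector (S := (𝒱.modeBilin m).compr₂ g.unipotentPart)
    (T := (𝒱.modeBilin m).compl₁₂ g.unipotentPart g.unipotentPart) (fun μ u hu => ?_) u |>
    fun h => LinearMap.congr_fun h v
  refine LinearMap.ext fun v => g.eq_of_sector (fun ν v hv => ?_) v
  simp only [LinearMap.compr₂_apply, LinearMap.compl₁₂_apply, 𝒱.modeBilin_apply]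
  rw [g.unipotentPart_apply hu, g.unipotentPart_apply hv,
    g.unipotentPart_apply (g.mode_mem_sector hu hv m), 𝒱.mode_smul, map_smul, g.op_mode, smul_smul,
    mul_inv]

/-- `𝒩` is a derivation of all products `u_m v`, being the logarithm of an automorphism of them. -/
theorem opN_mode (m : ℤ) (u v : V) :
    g.opN (𝒱.mode u m v) = 𝒱.mode (g.opN u) m v + 𝒱.mode u m (g.opN v) := by
  have := evalSeries_log_bilinear g.locallyNilpotent_unipotentPart_sub_one (𝒱.modeBilin m)
    (fun u v => by
      rw [add_sub_cancel]
      exact g.unipotentPart_mode m u v) u v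
  simp only [𝒱.modeBilin_apply] at this
  simp only [opN, LinearMap.smul_apply, this, 𝒱.mode_smul, map_smul, smul_add]

theorem opN_commute {S : Module.End ℂ V} (h : ∀ v, S (g.op v) = g.op (S v)) (v : V) :
    S (g.opN v) = g.opN (S v) := by
  simp only [opN, LinearMap.smul_apply, map_smul]
  congr 1
  refine evalSeries_intertwine _ _ _ (fun v => ?_) v
  simp only [LinearMap.sub_apply, map_sub, g.unipotentPart_commute h, Module.End.one_apply]

theorem diagOp_sector_commute (f : ℂ → ℂ) {S : Module.End ℂ V}
    (h : ∀ v, S (g.op v) = g.op (S v)) (v : V) :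
    S (diagOp g.isInternal_genEigenspace f v) = diagOp g.isInternal_genEigenspace f (S v) :=
  diagOp_commute _ f (fun _ _ hv => g.mem_sector_of_commute h hv) v

/-- The operator `P = 𝐋 - L(0) + 𝒩`, which is the logarithm of `g` divided by `2 π √-1`. -/
def opP : Module.End ℂ V := g.opL - 𝒱.vir 0 + g.opN

/-- The eigenvalue of `𝐋 - L(0)` on the generalized eigenspace of `g` with eigenvalue `μ`. -/
def sectorExp (μ : ℂ) : ℂ := if (gWeight μ).re = 0 then gWeight μ else gWeight μ - 1

theorem opP_eq : g.opP = diagOp g.isInternal_genEigenspace sectorExp + g.opN := by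
  rw [opP, opL, add_sub_cancel_left]
  rfl

theorem opL_add_opN : g.opL + g.opN = 𝒱.vir 0 + g.opP := by
  rw [opP]; abel

theorem opP_commute {S : Module.End ℂ V} (h : ∀ v, S (g.op v) = g.op (S v)) (v : V) :
    S (g.opP v) = g.opP (S v) := by
  rw [opP_eq, LinearMap.add_apply, map_add, g.diagOp_sector_commute _ h, g.opN_commute h]
  rfl

theorem opP_vir (n : ℤ) (v : V) : 𝒱.vir n (g.opP v) = g.opP (𝒱.vir n v) :=
  g.opP_commute (fun v => (g.op_vir n v).symm) v

theorem opP_mem_sector {μ : ℂ} {v : V} (hv : v ∈ g.sector μ) : g.opP v ∈ g.sector μ :=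
  g.mem_sector_of_commute (fun v => (g.opP_commute (S := g.op) (fun _ => rfl) v).symm) hv

theorem preservesWt_opP : 𝒱.PreservesWt g.opP := fun _ _ hv =>
  𝒱.mem_wtLE_of_commute (fun v => (g.opP_vir 0 v).symm) hv

theorem preservesWt_opL_add_opN : 𝒱.PreservesWt (g.opL + g.opN) := fun n v hv => by
  rw [opL_add_opN]
  refine Submodule.add_mem _ ?_ (g.preservesWt_opP n v hv)
  simpa using 𝒱.vir_mem_wtLE 0 hv

theorem opL_add_opN_mem_sector {μ : ℂ} {v : V} (hv : v ∈ g.sector μ) :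
    (g.opL + g.opN) v ∈ g.sector μ := by
  rw [opL_add_opN]
  exact Submodule.add_mem _ (g.vir_mem_sector 0 hv) (g.opP_mem_sector hv)

/-- On a product of two generalized eigenspaces of `g`, the operator `𝐋 + 𝒩` is a derivation of
`u_m v` up to the shift `k - m - 1`, where `k` is the defect of additivity of the exponents. -/
theorem opL_add_opN_mode {μ ν : ℂ} {k : ℤ} (hk : sectorExp (μ * ν) = sectorExp μ + sectorExp ν + k)
    (m : ℤ) {u v : V} (hu : u ∈ g.sector μ) (hv : v ∈ g.sector ν) :
    (g.opL + g.opN) (𝒱.mode u m v) = 𝒱.mode ((g.opL + g.opN) u) m v +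
      𝒱.mode u m ((g.opL + g.opN) v) + ((k - m - 1 : ℤ) : ℂ) • 𝒱.mode u m v := by
  rw [opL_add_opN, opP_eq]
  simp only [LinearMap.add_apply, map_add, 𝒱.mode_add]
  rw [diagOp_apply _ _ hu, diagOp_apply _ _ hv, diagOp_apply _ _ (g.mode_mem_sector hu hv m),
    𝒱.vir_zero_mode, g.opN_mode, hk, 𝒱.mode_smul, map_smul]
  push_cast
  module

/-- If `Re a = 0` for the first factor, the shift `k` of `opL_add_opN_mode` is `0`. -/
theorem sectorExp_mul_of_left {μ ν : ℂ} (hμ : μ ≠ 0) (hν : ν ≠ 0) (h : (gWeight μ).re = 0) :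
    sectorExp (μ * ν) = sectorExp μ + sectorExp ν + (0 : ℤ) := by
  have e := gWeight_mul_of_re_eq_zero hμ hν h
  have : (gWeight (μ * ν)).re = (gWeight ν).re := by rw [e, Complex.add_re, h, zero_add]
  rw [sectorExp, sectorExp, sectorExp, this, if_pos h, e]
  split_ifs <;> push_cast <;> ring

/-- If the exponents of the factors have nonzero real parts that add up to an integer, the shift `k`
of `opL_add_opN_mode` is `1`. -/
theorem sectorExp_mul_of_ne {μ ν : ℂ} (hμ : μ ≠ 0) (hν : ν ≠ 0) (h : (gWeight μ).re ≠ 0)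
    (h' : (gWeight (μ * ν)).re = 0) :
    sectorExp (μ * ν) = sectorExp μ + sectorExp ν + (1 : ℤ) := by
  have e := gWeight_mul_of_re_ne_zero hμ hν h h'
  have hν' : (gWeight ν).re ≠ 0 := by
    intro h0
    have := gWeight_mul_of_re_eq_zero hν hμ h0
    rw [mul_comm] at this
    rw [this, Complex.add_re, h0, zero_add] at h'
    exact h h'
  rw [sectorExp, sectorExp, sectorExp, if_pos h', if_neg h, if_neg hν', e]
  push_cast
  ring

end VOAAut

/-! ### Residues -/

section Residue

variable {V : Type*} [AddCommGroup V] [Module ℂ V] {𝒱 : VertexOperatorAlgebra V}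

theorem finsum_eq_finsum_comp {α β E : Type*} [AddCommMonoid E] {e : α → β}
    (he : Function.Injective e) {f : β → E} (hf : ∀ b, f b ≠ 0 → b ∈ Set.range e) :
    ∑ᶠ b, f b = ∑ᶠ a, f (e a) := by
  rw [← finsum_mem_range he, finsum_mem_def, Set.indicator_eq_self.2 hf]

theorem single_zpow (n : ℤ) : varY ^ n = HahnSeries.single n (1 : ℂ) :=
  (RatFunc.single_zpow n).symm

/-- For the coordinate `y` itself, only the diagonal of the double sum contributes. -/
theorem resY_varY (w : ℤ → V) (v : V) : resY 𝒱 varY w v = ∑ᶠ k : ℤ, 𝒱.mode (w k) k v := by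
  have h : ∀ p : ℤ × ℤ, (HahnSeries.single p.1 (1 : ℂ) * varY ^ (-p.2 - 1)).coeff (-1) =
      if p.1 = p.2 then 1 else 0 := by
    intro p
    rw [single_zpow, HahnSeries.single_mul_single, mul_one]
    split_ifs with heq
    · rw [heq, show p.2 + (-p.2 - 1) = -1 by ring, HahnSeries.coeff_single_same]
    · exact HahnSeries.coeff_single_of_ne (by omega)
  rw [resY, finsum_eq_finsum_comp (e := fun k : ℤ => (k, k)) (fun a b hab => (Prod.ext_iff.1 hab).1)]
  · refine finsum_congr fun a => ?_
    rw [h (a, a), if_pos rfl, one_smul]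
  · rintro ⟨a, b⟩ hab
    rw [h] at hab
    by_cases heq : a = b
    · exact ⟨a, by simp [heq]⟩
    · simp [heq] at hab

/-- The residue against `(1 + x)^B u` is a twisted mode. -/
theorem resY_varY_onePlusPow {B : Module.End ℂ V} (hB : 𝒱.PreservesWt B) (s : ℤ) (u v : V) :
    resY 𝒱 varY (shift s (onePlusPow B u)) v = VertexOperatorAlgebra.tmode hB s u v := by
  rw [resY_varY, VertexOperatorAlgebra.tmode_apply, finsum_eq_finsum_comp (e := fun j : ℕ => s + j)
    (fun a b hab => by simpa using hab)]
  · simp [shift, onePlusPow]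
  · intro k hk
    have : 0 ≤ k - s := by
      by_contra hlt
      apply hk
      rw [shift, onePlusPow, if_neg hlt, 𝒱.mode_zero]
    exact ⟨(k - s).toNat, by simp; omega⟩

/-- A series `ℓ` of order one, in the form in which it enters residues. -/
def OrderOne (ℓ : LaurentSeries ℂ) : Prop :=
  ∀ k m : ℤ, m < k → (HahnSeries.single k (1 : ℂ) * ℓ ^ (-m - 1)).coeff (-1) = 0

theorem orderOne_varY : OrderOne varY := by
  intro k m h
  rw [single_zpow, HahnSeries.single_mul_single, mul_one]
  exact HahnSeries.coeff_single_of_ne (by omega)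

/-- The residue of `Y(w(y), ℓ(y)) v` is a finite sum if the coefficients of `w` have bounded
weight. -/
theorem finite_support_resY {ℓ : LaurentSeries ℂ} (hℓ : OrderOne ℓ) {w : ℤ → V} {s n : ℤ}
    (hs : ∀ k < s, w k = 0) (hw : ∀ k, w k ∈ 𝒱.wtLE n) (v : V) :
    (Function.support fun p : ℤ × ℤ => (HahnSeries.single p.1 (1 : ℂ) * ℓ ^ (-p.2 - 1)).coeff (-1) •
      𝒱.mode (w p.1) p.2 v).Finite := by
  obtain ⟨q, hq⟩ := 𝒱.exists_mem_wtLE v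
  refine ((Set.finite_Icc s (n + q - 𝒱.minWt)).prod
    (Set.finite_Icc s (n + q - 𝒱.minWt))).subset ?_
  rintro ⟨k, m⟩ hkm
  simp only [Function.mem_support] at hkm
  have h1 : s ≤ k := by
    by_contra hlt
    exact hkm (by rw [hs k (by omega), 𝒱.mode_zero, smul_zero])
  have h2 : k ≤ m := by
    by_contra hlt
    exact hkm (by rw [hℓ k m (by omega), zero_smul])
  have h3 : m ≤ n + q - 𝒱.minWt := by
    by_contra hlt
    exact hkm (by rw [𝒱.mode_eq_zero (hw k) hq (by omega), smul_zero])
  exact ⟨⟨h1, h2.trans h3⟩, ⟨h1.trans h2, h3⟩⟩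

theorem resY_add {ℓ : LaurentSeries ℂ} (hℓ : OrderOne ℓ) {w w' : ℤ → V} {s n : ℤ}
    (hs : ∀ k < s, w k = 0) (hw : ∀ k, w k ∈ 𝒱.wtLE n) (hs' : ∀ k < s, w' k = 0)
    (hw' : ∀ k, w' k ∈ 𝒱.wtLE n) (v : V) :
    resY 𝒱 ℓ (fun k => w k + w' k) v = resY 𝒱 ℓ w v + resY 𝒱 ℓ w' v := by
  rw [resY, resY, resY, ← finsum_add_distrib (finite_support_resY hℓ hs hw v)
    (finite_support_resY hℓ hs' hw' v)]
  simp only [𝒱.mode_add, smul_add]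

theorem shift_onePlusPow_eq_zero (B : Module.End ℂ V) (u : V) (s k : ℤ) (h : k < s) :
    shift s (onePlusPow B u) k = 0 := by
  rw [shift, onePlusPow, if_neg (by omega)]

theorem shift_onePlusPow_mem {B : Module.End ℂ V} (hB : 𝒱.PreservesWt B) {u : V} {n : ℤ}
    (hu : u ∈ 𝒱.wtLE n) (s k : ℤ) : shift s (onePlusPow B u) k ∈ 𝒱.wtLE n := by
  rw [shift, onePlusPow]
  split_ifs
  · exact hB.binomOp_mem _ hu
  · exact Submodule.zero_mem _

end Residue

namespace VOAAut

variable {V : Type*} [AddCommGroup V] [Module ℂ V] {𝒱 : VertexOperatorAlgebra V} (g : VOAAut 𝒱)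

/-- The operator `L(0) - 𝐋 + 𝐀`, the projection of `V` onto the sum of the generalized eigenspaces
with `Re a > 0`. -/
def opD : Module.End ℂ V := 𝒱.vir 0 - g.opL + g.opA

theorem opD_apply {μ : ℂ} {v : V} (hv : v ∈ g.sector μ) :
    g.opD v = if (gWeight μ).re = 0 then 0 else v := g.opL_sub_apply hv

theorem opD_commute {S : Module.End ℂ V} (h : ∀ v, S (g.op v) = g.op (S v)) (v : V) :
    S (g.opD v) = g.opD (S v) :=
  g.eq_of_sector (S := S * g.opD) (T := g.opD * S) (fun μ v hv => by
    rw [Module.End.mul_apply, Module.End.mul_apply, g.opD_apply hv,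
      g.opD_apply (g.mem_sector_of_commute h hv)]
    split_ifs <;> simp) v

theorem opD_mem_wtLE {n : ℤ} {v : V} (hv : v ∈ 𝒱.wtLE n) : g.opD v ∈ 𝒱.wtLE n :=
  𝒱.mem_wtLE_of_commute (fun v => (g.opD_commute (fun v => (g.op_vir 0 v).symm) v).symm) hv

/-- Since `L(0) - 𝐋 + 𝐀` is a projection, its eigenprojections are itself, its complement, and `0`
for all other eigenvalues. -/
theorem eigenProj_opD (e : ℤ) (v : V) : eigenProj (𝒱.vir 0 - g.opL + g.opA) g.isInternal_opL_sub e v =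
    if e = 0 then v - g.opD v else if e = 1 then g.opD v else 0 := by
  have key : ∀ μ, ∀ v ∈ g.sector μ, eigenProj (𝒱.vir 0 - g.opL + g.opA) g.isInternal_opL_sub e v =
      ((if e = 0 then 1 - g.opD else if e = 1 then g.opD else 0 : Module.End ℂ V)) v := by
    intro μ v hv
    have hD := g.opD_apply hv
    have hm : v ∈ (𝒱.vir 0 - g.opL + g.opA).eigenspace
        (((if (gWeight μ).re = 0 then 0 else 1 : ℤ)) : ℂ) := by
      rw [Module.End.mem_eigenspace_iff]
      rw [opD] at hD
      rw [hD]
      split_ifs <;> simp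
    refine (diagOp_apply g.isInternal_opL_sub (fun k : ℤ => if k = e then (1 : ℂ) else 0)
      (i := if (gWeight μ).re = 0 then 0 else 1) hm).trans ?_
    by_cases hμ : (gWeight μ).re = 0
    · rw [if_pos hμ] at hD
      by_cases h0 : e = 0
      · simp [hμ, h0, hD]
      · by_cases h1 : e = 1 <;> simp [hμ, h0, h1, hD, Ne.symm h0]
    · rw [if_neg hμ] at hD
      by_cases h0 : e = 0
      · simp [hμ, h0, hD]
      · by_cases h1 : e = 1
        · simp [hμ, h1, hD]
        · simp [hμ, h0, h1, Ne.symm h1]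
  have := g.eq_of_sector key v
  rw [this]
  split_ifs <;> simp

/-- `y^D (1 + y)^B u` for the projection `D = L(0) - 𝐋 + 𝐀`, which commutes with `B`: the factor
`y^D` is `1` on the kernel and `y` on the image of `D`. -/
theorem varPow_onePlusPow {B : Module.End ℂ V} (hB : ∀ v, B (g.opD v) = g.opD (B v)) (u : V)
    (k : ℤ) :
    varPow (𝒱.vir 0 - g.opL + g.opA) g.isInternal_opL_sub (onePlusPow B u) k =
      onePlusPow B (u - g.opD u) k + onePlusPow B (g.opD u) (k - 1) := by
  have hc : ∀ k : ℤ, g.opD (onePlusPow B u k) = onePlusPow B (g.opD u) k := by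
    intro k
    rw [onePlusPow, onePlusPow]
    split_ifs
    · exact binomOp_intertwine g.opD (fun u => (hB u).symm) _ u
    · exact map_zero _
  have hc' : onePlusPow B (u - g.opD u) k = onePlusPow B u k - onePlusPow B (g.opD u) k := by
    rw [onePlusPow, onePlusPow, onePlusPow]
    split_ifs <;> simp
  rw [varPow, finsum_eq_sum_of_support_subset (s := {0, 1})]
  · rw [Finset.sum_pair zero_ne_one, eigenProj_opD, eigenProj_opD]
    simp [hc, hc']
  · intro e he
    by_contra hne
    apply he
    simp only
    simp only [Finset.coe_insert, Finset.coe_singleton, Set.mem_insert_iff,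
      Set.mem_singleton_iff, not_or] at hne
    rw [eigenProj_opD, if_neg hne.1, if_neg hne.2]

/-- Splitting a residue with `y^{L(0) - 𝐋 + 𝐀}` by the eigenvalue of `L(0) - 𝐋 + 𝐀`. -/
theorem resY_varPow {ℓ : LaurentSeries ℂ} (hℓ : OrderOne ℓ) {B : Module.End ℂ V}
    (hW : 𝒱.PreservesWt B) (hB : ∀ v, B (g.opD v) = g.opD (B v)) (n : ℤ) (u v : V) :
    resY 𝒱 ℓ (shift (-n) (varPow (𝒱.vir 0 - g.opL + g.opA) g.isInternal_opL_sub
      (onePlusPow B u))) v =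
      resY 𝒱 ℓ (shift (-n) (onePlusPow B (u - g.opD u))) v +
        resY 𝒱 ℓ (shift (1 - n) (onePlusPow B (g.opD u))) v := by
  obtain ⟨p, hp⟩ := 𝒱.exists_mem_wtLE u
  rw [← resY_add hℓ (s := -n) (n := p)
    (fun k hk => shift_onePlusPow_eq_zero _ _ _ _ hk)
    (fun k => shift_onePlusPow_mem hW (Submodule.sub_mem _ hp (g.opD_mem_wtLE hp)) _ k)
    (fun k hk => shift_onePlusPow_eq_zero _ _ _ _ (by omega))
    (fun k => shift_onePlusPow_mem hW (g.opD_mem_wtLE hp) _ k)]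
  congr 1
  funext k
  rw [shift, g.varPow_onePlusPow hB]
  simp only [shift]
  congr 2
  ring

theorem opL_add_opN_opD (v : V) : (g.opL + g.opN) (g.opD v) = g.opD ((g.opL + g.opN) v) := by
  rw [opL_add_opN]
  refine g.opD_commute (fun v => ?_) v
  rw [LinearMap.add_apply, LinearMap.add_apply, map_add, g.op_vir,
    g.opP_commute (S := g.op) (fun _ => rfl)]

theorem opP_opD (v : V) : g.opP (g.opD v) = g.opD (g.opP v) :=
  g.opD_commute (fun v => (g.opP_commute (S := g.op) (fun _ => rfl) v).symm) v

/-- The twisted mode `Res_x x^m Y((1 + x)^{𝐋 + 𝒩} u, x) v`. -/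
abbrev tm (m : ℤ) : V →ₗ[ℂ] V →ₗ[ℂ] V :=
  VertexOperatorAlgebra.tmode g.preservesWt_opL_add_opN m

theorem star_eq (u v : V) : g.star u v = g.tm (-1) u v := resY_varY_onePlusPow _ _ _ _

/-- The generators of `O_g(V)`, split by the eigenvalue of the projection `L(0) - 𝐋 + 𝐀`. -/
theorem ordO_eq : g.ordO = Submodule.span ℂ {z | ∃ (n : ℤ) (u v : V), 1 < n ∧
    z = g.tm (-n) (u - g.opD u) v + g.tm (1 - n) (g.opD u) v} := by
  rw [ordO]
  congr 1
  ext z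
  simp only [Set.mem_ofPred_eq]
  refine exists_congr fun n => exists_congr fun u => exists_congr fun v => and_congr_right fun _ => ?_
  rw [g.resY_varPow orderOne_varY g.preservesWt_opL_add_opN g.opL_add_opN_opD,
    resY_varY_onePlusPow g.preservesWt_opL_add_opN, resY_varY_onePlusPow g.preservesWt_opL_add_opN]

end VOAAut

/-! ### The algebra `A_g(V)` -/

/-- A bilinear product on `V` that is associative and unital modulo an ideal `O` makes `V / O` an
associative algebra. -/
theorem exists_quotient_algebra {V : Type*} [AddCommGroup V] [Module ℂ V] {O : Submodule ℂ V}
    (β : V →ₗ[ℂ] V →ₗ[ℂ] V) (e : V) (hl : ∀ u ∈ O, ∀ v, β u v ∈ O) (hr : ∀ u, ∀ v ∈ O, β u v ∈ O)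
    (hassoc : ∀ u v w, β (β u v) w - β u (β v w) ∈ O) (hone : ∀ v, β e v = v)
    (hone' : ∀ u, β u e = u) :
    ∃ m : (V ⧸ O) →ₗ[ℂ] (V ⧸ O) →ₗ[ℂ] (V ⧸ O),
      (∀ u v, m (O.mkQ u) (O.mkQ v) = O.mkQ (β u v)) ∧ IsAssociativeAlgebra m (O.mkQ e) := by
  let φ : V →ₗ[ℂ] (V ⧸ O) →ₗ[ℂ] (V ⧸ O) :=
    { toFun := fun u => O.mapQ O (β u) fun v hv => hr u v hv
      map_add' := fun u u' => by
        ext v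
        simp
      map_smul' := fun c u => by
        ext v
        simp }
  have hφ : O ≤ LinearMap.ker φ := fun u hu => by
    rw [LinearMap.mem_ker]
    ext v
    simpa [φ] using hl u hu v
  have hm : ∀ u v, O.liftQ φ hφ (O.mkQ u) (O.mkQ v) = O.mkQ (β u v) := fun u v => rfl
  refine ⟨O.liftQ φ hφ, hm, ⟨fun x y z => ?_, fun x => ?_, fun x => ?_⟩⟩
  · obtain ⟨u, rfl⟩ := O.mkQ_surjective x
    obtain ⟨v, rfl⟩ := O.mkQ_surjective y
    obtain ⟨w, rfl⟩ := O.mkQ_surjective z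
    rw [hm, hm, hm, hm]
    simpa using (Submodule.Quotient.eq O).2 (hassoc u v w)
  · obtain ⟨u, rfl⟩ := O.mkQ_surjective x
    rw [hm, hone]
  · obtain ⟨u, rfl⟩ := O.mkQ_surjective x
    rw [hm, hone']

namespace VOAAut

variable {V : Type*} [AddCommGroup V] [Module ℂ V] {𝒱 : VertexOperatorAlgebra V} (g : VOAAut 𝒱)

/-- Membership in a subspace may be tested on generalized eigenspaces for nonzero eigenvalues. -/
theorem mem_of_sector {V' : Type*} [AddCommGroup V'] [Module ℂ V'] {S : V →ₗ[ℂ] V'}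
    {W : Submodule ℂ V'} (h : ∀ μ ≠ 0, ∀ v ∈ g.sector μ, S v ∈ W) (v : V) : S v ∈ W := by
  have : ⨆ μ, g.sector μ ≤ W.comap S := iSup_le fun μ v hv => by
    by_cases hμ : μ = 0
    · subst hμ
      rw [g.eq_zero_of_mem_sector_zero hv]
      exact Submodule.zero_mem _
    · exact h μ hμ v hv
  exact this (g.isInternal_genEigenspace.submodule_iSup_eq_top ▸ Submodule.mem_top)

theorem tm_mem_sector {μ ν : ℂ} {u v : V} (hu : u ∈ g.sector μ) (hv : v ∈ g.sector ν) (m : ℤ) :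
    g.tm m u v ∈ g.sector (μ * ν) := by
  rw [VertexOperatorAlgebra.tmode_apply]
  exact finsum_induction (· ∈ g.sector (μ * ν)) (Submodule.zero_mem _)
    (fun _ _ => Submodule.add_mem _) fun j =>
      g.mode_mem_sector (binomOp_mem (fun _ => g.opL_add_opN_mem_sector) j hu) hv _

theorem exists_tm_eq_zero (u v : V) : ∃ M : ℕ, ∀ m : ℤ, M ≤ m → g.tm m u v = 0 := by
  obtain ⟨p, hp⟩ := 𝒱.exists_mem_wtLE u
  obtain ⟨q, hq⟩ := 𝒱.exists_mem_wtLE v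
  exact ⟨(p + q - 𝒱.minWt).toNat, fun m hm => 𝒱.eq_zero_of_mem_wtLE (by omega)
    (VertexOperatorAlgebra.tmode_mem_wtLE _ hp hq m)⟩

/-- On the generalized eigenspace of `g` with eigenvalue `μ`, the generators of `O_g(V)` are the
residues `Res_x x^{-n} Y((1 + x)^{𝐋 + 𝒩} u, x) v` with `n ≥ poleOrder μ`. -/
def poleOrder (μ : ℂ) : ℤ := if (gWeight μ).re = 0 then 2 else 1

/-- Twisted modes with `m ≤ -poleOrder μ` lie in `O_g(V)`; by `ordO_le` they span it. -/
theorem tm_mem_ordO {μ : ℂ} {u : V} (hu : u ∈ g.sector μ) {m : ℤ} (hm : m ≤ -poleOrder μ) (v : V) :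
    g.tm m u v ∈ g.ordO := by
  have hD := g.opD_apply hu
  rw [ordO_eq]
  rw [poleOrder] at hm
  by_cases hμ : (gWeight μ).re = 0
  · rw [if_pos hμ] at hD hm
    exact Submodule.subset_span ⟨-m, u, v, by omega, by simp [hD]⟩
  · rw [if_neg hμ] at hD hm
    exact Submodule.subset_span ⟨1 - m, u, v, by omega, by simp [hD]⟩

/-- `O_g(V)` is the smallest subspace that contains the twisted modes of `tm_mem_ordO`. -/
theorem ordO_le {W : Submodule ℂ V} (h : ∀ μ ≠ 0, ∀ u ∈ g.sector μ, ∀ n : ℤ, poleOrder μ ≤ n →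
    ∀ v, g.tm (-n) u v ∈ W) : g.ordO ≤ W := by
  rw [ordO_eq, Submodule.span_le]
  rintro _ ⟨n, u, v, hn, rfl⟩
  refine g.mem_of_sector (S := ((g.tm (-n)).flip v) ∘ₗ (1 - g.opD) + ((g.tm (1 - n)).flip v) ∘ₗ g.opD)
    (fun μ hμ u hu => ?_) u
  have hD := g.opD_apply hu
  by_cases h0 : (gWeight μ).re = 0
  · rw [if_pos h0] at hD
    simpa [hD] using h μ hμ u hu n (by rw [poleOrder, if_pos h0]; omega) v
  · rw [if_neg h0] at hD
    simpa [hD] using h μ hμ u hu (n - 1) (by rw [poleOrder, if_neg h0]; omega) v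

theorem opL_add_opN_vac : (g.opL + g.opN) 𝒱.vac = 0 := by
  have hop : g.op 𝒱.vac = 𝒱.vac := g.map_vac
  have hs : 𝒱.vac ∈ g.sector 1 := by
    refine (Module.End.mem_maxGenEigenspace _ _ _).2 ⟨1, ?_⟩
    simp [hop]
  have hw : gWeight 1 = 0 := by simp [gWeight]
  have hN : evalSeries (PowerSeries.log ℂ) (g.unipotentPart - 1)
      g.locallyNilpotent_unipotentPart_sub_one 𝒱.vac = 0 := by
    rw [evalSeries_eq_sum (J := 1)]
    · simp
    · rw [pow_one, LinearMap.sub_apply, g.unipotentPart_apply hs, hop]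
      simp
  have h0 : 𝒱.vir 0 𝒱.vac = 0 := (𝒱.creation 𝒱.conf).2 1 (by norm_num)
  rw [opL_add_opN, opP_eq, LinearMap.add_apply, LinearMap.add_apply, diagOp_apply _ _ hs, h0, opN,
    LinearMap.smul_apply, hN, sectorExp, hw]
  simp

/-- The vacuum is a left identity for `*_g` already on `V`, because `𝐋 + 𝒩` kills it. -/
theorem tm_vac_left (v : V) : g.tm (-1) 𝒱.vac v = v := by
  rw [VertexOperatorAlgebra.tmode_apply, finsum_eq_single _ 0]
  · simp [binomOp_zero, VertexOperatorAlgebra.mode, 𝒱.vacuum]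
  · intro j hj
    rw [binomOp_eigen (r := 0) (by rw [g.opL_add_opN_vac]; simp), Ring.choose_zero_pos ℤ (Nat.pos_of_ne_zero hj), zero_smul,
      𝒱.mode_zero]

/-- The vacuum is a right identity for `*_g` already on `V`, by the creation property. -/
theorem tm_vac_right (u : V) : g.tm (-1) u 𝒱.vac = u := by
  rw [VertexOperatorAlgebra.tmode_apply, finsum_eq_single _ 0]
  · simpa [binomOp_zero, VertexOperatorAlgebra.mode] using (𝒱.creation u).1
  · intro j hj
    exact (𝒱.creation _).2 _ (by omega)

/-- A twisted mode with `m = -1` of an iterated twisted mode, as a combination of products of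
twisted modes.  The sum over `r` cancels the factor `(1 + x)^{l + 1 - k}` of the twisted Jacobi
identity. -/
theorem exists_tm_tm_eq {μ ν : ℂ} {k : ℤ} (hk : sectorExp (μ * ν) = sectorExp μ + sectorExp ν + k)
    {u v : V} (hu : u ∈ g.sector μ) (hv : v ∈ g.sector ν) (w : V) (l : ℤ) (d : ℕ)
    (hd : l + 1 - k = -d) :
    ∃ M : ℕ, 0 < M ∧ g.tm (-1) (g.tm l u v) w = ∑ r ∈ Finset.range (d + 1), d.choose r •
      ∑ i ∈ Finset.range M, ((-1 : ℤ) ^ i * Ring.choose l i) •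
        (g.tm (l - i) u (g.tm (-1 + r + i) v w) -
          (-1 : ℂ) ^ l • g.tm (-1 + r + l - i) v (g.tm i u w)) := by
  have hTJ := fun r : ℕ => VertexOperatorAlgebra.twisted_jacobi g.preservesWt_opL_add_opN
    (fun _ => g.opL_add_opN_mem_sector) (fun _ => g.opL_add_opN_mem_sector)
    (fun m _ hu _ hv => g.opL_add_opN_mode hk m hu hv) hu hv w l 0 (-1 + r)
  choose M₀ hM₀ using hTJ
  obtain ⟨M₁, hM₁⟩ := g.exists_tm_eq_zero (g.tm l u v) w
  set M := M₁ + d + 2 + ∑ r ∈ Finset.range (d + 1), M₀ r with hM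
  have hle : ∀ r ∈ Finset.range (d + 1), M₀ r ≤ M := fun r hr =>
    (Finset.single_le_sum (f := M₀) (fun _ _ => Nat.zero_le _) hr).trans (by omega)
  refine ⟨M, by omega, ?_⟩
  -- the twisted Jacobi identity with `m = 0` has the single term `i = 0` on the left; its exponent
  -- `l + 1 - k` is `-d`
  have hr : ∀ r ∈ Finset.range (d + 1), ∑ i ∈ Finset.range M, ((-1 : ℤ) ^ i * Ring.choose l i) •
        (g.tm (l - i) u (g.tm (-1 + r + i) v w) -
          (-1 : ℂ) ^ l • g.tm (-1 + r + l - i) v (g.tm i u w)) =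
      ∑ s ∈ Finset.range M, Ring.choose (-d : ℤ) s • g.tm (-1 + r + s) (g.tm l u v) w := by
    intro r hr
    have := hM₀ r M (hle r hr)
    simp only [zero_add] at this
    rw [← this, Finset.sum_eq_single 0]
    · simp [hd]
    · intro i _ hi
      rw [Ring.choose_zero_pos ℤ (Nat.pos_of_ne_zero hi), zero_smul]
    · intro h
      exact absurd (Finset.mem_range.2 (by omega)) h
  rw [Finset.sum_congr rfl fun r h => by rw [hr r h]]
  have hext : ∑ r ∈ Finset.range (d + 1), d.choose r •
      ∑ s ∈ Finset.range M, Ring.choose (-d : ℤ) s • g.tm (-1 + r + s) (g.tm l u v) w =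
      ∑ r ∈ Finset.range M, d.choose r •
      ∑ s ∈ Finset.range M, Ring.choose (-d : ℤ) s • g.tm (-1 + r + s) (g.tm l u v) w := by
    refine Finset.sum_subset (fun r hr => Finset.mem_range.2 ?_) fun r _ hr => ?_
    · have := Finset.mem_range.1 hr
      omega
    · rw [Nat.choose_eq_zero_of_lt (by simpa using hr), zero_smul]
  rw [hext]
  simp only [Finset.smul_sum]
  rw [Finset.sum_comm, ← sum_range_antidiagonal (G := fun s r => d.choose r •
    Ring.choose (-d : ℤ) s • g.tm (-1 + r + s) (g.tm l u v) w)]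
  · -- `∑ binom(-d, s) binom(d, r)` over `s + r = n` is the coefficient of `x^n` in `(1 + x)^{-d} (1
    -- + x)^d = 1`
    rw [Finset.sum_eq_single 0]
    · simp
    · intro n _ hn
      have h0 := choose_add_natCast (-d) d n
      rw [neg_add_cancel, Ring.choose_zero_pos ℤ (Nat.pos_of_ne_zero hn)] at h0
      have : ∀ p ∈ antidiagonal n, d.choose p.2 • Ring.choose (-d : ℤ) p.1 •
          g.tm (-1 + p.2 + p.1) (g.tm l u v) w =
          (Ring.choose (-d : ℤ) p.1 * (d.choose p.2 : ℤ)) • g.tm (-1 + n) (g.tm l u v) w := by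
        intro p hp
        rw [mem_antidiagonal] at hp
        rw [← natCast_zsmul, smul_smul, mul_comm, ← hp,
          show (-1 : ℤ) + p.2 + p.1 = -1 + ((p.1 + p.2 : ℕ) : ℤ) by push_cast; ring]
      rw [Finset.sum_congr rfl this, ← Finset.sum_smul, ← h0, zero_smul]
    · intro h
      exact absurd (Finset.mem_range.2 (by omega)) h
  · intro s r hsr
    rw [hM₁ _ (by omega), smul_zero, smul_zero]

theorem poleOrder_mul_of_left {μ ν : ℂ} (hμ : μ ≠ 0) (hν : ν ≠ 0) (h : (gWeight μ).re = 0) :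
    poleOrder (μ * ν) = poleOrder ν := by
  rw [poleOrder, poleOrder, gWeight_mul_of_re_eq_zero hμ hν h, Complex.add_re, h, zero_add]

/-- `O_g(V)` is a left ideal for `*_g`. -/
theorem star_mem_ordO_right (u : V) {v : V} (hv : v ∈ g.ordO) : g.tm (-1) u v ∈ g.ordO := by
  refine g.mem_of_sector (S := (g.tm (-1)).flip v) (fun μ hμ u hu => ?_) u
  rw [LinearMap.flip_apply]
  -- if `Re a ≠ 0`, then `m = -1` is already among the exponents of the generators
  by_cases h0 : (gWeight μ).re = 0
  swap
  · exact g.tm_mem_ordO hu (by rw [poleOrder, if_neg h0]) v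
  suffices g.ordO ≤ g.ordO.comap (g.tm (-1) u) from this hv
  refine g.ordO_le fun ν hν v hv n hn w => ?_
  rw [Submodule.mem_comap]
  -- The case `l = 0`, `m = -1` of the twisted Jacobi identity is a commutator formula; its left
  -- side consists of modes of degree at most `-n` on the generalized eigenspace of `μ ν`, whose
  -- pole order is that of `ν`.
  obtain ⟨M₀, hM₀⟩ := VertexOperatorAlgebra.twisted_jacobi g.preservesWt_opL_add_opN
    (fun _ => g.opL_add_opN_mem_sector) (fun _ => g.opL_add_opN_mem_sector)
    (fun m _ hu _ hv => g.opL_add_opN_mode (sectorExp_mul_of_left hμ hν h0) m hu hv) hu hv w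
    0 (-1) (-n)
  have h := hM₀ (M₀ + 1) (by omega)
  have hR : ∑ i ∈ Finset.range (M₀ + 1), ((-1 : ℤ) ^ i * Ring.choose 0 i) •
        (g.tm (-1 + 0 - i) u (g.tm (-n + i) v w) -
          (-1 : ℂ) ^ (0 : ℤ) • g.tm (-n + 0 - i) v (g.tm (-1 + i) u w)) =
      g.tm (-1) u (g.tm (-n) v w) - g.tm (-n) v (g.tm (-1) u w) := by
    rw [Finset.sum_eq_single 0]
    · simp
    · intro i _ hi
      rw [Ring.choose_zero_pos ℤ (Nat.pos_of_ne_zero hi), mul_zero, zero_smul]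
    · simp
  rw [hR] at h
  rw [← sub_add_cancel (g.tm (-1) u (g.tm (-n) v w)) (g.tm (-n) v (g.tm (-1) u w)), ← h]
  refine Submodule.add_mem _ (Submodule.sum_mem _ fun i _ => ?_) (g.tm_mem_ordO hv (by omega) _)
  refine zsmul_mem (Submodule.sum_mem _ fun s _ => ?_) _
  -- the sum over `s` stops at `i + 1`, so that the exponents `-1 - n - i + s` do not exceed `-n`
  by_cases hs : i + 1 < s
  · rw [show (0 : ℤ) + i + 1 - 0 = (i + 1 : ℕ) by push_cast; ring, Ring.choose_natCast,
      Nat.choose_eq_zero_of_lt hs, Nat.cast_zero, zero_smul]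
    exact Submodule.zero_mem _
  · refine zsmul_mem (g.tm_mem_ordO (g.tm_mem_sector hu hv _) ?_ w) _
    rw [poleOrder_mul_of_left hμ hν h0]
    omega

/-- The generators of `O_g(V)` multiply `V` into `O_g(V)`. -/
theorem tm_tm_mem_ordO {μ ν : ℂ} (hμ : μ ≠ 0) (hν : ν ≠ 0) {u v : V} (hu : u ∈ g.sector μ)
    (hv : v ∈ g.sector ν) (w : V) {n : ℤ} (hn : poleOrder μ ≤ n) :
    g.tm (-1) (g.tm (-n) u v) w ∈ g.ordO := by
  -- if the exponent of `μ ν` has nonzero real part, all products from that eigenspace are in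
  -- `O_g(V)`
  by_cases h1 : (gWeight (μ * ν)).re = 0
  swap
  · exact g.tm_mem_ordO (g.tm_mem_sector hu hv _) (by rw [poleOrder, if_neg h1]) w
  -- otherwise both exponents have zero real parts, or neither has; the shift `k` is `0` or `1`,
  -- respectively
  have hp : poleOrder μ = poleOrder ν ∧
      sectorExp (μ * ν) = sectorExp μ + sectorExp ν + ((2 - poleOrder μ : ℤ) : ℂ) := by
    by_cases h0 : (gWeight μ).re = 0
    · have hν0 : (gWeight ν).re = 0 := by
        rw [← h1, gWeight_mul_of_re_eq_zero hμ hν h0, Complex.add_re, h0, zero_add]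
      exact ⟨by rw [poleOrder, poleOrder, if_pos h0, if_pos hν0],
        by rw [poleOrder, if_pos h0]; simpa using sectorExp_mul_of_left hμ hν h0⟩
    · have hν0 : (gWeight ν).re ≠ 0 := by
        intro hν0
        rw [mul_comm, gWeight_mul_of_re_eq_zero hν hμ hν0, Complex.add_re, hν0, zero_add] at h1
        exact h0 h1
      exact ⟨by rw [poleOrder, poleOrder, if_neg h0, if_neg hν0],
        by rw [poleOrder, if_neg h0]; simpa using sectorExp_mul_of_ne hμ hν h0 h1⟩
  have hp2 : poleOrder μ ≤ 2 := by rw [poleOrder]; split_ifs <;> norm_num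
  have hp1 : 1 ≤ poleOrder μ := by rw [poleOrder]; split_ifs <;> norm_num
  -- expanded by `exists_tm_tm_eq`, the double mode has outer factors `u` and `v` with exponents at
  -- most `-n` and `-1 + r - n`, where `r ≤ n + 1 - poleOrder μ`
  obtain ⟨M, -, hM⟩ := g.exists_tm_tm_eq hp.2 hu hv w (-n) (n + 1 - poleOrder μ).toNat (by omega)
  rw [hM]
  refine Submodule.sum_mem _ fun r hr => nsmul_mem (Submodule.sum_mem _ fun i _ => zsmul_mem
    (Submodule.sub_mem _ (g.tm_mem_ordO hu (by omega) _)
      (Submodule.smul_mem _ _ (g.tm_mem_ordO hv ?_ _))) _) _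
  have := Finset.mem_range.1 hr
  omega

/-- `O_g(V)` is a right ideal for `*_g`. -/
theorem star_mem_ordO_left {u : V} (hu : u ∈ g.ordO) (w : V) : g.tm (-1) u w ∈ g.ordO := by
  suffices g.ordO ≤ g.ordO.comap ((g.tm (-1)).flip w) from this hu
  refine g.ordO_le fun μ hμ u hu n hn v => ?_
  rw [Submodule.mem_comap, LinearMap.flip_apply]
  have h : ∀ ν ≠ 0, ∀ v ∈ g.sector ν, (((g.tm (-1)).flip w) ∘ₗ g.tm (-n) u) v ∈ g.ordO := by
    intro ν hν v hv
    rw [LinearMap.comp_apply, LinearMap.flip_apply]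
    exact g.tm_tm_mem_ordO hμ hν hu hv w hn
  have := g.mem_of_sector h v
  rwa [LinearMap.comp_apply, LinearMap.flip_apply] at this

/-- `*_g` is associative modulo `O_g(V)`. -/
theorem star_assoc (u v w : V) :
    g.tm (-1) (g.tm (-1) u v) w - g.tm (-1) u (g.tm (-1) v w) ∈ g.ordO := by
  refine g.mem_of_sector (S := ((g.tm (-1)).flip w) ∘ₗ (g.tm (-1)).flip v -
    (g.tm (-1)).flip (g.tm (-1) v w)) (fun μ hμ u hu => ?_) u
  refine g.mem_of_sector (S := ((g.tm (-1)).flip w) ∘ₗ g.tm (-1) u -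
    (g.tm (-1) u) ∘ₗ (g.tm (-1)).flip w) (fun ν hν v hv => ?_) v
  change g.tm (-1) (g.tm (-1) u v) w - g.tm (-1) u (g.tm (-1) v w) ∈ g.ordO
  -- If `Re a ≠ 0` for `u`, or for `v`, both triple products lie in `O_g(V)`.  If both real parts
  -- vanish, all terms of `exists_tm_tm_eq` for `l = -1`, `d = 0` lie in `O_g(V)`, except `u * (v *
  -- w)`.
  by_cases h0 : (gWeight μ).re = 0
  swap
  · have hp : poleOrder μ = 1 := by rw [poleOrder, if_neg h0]
    exact Submodule.sub_mem _ (g.tm_tm_mem_ordO hμ hν hu hv w hp.le)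
      (g.tm_mem_ordO hu (by rw [hp]) _)
  have hp : poleOrder μ = 2 := by rw [poleOrder, if_pos h0]
  by_cases h1 : (gWeight ν).re = 0
  swap
  · have hp' : poleOrder ν = 1 := by rw [poleOrder, if_neg h1]
    exact Submodule.sub_mem _ (g.tm_mem_ordO (g.tm_mem_sector hu hv _)
      (by rw [poleOrder_mul_of_left hμ hν h0, hp']) w)
      (g.star_mem_ordO_right u (g.tm_mem_ordO hv (by rw [hp']) w))
  have hp' : poleOrder ν = 2 := by rw [poleOrder, if_pos h1]
  obtain ⟨M, hM0, hM⟩ := g.exists_tm_tm_eq (sectorExp_mul_of_left hμ hν h0) hu hv w (-1) 0 (by simp)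
  obtain ⟨M, rfl⟩ : ∃ M', M = M' + 1 := ⟨M - 1, by omega⟩
  rw [hM]
  simp only [zero_add, Finset.range_one, Finset.sum_singleton, Nat.choose_self, one_smul,
    Nat.cast_zero, add_zero]
  rw [Finset.sum_range_succ', add_sub_assoc]
  refine Submodule.add_mem _ (Submodule.sum_mem _ fun i _ => zsmul_mem (Submodule.sub_mem _
    (g.tm_mem_ordO hu (by push_cast; omega) _)
    (Submodule.smul_mem _ _ (g.tm_mem_ordO hv (by push_cast; omega) _))) _) ?_
  simp only [pow_zero, Ring.choose_zero_right, mul_one, one_smul, Nat.cast_zero, sub_zero, add_zero]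
  rw [sub_sub_cancel_left]
  exact Submodule.neg_mem _ (Submodule.smul_mem _ _ (g.tm_mem_ordO hv (by omega) _))

theorem exists_mul_ordA : ∃ m : g.OrdA →ₗ[ℂ] g.OrdA →ₗ[ℂ] g.OrdA,
    (∀ u v, m (g.ordO.mkQ u) (g.ordO.mkQ v) = g.ordO.mkQ (g.star u v)) ∧
      IsAssociativeAlgebra m (g.ordO.mkQ 𝒱.vac) := by
  simp only [star_eq]
  exact exists_quotient_algebra (g.tm (-1)) 𝒱.vac (fun _ hu v => g.star_mem_ordO_left hu v)
    (fun u _ hv => g.star_mem_ordO_right u hv) g.star_assoc g.tm_vac_left g.tm_vac_right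

end VOAAut

/-! ### Divided powers and truncated exponentials of operators -/

section Exponential

variable {U U₁ U₂ : Type*} [AddCommGroup U] [Module ℂ U] [AddCommGroup U₁] [Module ℂ U₁]
  [AddCommGroup U₂] [Module ℂ U₂]

/-- The divided power `T^n / n!`. -/
def divPow (T : Module.End ℂ U) (n : ℕ) : Module.End ℂ U := (n.factorial : ℂ)⁻¹ • T ^ n

theorem divPow_zero (T : Module.End ℂ U) (u : U) : divPow T 0 u = u := by simp [divPow]

theorem divPow_one (T : Module.End ℂ U) (u : U) : divPow T 1 u = T u := by simp [divPow]

theorem divPow_succ (T : Module.End ℂ U) (n : ℕ) (u : U) :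
    ((n : ℂ) + 1) • divPow T (n + 1) u = T (divPow T n u) := by
  have hn : ((n : ℂ) + 1) ≠ 0 := by exact_mod_cast Nat.succ_ne_zero n
  rw [divPow, divPow, LinearMap.smul_apply, LinearMap.smul_apply, map_smul, smul_smul,
    Nat.factorial_succ, pow_succ', Module.End.mul_apply]
  push_cast
  rw [mul_inv, mul_inv_cancel_left₀ hn]

theorem divPow_succ_apply (T : Module.End ℂ U) (n : ℕ) (u : U) :
    divPow T (n + 1) u = ((n : ℂ) + 1)⁻¹ • T (divPow T n u) := by
  have hn : ((n : ℂ) + 1) ≠ 0 := by exact_mod_cast Nat.succ_ne_zero n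
  rw [← divPow_succ, inv_smul_smul₀ hn]

theorem apply_divPow (T : Module.End ℂ U) (n : ℕ) (u : U) :
    divPow T n (T u) = T (divPow T n u) := by
  rw [divPow, LinearMap.smul_apply, LinearMap.smul_apply, map_smul, ← Module.End.mul_apply,
    ← Module.End.mul_apply, ← pow_succ, pow_succ']

theorem divPow_mem {T : Module.End ℂ U} {W : ℤ → Submodule ℂ U} {d : ℤ}
    (hT : ∀ k, ∀ u ∈ W k, T u ∈ W (k + d)) (n : ℕ) {k : ℤ} {u : U} (hu : u ∈ W k) :
    divPow T n u ∈ W (k + n * d) := by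
  induction n with
  | zero => simpa [divPow_zero] using hu
  | succ n ih =>
    rw [divPow_succ_apply]
    refine Submodule.smul_mem _ _ ?_
    have := hT _ _ ih
    rwa [show k + n * d + d = k + ((n + 1 : ℕ) : ℤ) * d by push_cast; ring] at this

/-- Leibniz rule for divided powers. -/
theorem divPow_bilinear (β : U₁ →ₗ[ℂ] U₂ →ₗ[ℂ] U) {T : Module.End ℂ U} {T₁ : Module.End ℂ U₁}
    {T₂ : Module.End ℂ U₂} (h : ∀ u v, T (β u v) = β (T₁ u) v + β u (T₂ v)) (n : ℕ) (u : U₁)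
    (v : U₂) :
    divPow T n (β u v) = ∑ p ∈ antidiagonal n, β (divPow T₁ p.1 u) (divPow T₂ p.2 v) := by
  induction n with
  | zero => simp [divPow_zero]
  | succ n ih =>
    have hn : ((n : ℂ) + 1) ≠ 0 := by exact_mod_cast Nat.succ_ne_zero n
    rw [divPow_succ_apply, ih, inv_smul_eq_iff₀ hn,
      ← sum_antidiagonal_succ_smul (fun i j => β (divPow T₁ i u) (divPow T₂ j v)), map_sum]
    refine Finset.sum_congr rfl fun p _ => ?_
    rw [h, ← divPow_succ, ← divPow_succ]
    simp

/-- The truncated exponential `∑_{j < J} T^j / j!`. -/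
def expTrunc (J : ℕ) (T : Module.End ℂ U) : Module.End ℂ U := ∑ j ∈ Finset.range J, divPow T j

theorem expTrunc_apply (J : ℕ) (T : Module.End ℂ U) (u : U) :
    expTrunc J T u = ∑ j ∈ Finset.range J, divPow T j u := by
  simp [expTrunc]

/-- The exponential of a derivation of a bilinear product is multiplicative; truncated at order `J`,
this holds modulo any subspace that contains all terms of total order at least `J`. -/
theorem expTrunc_bilinear (β : U₁ →ₗ[ℂ] U₂ →ₗ[ℂ] U) {T : Module.End ℂ U} {T₁ : Module.End ℂ U₁}
    {T₂ : Module.End ℂ U₂} (h : ∀ u v, T (β u v) = β (T₁ u) v + β u (T₂ v)) {F : Submodule ℂ U}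
    {J : ℕ} {u : U₁} {v : U₂}
    (hF : ∀ i j, J ≤ i + j → β (divPow T₁ i u) (divPow T₂ j v) ∈ F) :
    expTrunc J T (β u v) - β (expTrunc J T₁ u) (expTrunc J T₂ v) ∈ F := by
  rw [← Submodule.Quotient.eq, ← Submodule.mkQ_apply, ← Submodule.mkQ_apply]
  simp only [expTrunc_apply, divPow_bilinear β h, map_sum, LinearMap.sum_apply]
  rw [sum_range_antidiagonal (G := fun i j => F.mkQ (β (divPow T₁ i u) (divPow T₂ j v)))
    fun i j hij => by
      rw [Submodule.mkQ_apply, Submodule.Quotient.mk_eq_zero]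
      exact hF i j hij]
  rw [Finset.sum_comm]

/-- `exp(T) exp(-T) = 1` for truncated exponentials, modulo a subspace that contains all terms of
total order at least `J`. -/
theorem expTrunc_neg {T : Module.End ℂ U} {F : Submodule ℂ U} {J : ℕ} (hJ : 0 < J) {u : U}
    (hF : ∀ i j, J ≤ i + j → divPow T i (divPow (-T) j u) ∈ F) :
    expTrunc J T (expTrunc J (-T) u) - u ∈ F := by
  -- the Leibniz rule for the pairing `(X, u) ↦ X u`, on which `X ↦ X T` and `-T` have total action
  -- `0`
  have h : ∀ n, ∑ p ∈ antidiagonal n, divPow T p.1 (divPow (-T) p.2 u) =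
      divPow (0 : Module.End ℂ U) n u := by
    intro n
    have := divPow_bilinear (T := (0 : Module.End ℂ U)) (T₁ := LinearMap.mulRight ℂ T) (T₂ := -T)
      (LinearMap.id : Module.End ℂ U →ₗ[ℂ] Module.End ℂ U) (fun X v => by simp) n 1 u
    rw [LinearMap.id_apply, Module.End.one_apply] at this
    rw [this]
    refine Finset.sum_congr rfl fun p _ => ?_
    congr 1
    simp [divPow, LinearMap.pow_mulRight]
  have hG := sum_range_antidiagonal (M := J)
    (G := fun i j => F.mkQ (divPow T i (divPow (-T) j u))) fun i j hij => by
      rw [Submodule.mkQ_apply, Submodule.Quotient.mk_eq_zero]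
      exact hF i j hij
  rw [← Submodule.Quotient.eq, ← Submodule.mkQ_apply, ← Submodule.mkQ_apply]
  calc F.mkQ (expTrunc J T (expTrunc J (-T) u))
      = ∑ i ∈ Finset.range J, ∑ j ∈ Finset.range J, F.mkQ (divPow T i (divPow (-T) j u)) := by
        simp only [expTrunc_apply, map_sum]
        exact Finset.sum_comm
    _ = ∑ n ∈ Finset.range J, F.mkQ (divPow (0 : Module.End ℂ U) n u) := by
        rw [← hG]
        exact Finset.sum_congr rfl fun n _ => by rw [← map_sum, h]
    _ = F.mkQ u := by
        rw [Finset.sum_eq_single 0]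
        · rw [divPow_zero]
        · intro n _ hn
          simp [divPow, hn]
        · intro h0
          exact absurd (Finset.mem_range.2 hJ) h0

/-- On a vector killed by `T^J`, the exponential is the exponential truncated at `J`. -/
theorem evalSeries_exp_eq {T : Module.End ℂ U} (hT : LocallyNilpotent T) {u : U} {J : ℕ}
    (hJ : (T ^ J) u = 0) : evalSeries (PowerSeries.exp ℂ) T hT u = expTrunc J T u := by
  rw [evalSeries_eq_sum _ hT hJ, expTrunc_apply]
  refine Finset.sum_congr rfl fun k _ => ?_
  simp [divPow, PowerSeries.coeff_exp]

theorem divPow_intertwine {T : Module.End ℂ U} {T' : Module.End ℂ U₁} (S : U →ₗ[ℂ] U₁)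
    (h : ∀ u, S (T u) = T' (S u)) (n : ℕ) (u : U) : S (divPow T n u) = divPow T' n (S u) := by
  simp [divPow, pow_apply_comm S h]

theorem expTrunc_intertwine {T : Module.End ℂ U} {T' : Module.End ℂ U₁} (S : U →ₗ[ℂ] U₁)
    (h : ∀ u, S (T u) = T' (S u)) (J : ℕ) (u : U) : S (expTrunc J T u) = expTrunc J T' (S u) := by
  simp [expTrunc_apply, divPow_intertwine S h]

theorem neg_pow_apply_eq_zero {T : Module.End ℂ U} {J : ℕ} {u : U} (h : (T ^ J) u = 0) :
    ((-T) ^ J) u = 0 := by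
  rw [neg_pow, Module.End.mul_apply, h, map_zero]

theorem LocallyNilpotent.neg {T : Module.End ℂ U} (hT : LocallyNilpotent T) :
    LocallyNilpotent (-T) := fun u => (hT u).imp fun _ => neg_pow_apply_eq_zero

theorem evalSeries_exp_neg {T : Module.End ℂ U} (hT : LocallyNilpotent T)
    (hT' : LocallyNilpotent (-T)) (u : U) :
    evalSeries (PowerSeries.exp ℂ) T hT (evalSeries (PowerSeries.exp ℂ) (-T) hT' u) = u := by
  obtain ⟨J, hJ⟩ := hT u
  have hJ' := pow_apply_eq_zero_of_le hJ (Nat.le_succ J)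
  have hcomm : ∀ (i j : ℕ) (u : U), (T ^ i) (divPow (-T) j u) = divPow (-T) j ((T ^ i) u) :=
    fun i j u => (divPow_intertwine (T' := -T) (T ^ i) (fun u => by
      rw [LinearMap.neg_apply, LinearMap.neg_apply, map_neg, ← Module.End.mul_apply,
        ← Module.End.mul_apply, ← pow_succ, pow_succ']) j u)
  rw [evalSeries_exp_eq hT' (neg_pow_apply_eq_zero hJ'), evalSeries_exp_eq hT (J := J + 1)]
  · have := expTrunc_neg (F := ⊥) (T := T) (u := u) (Nat.succ_pos J) fun i j hij => by
      have h0 : ((-T) ^ j) ((T ^ i) u) = 0 := by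
        rw [neg_pow, Module.End.mul_apply, ← Module.End.mul_apply (T ^ j), ← pow_add,
          pow_apply_eq_zero_of_le hJ (by omega), map_zero]
      rw [Submodule.mem_bot, divPow, LinearMap.smul_apply, hcomm, divPow, LinearMap.smul_apply, h0,
        smul_zero, smul_zero]
    exact sub_eq_zero.1 ((Submodule.mem_bot ℂ).1 this)
  · rw [expTrunc_apply, map_sum]
    exact Finset.sum_eq_zero fun j _ => by rw [hcomm, hJ', map_zero]

end Exponential

/-! ### Laurent series: derivation and order filtration -/

section Laurent

/-- The field `ℂ((x))` with its structure of `ℂ`-algebra, as a type of its own: `LaurentSeries ℂ`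
carries several scalar actions of `ℂ` that agree only after unfolding. -/
def Laurent : Type := LaurentSeries ℂ

instance : Field Laurent := inferInstanceAs (Field (LaurentSeries ℂ))

instance : Algebra ℂ Laurent :=
  RingHom.toAlgebra (S := Laurent) (HahnSeries.C : ℂ →+* LaurentSeries ℂ)

/-- The coefficient of `x^n`. -/
def lcoeff (n : ℤ) : Laurent →ₗ[ℂ] ℂ where
  toFun f := HahnSeries.coeff (f : LaurentSeries ℂ) n
  map_add' _ _ := rfl
  map_smul' c f := by
    rw [Algebra.smul_def]
    exact HahnSeries.coeff_single_zero_mul (r := c) (x := (f : LaurentSeries ℂ))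

theorem laurent_ext {f g : Laurent} (h : ∀ n, lcoeff n f = lcoeff n g) : f = g :=
  HahnSeries.ext (Γ := ℤ) (R := ℂ) (funext h)

/-- The monomial `x^n`. -/
def mono (n : ℤ) : Laurent := (HahnSeries.single n (1 : ℂ) : LaurentSeries ℂ)

theorem lcoeff_mono_same (n : ℤ) : lcoeff n (mono n) = 1 := HahnSeries.coeff_single_same n (1 : ℂ)

theorem lcoeff_mono_of_ne {m n : ℤ} (h : m ≠ n) : lcoeff m (mono n) = 0 :=
  HahnSeries.coeff_single_of_ne h

theorem lcoeff_mono_mul (m n : ℤ) (f : Laurent) : lcoeff n (mono m * f) = lcoeff (n - m) f := by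
  have := HahnSeries.coeff_single_mul_add (r := (1 : ℂ)) (x := (f : LaurentSeries ℂ)) (a := n - m)
    (b := m)
  rw [sub_add_cancel, one_mul] at this
  exact this

theorem mono_mul_mono (m n : ℤ) : mono m * mono n = mono (m + n) := by
  have := HahnSeries.single_mul_single (a := m) (b := n) (r := (1 : ℂ)) (s := (1 : ℂ))
  rw [one_mul] at this
  exact this

theorem mono_zero : mono 0 = 1 := rfl

theorem mono_ne_zero (n : ℤ) : mono n ≠ 0 := HahnSeries.single_ne_zero (one_ne_zero (α := ℂ))

/-- A power series as a Laurent series. -/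
def ofPS : ℂ⟦X⟧ →+* Laurent := (HahnSeries.ofPowerSeries ℤ ℂ : ℂ⟦X⟧ →+* LaurentSeries ℂ)

theorem lcoeff_ofPS (f : ℂ⟦X⟧) (n : ℤ) :
    lcoeff n (ofPS f) = if n < 0 then 0 else PowerSeries.coeff n.natAbs f :=
  PowerSeries.coeff_coe f n

theorem ofPS_X : ofPS PowerSeries.X = mono 1 := HahnSeries.ofPowerSeries_X (Γ := ℤ) (R := ℂ)

/-- The derivation `d/dx` of `ℂ((x))`. -/
def dX : Module.End ℂ Laurent where
  toFun f := LaurentSeries.derivative ℂ (f : LaurentSeries ℂ)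
  map_add' f g := map_add (LaurentSeries.derivative ℂ) (f : LaurentSeries ℂ) g
  map_smul' c f := by
    refine laurent_ext fun n => ?_
    have hs : ∀ h : Laurent, lcoeff n (c • h) = c • lcoeff n h := fun h => map_smul _ c h
    refine Eq.trans ?_ (hs _).symm
    change Ring.choose (n + (1 : ℕ)) 1 • lcoeff (n + (1 : ℕ)) (c • f) =
      c • (Ring.choose (n + (1 : ℕ)) 1 • lcoeff (n + (1 : ℕ)) f)
    rw [map_smul, smul_comm]

theorem lcoeff_dX (f : Laurent) (n : ℤ) : lcoeff n (dX f) = (n + 1) * lcoeff (n + 1) f := by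
  have : lcoeff n (dX f) = Ring.choose (n + (1 : ℕ)) 1 • lcoeff (n + (1 : ℕ)) f := rfl
  rw [this, Ring.choose_one_right, zsmul_eq_mul]
  push_cast
  rfl

/-- The coefficients of the divided power `(d/dx)^k / k!`. -/
theorem lcoeff_divPow_dX (k : ℕ) (f : Laurent) (n : ℤ) :
    lcoeff n (divPow dX k f) = Ring.choose (n + k) k * lcoeff (n + k) f := by
  induction k generalizing n with
  | zero => simp [divPow_zero]
  | succ k ih =>
    have hk : ((k : ℂ) + 1) ≠ 0 := by exact_mod_cast Nat.succ_ne_zero k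
    rw [divPow_succ_apply, map_smul, lcoeff_dX, ih, smul_eq_mul, inv_mul_eq_iff_eq_mul₀ hk]
    have := choose_succ_int (n + (k + 1 : ℕ)) k
    have h2 : ((k : ℂ) + 1) * (Ring.choose (n + (k + 1 : ℕ)) (k + 1) : ℤ) =
        (n + 1) * (Ring.choose (n + 1 + k) k : ℤ) := by
      rw [show n + 1 + (k : ℤ) = n + (k + 1 : ℕ) by push_cast; ring]
      have h3 : n + ((k + 1 : ℕ) : ℤ) - k = n + 1 := by push_cast; ring
      rw [h3] at this
      exact_mod_cast this
    rw [← mul_assoc, ← mul_assoc, h2, show n + 1 + (k : ℤ) = n + (k + 1 : ℕ) by push_cast; ring]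

theorem lcoeff_mul (f g : Laurent) (n : ℤ) : lcoeff n (f * g) = ∑ p ∈ Finset.antidiagonal
    (HahnSeries.isPWO_support (f : LaurentSeries ℂ))
    (HahnSeries.isPWO_support (g : LaurentSeries ℂ)) n, lcoeff p.1 f * lcoeff p.2 g := rfl

/-- The Leibniz rule.  It is checked for `x d/dx`, which multiplies the coefficient of `x^n` by `n`
and so does not enlarge supports. -/
theorem dX_mul (f g : Laurent) : dX (f * g) = dX f * g + f * dX g := by
  have hθ : ∀ (f : Laurent) (n : ℤ), lcoeff n (mono 1 * dX f) = n * lcoeff n f := by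
    intro f n
    rw [lcoeff_mono_mul, lcoeff_dX]
    push_cast
    rw [sub_add_cancel, sub_add_cancel]
  have hs : ∀ f : Laurent, HahnSeries.support (mono 1 * dX f : LaurentSeries ℂ) ⊆
      HahnSeries.support (f : LaurentSeries ℂ) := by
    intro f n hn
    have hn : lcoeff n (mono 1 * dX f) ≠ 0 := hn
    rw [hθ] at hn
    exact right_ne_zero_of_mul hn
  have h : mono 1 * dX (f * g) = mono 1 * dX f * g + f * (mono 1 * dX g) := by
    refine laurent_ext fun n => ?_
    have e2 := HahnSeries.coeff_mul_left' (x := (mono 1 * dX f : LaurentSeries ℂ))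
      (y := (g : LaurentSeries ℂ)) (a := n)
      (HahnSeries.isPWO_support (f : LaurentSeries ℂ)) (hs f)
    have e3 := HahnSeries.coeff_mul_right' (x := (f : LaurentSeries ℂ))
      (y := (mono 1 * dX g : LaurentSeries ℂ)) (a := n)
      (HahnSeries.isPWO_support (g : LaurentSeries ℂ)) (hs g)
    rw [hθ, map_add, lcoeff_mul, Finset.mul_sum]
    refine Eq.trans ?_ (congrArg₂ (· + ·) e2 e3).symm
    rw [← Finset.sum_add_distrib]
    refine Finset.sum_congr rfl fun p hp => ?_
    have hp := (Finset.mem_antidiagonal.1 hp).2.2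
    change _ = lcoeff p.1 (mono 1 * dX f) * lcoeff p.2 g + lcoeff p.1 f * lcoeff p.2 (mono 1 * dX g)
    rw [hθ, hθ, ← hp]
    push_cast
    ring
  apply mul_left_cancel₀ (mono_ne_zero 1)
  rw [h]
  ring

theorem dX_one : dX 1 = 0 := by
  have := dX_mul 1 1
  rw [one_mul, one_mul, mul_one] at this
  simpa using this

theorem dX_mono_one : dX (mono 1) = 1 := by
  refine laurent_ext fun n => ?_
  rw [lcoeff_dX, ← mono_zero]
  by_cases hn : n = 0
  · subst hn
    rw [zero_add, lcoeff_mono_same, lcoeff_mono_same]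
    simp
  · rw [lcoeff_mono_of_ne (by omega), mul_zero, lcoeff_mono_of_ne hn]

theorem dX_ofPS (f : ℂ⟦X⟧) : dX (ofPS f) = ofPS (PowerSeries.derivative ℂ f) := by
  refine laurent_ext fun n => ?_
  rw [lcoeff_dX, lcoeff_ofPS, lcoeff_ofPS]
  by_cases hn : n < 0
  · rw [if_pos hn]
    by_cases h1 : n = -1
    · subst h1
      simp
    · rw [if_pos (by omega), mul_zero]
  · rw [if_neg hn, if_neg (by omega)]
    obtain ⟨k, rfl⟩ := Int.eq_ofNat_of_zero_le (not_lt.1 hn)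
    rw [Int.natAbs_natCast, PowerSeries.coeff_derivative,
      show ((k : ℤ) + 1).natAbs = k + 1 by omega]
    push_cast
    ring

theorem dX_inv {f : Laurent} (hf : f ≠ 0) : dX f⁻¹ = -(dX f * f⁻¹ * f⁻¹) := by
  have h := dX_mul f f⁻¹
  rw [mul_inv_cancel₀ hf, dX_one] at h
  apply mul_left_cancel₀ hf
  rw [← neg_eq_of_add_eq_zero_right h.symm]
  field_simp

theorem dX_zpow {f : Laurent} (hf : f ≠ 0) (n : ℤ) :
    dX (f ^ n) = (n : ℂ) • (f ^ (n - 1) * dX f) := by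
  have hnat : ∀ n : ℕ, dX (f ^ n) = (n : ℂ) • (f ^ ((n : ℤ) - 1) * dX f) := by
    intro n
    induction n with
    | zero => simp [dX_one]
    | succ n ih =>
      rw [pow_succ, dX_mul, ih]
      have : f ^ ((n : ℤ) - 1) * f = f ^ n := by
        rw [← zpow_add_one₀ hf, sub_add_cancel, zpow_natCast]
      push_cast
      rw [add_sub_cancel_right, zpow_natCast, add_smul, one_smul, smul_mul_assoc, mul_right_comm, this]
  obtain ⟨k, rfl | rfl⟩ := n.eq_nat_or_neg
  · have := hnat k
    rw [zpow_natCast]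
    exact_mod_cast this
  · rw [zpow_neg, zpow_natCast, dX_inv (pow_ne_zero _ hf), hnat]
    have : f ^ (-(k : ℤ) - 1) = f ^ ((k : ℤ) - 1) * (f ^ k)⁻¹ * (f ^ k)⁻¹ := by
      rw [← zpow_natCast f k, ← zpow_neg, ← zpow_add₀ hf, ← zpow_add₀ hf]
      congr 1
      ring
    rw [this]
    generalize f ^ ((k : ℤ) - 1) = A
    generalize (f ^ k)⁻¹ = B
    push_cast
    rw [neg_smul, smul_mul_assoc, smul_mul_assoc, mul_right_comm A (dX f) B,
      mul_right_comm (A * B) (dX f) B]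

/-- The subspace `x^n ℂ[[x]]` of `ℂ((x))`. -/
def ordGE (n : ℤ) : Submodule ℂ Laurent where
  carrier := {f | ∀ k < n, lcoeff k f = 0}
  add_mem' hf hg k hk := by rw [map_add, hf k hk, hg k hk, add_zero]
  zero_mem' _ _ := rfl
  smul_mem' c f hf k hk := by rw [map_smul, hf k hk, smul_zero]

theorem ordGE_mono {m n : ℤ} (h : m ≤ n) : ordGE n ≤ ordGE m := fun _ hf k hk =>
  hf k (lt_of_lt_of_le hk h)

/-- The order of vanishing at `x = 0`. -/
def lorder (f : Laurent) : ℤ := HahnSeries.order (f : LaurentSeries ℂ)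

theorem mem_ordGE_of_le_order {f : Laurent} {n : ℤ} (h : n ≤ lorder f) : f ∈ ordGE n :=
  fun _ hk => HahnSeries.coeff_eq_zero_of_lt_order (lt_of_lt_of_le hk h)

theorem exists_mem_ordGE (f : Laurent) : ∃ n : ℤ, f ∈ ordGE n :=
  ⟨lorder f, mem_ordGE_of_le_order le_rfl⟩

theorem mono_mem_ordGE {n p : ℤ} (h : n ≤ p) : mono p ∈ ordGE n :=
  fun _ hk => lcoeff_mono_of_ne (by omega)

theorem mul_mem_ordGE {m n : ℤ} {f g : Laurent} (hf : f ∈ ordGE m) (hg : g ∈ ordGE n) :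
    f * g ∈ ordGE (m + n) := by
  intro k hk
  rw [lcoeff_mul]
  refine Finset.sum_eq_zero fun p hp => ?_
  have h := (Finset.mem_antidiagonal.1 hp).2.2
  by_cases h1 : p.1 < m
  · rw [hf _ h1, zero_mul]
  · rw [hg _ (by omega), mul_zero]

theorem dX_mem_ordGE {n : ℤ} {f : Laurent} (hf : f ∈ ordGE n) : dX f ∈ ordGE (n - 1) := by
  intro k hk
  rw [lcoeff_dX, hf _ (by omega), mul_zero]

/-- The derivative of a power series is a power series: the coefficient of `x^{-1}` of a derivative
vanishes. -/
theorem dX_mem_ordGE_zero {f : Laurent} (hf : f ∈ ordGE 0) : dX f ∈ ordGE 0 := by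
  intro k hk
  rw [lcoeff_dX]
  by_cases h1 : k = -1
  · subst h1
    simp
  · rw [hf _ (by omega), mul_zero]

theorem ofPS_mem_ordGE (f : ℂ⟦X⟧) : ofPS f ∈ ordGE 0 := by
  intro k hk
  rw [lcoeff_ofPS, if_pos hk]

theorem ofPS_mem_ordGE_of_dvd {f : ℂ⟦X⟧} {n : ℕ} (h : (PowerSeries.X : ℂ⟦X⟧) ^ n ∣ f) :
    ofPS f ∈ ordGE n := by
  intro k hk
  rw [lcoeff_ofPS]
  split_ifs with h0
  · rfl
  · exact PowerSeries.X_pow_dvd_iff.1 h _ (by omega)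

theorem one_mem_ordGE : (1 : Laurent) ∈ ordGE 0 := mono_mem_ordGE le_rfl

theorem lorder_mul {f g : Laurent} (hf : f ≠ 0) (hg : g ≠ 0) :
    lorder (f * g) = lorder f + lorder g :=
  HahnSeries.order_mul (x := (f : LaurentSeries ℂ)) (y := (g : LaurentSeries ℂ)) hf hg

theorem lorder_one : lorder 1 = 0 := HahnSeries.order_one (Γ := ℤ) (R := ℂ)

theorem lorder_inv {f : Laurent} (hf : f ≠ 0) : lorder f⁻¹ = -lorder f := by
  have := lorder_mul hf (inv_ne_zero hf)
  rw [mul_inv_cancel₀ hf, lorder_one] at this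
  omega

theorem lorder_zpow {f : Laurent} (hf : f ≠ 0) (n : ℤ) : lorder (f ^ n) = n * lorder f := by
  have hnat : ∀ k : ℕ, lorder (f ^ k) = k * lorder f := by
    intro k
    induction k with
    | zero => simp [lorder_one]
    | succ k ih =>
      rw [pow_succ, lorder_mul (pow_ne_zero _ hf) hf, ih]
      push_cast
      ring
  obtain ⟨k, rfl | rfl⟩ := n.eq_nat_or_neg
  · rw [zpow_natCast, hnat]
  · rw [zpow_neg, zpow_natCast, lorder_inv (pow_ne_zero _ hf), hnat, neg_mul]

theorem zpow_mem_ordGE {f : Laurent} (hf : f ≠ 0) (h1 : lorder f = 1) (n : ℤ) :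
    f ^ n ∈ ordGE n :=
  mem_ordGE_of_le_order (by rw [lorder_zpow hf, h1, mul_one])

theorem lorder_eq_of_mem {f : Laurent} {n : ℤ} (hf : f ∈ ordGE n) (h : lcoeff n f ≠ 0) :
    lorder f = n := by
  refine le_antisymm (HahnSeries.order_le_of_coeff_ne_zero h) ?_
  by_contra hlt
  have h0 : f ≠ 0 := by
    rintro rfl
    exact h (map_zero _)
  exact h0 (HahnSeries.coeff_order_eq_zero.1 (hf _ (not_le.1 hlt)))

/-- Modulo `x^M ℂ[[x]]`, a Laurent series is a Laurent polynomial. -/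
theorem sub_sum_mem_ordGE {f : Laurent} {s : ℤ} (hf : f ∈ ordGE s) (M : ℤ) :
    f - ∑ p ∈ Finset.Ico s M, lcoeff p f • mono p ∈ ordGE M := by
  intro k hk
  rw [map_sub, map_sum, sub_eq_zero]
  simp only [map_smul, smul_eq_mul]
  by_cases hs : k < s
  · rw [hf k hs, Finset.sum_eq_zero]
    intro p hp
    have := Finset.mem_Ico.1 hp
    rw [lcoeff_mono_of_ne (by omega), mul_zero]
  · rw [Finset.sum_eq_single k]
    · rw [lcoeff_mono_same, mul_one]
    · intro p _ hp
      rw [lcoeff_mono_of_ne hp.symm, mul_zero]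
    · intro h
      exact absurd (Finset.mem_Ico.2 ⟨by omega, hk⟩) h

theorem lcoeff_zero_mul {f g : Laurent} (hf : f ∈ ordGE 0) (hg : g ∈ ordGE 0) :
    lcoeff 0 (f * g) = lcoeff 0 f * lcoeff 0 g := by
  have hf1 := sub_sum_mem_ordGE hf 1
  have hs : Finset.Ico (0 : ℤ) 1 = {0} := rfl
  rw [hs, Finset.sum_singleton, mono_zero] at hf1
  have := mul_mem_ordGE hf1 hg 0 (by norm_num)
  rwa [sub_mul, map_sub, smul_mul_assoc, one_mul, map_smul, sub_eq_zero] at this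

/-- Linear maps on `ℂ((x))` that vanish on some `x^M ℂ[[x]]` are determined by their values on
monomials. -/
theorem eq_of_mono_of_mem {E : Type*} [AddCommGroup E] [Module ℂ E] {Θ Θ' : Laurent →ₗ[ℂ] E}
    {M M' s : ℤ} (h : ∀ f ∈ ordGE M, Θ f = 0) (h' : ∀ f ∈ ordGE M', Θ' f = 0)
    (hs : ∀ m : ℤ, s ≤ m → Θ (mono m) = Θ' (mono m)) {f : Laurent} (hf : f ∈ ordGE s) :
    Θ f = Θ' f := by
  have hm := sub_sum_mem_ordGE hf (max M M')
  have e1 := h _ (ordGE_mono (le_max_left _ _) hm)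
  have e2 := h' _ (ordGE_mono (le_max_right _ _) hm)
  rw [map_sub, map_sum, sub_eq_zero] at e1 e2
  rw [e1, e2]
  exact Finset.sum_congr rfl fun p hp => by rw [map_smul, map_smul, hs p (Finset.mem_Ico.1 hp).1]

theorem eq_of_mono {E : Type*} [AddCommGroup E] [Module ℂ E] {Θ Θ' : Laurent →ₗ[ℂ] E}
    {M M' : ℤ} (h : ∀ f ∈ ordGE M, Θ f = 0) (h' : ∀ f ∈ ordGE M', Θ' f = 0)
    (hs : ∀ m : ℤ, Θ (mono m) = Θ' (mono m)) (f : Laurent) : Θ f = Θ' f := by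
  obtain ⟨s, hf⟩ := exists_mem_ordGE f
  exact eq_of_mono_of_mem h h' (fun m _ => hs m) hf

theorem divPow_dX_mono (k : ℕ) (m : ℤ) :
    divPow dX k (mono m) = ((Ring.choose m k : ℤ) : ℂ) • mono (m - k) := by
  refine laurent_ext fun n => ?_
  rw [lcoeff_divPow_dX, map_smul, smul_eq_mul]
  by_cases h : n + k = m
  · rw [h, lcoeff_mono_same, ← h, add_sub_cancel_right, lcoeff_mono_same]
  · rw [lcoeff_mono_of_ne h, lcoeff_mono_of_ne (by omega), mul_zero, mul_zero]

theorem dX_mono (m : ℤ) : dX (mono m) = (m : ℂ) • mono (m - 1) := by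
  have := divPow_dX_mono 1 m
  rw [divPow_one, Ring.choose_one_right] at this
  exact_mod_cast this

theorem divPow_dX_mem {n : ℤ} (k : ℕ) {f : Laurent} (hf : f ∈ ordGE n) :
    divPow dX k f ∈ ordGE (n - k) := by
  have := divPow_mem (T := dX) (d := -1) (fun k f hf => dX_mem_ordGE hf) k hf
  rwa [mul_neg_one, ← sub_eq_add_neg] at this

theorem divPow_dX_mem_zero (k : ℕ) {f : Laurent} (hf : f ∈ ordGE 0) : divPow dX k f ∈ ordGE 0 := by
  induction k with
  | zero => rwa [divPow_zero]
  | succ k ih =>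
    rw [divPow_succ_apply]
    exact Submodule.smul_mem _ _ (dX_mem_ordGE_zero ih)

end Laurent

/-! ### Flows of vector fields -/

section Flow

/-- The vector field `a d/dx`, acting on Laurent series. -/
def vecAct (a : Laurent) : Module.End ℂ Laurent := LinearMap.mulLeft ℂ a ∘ₗ dX

theorem vecAct_apply (a f : Laurent) : vecAct a f = a * dX f := rfl

/-- The operator `b ↦ a b' - a' b`, the bracket with `a d/dx` on vector fields `b d/dx`. -/
def adAct (a : Laurent) : Module.End ℂ Laurent :=
  LinearMap.mulLeft ℂ a ∘ₗ dX - LinearMap.mulLeft ℂ (dX a)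

theorem adAct_apply (a b : Laurent) : adAct a b = a * dX b - dX a * b := rfl

/-- The Taylor coefficients of the bracket of two vector fields. -/
theorem divPow_dX_adAct (a b : Laurent) (k : ℕ) :
    divPow dX k (adAct a b) = ∑ p ∈ antidiagonal k,
      (((p.2 : ℂ) + 1) • (divPow dX p.1 a * divPow dX (p.2 + 1) b) -
        ((p.1 : ℂ) + 1) • (divPow dX (p.1 + 1) a * divPow dX p.2 b)) := by
  have h := divPow_bilinear (LinearMap.mul ℂ Laurent) (T := dX) (T₁ := dX) (T₂ := dX) dX_mul k
  simp only [LinearMap.mul_apply'] at h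
  rw [adAct_apply, map_sub, h, h, ← Finset.sum_sub_distrib]
  refine Finset.sum_congr rfl fun p _ => ?_
  rw [apply_divPow, apply_divPow, ← divPow_succ, ← divPow_succ, mul_smul_comm, smul_mul_assoc]

theorem vecAct_mem {a : Laurent} (ha : a ∈ ordGE 2) (k : ℤ) (f : Laurent) (hf : f ∈ ordGE k) :
    vecAct a f ∈ ordGE (k + 1) := by
  have := mul_mem_ordGE ha (dX_mem_ordGE hf)
  rwa [show 2 + (k - 1) = k + 1 by ring] at this

theorem neg_vecAct_mem {a : Laurent} (ha : a ∈ ordGE 2) (k : ℤ) (f : Laurent) (hf : f ∈ ordGE k) :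
    (-vecAct a) f ∈ ordGE (k + 1) :=
  Submodule.neg_mem _ (vecAct_mem ha k f hf)

theorem adAct_mem {a : Laurent} (ha : a ∈ ordGE 2) (k : ℤ) (f : Laurent) (hf : f ∈ ordGE k) :
    adAct a f ∈ ordGE (k + 1) := by
  refine Submodule.sub_mem _ (vecAct_mem ha k f hf) ?_
  have := mul_mem_ordGE (dX_mem_ordGE ha) hf
  rwa [show (2 : ℤ) - 1 + k = k + 1 by ring] at this

theorem divPow_mem_ordGE {T : Module.End ℂ Laurent}
    (hT : ∀ k, ∀ f ∈ ordGE k, T f ∈ ordGE (k + 1)) (n : ℕ) {k : ℤ} {f : Laurent}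
    (hf : f ∈ ordGE k) : divPow T n f ∈ ordGE (k + n) := by
  simpa using divPow_mem hT n hf

theorem expTrunc_mem_ordGE {T : Module.End ℂ Laurent}
    (hT : ∀ k, ∀ f ∈ ordGE k, T f ∈ ordGE (k + 1)) (J : ℕ) {k : ℤ} {f : Laurent}
    (hf : f ∈ ordGE k) : expTrunc J T f ∈ ordGE k := by
  rw [expTrunc_apply]
  exact Submodule.sum_mem _ fun j _ => ordGE_mono (by omega) (divPow_mem_ordGE hT j hf)

/-- `exp(a d/dx)` is an algebra automorphism, up to truncation. -/
theorem expTrunc_vecAct_mul {a : Laurent} (ha : a ∈ ordGE 2) {m n : ℤ} {f g : Laurent}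
    (hf : f ∈ ordGE m) (hg : g ∈ ordGE n) (J : ℕ) :
    expTrunc J (vecAct a) (f * g) - expTrunc J (vecAct a) f * expTrunc J (vecAct a) g ∈
      ordGE (m + n + J) := by
  refine expTrunc_bilinear (LinearMap.mul ℂ Laurent) (fun f g => ?_) (fun i j hij => ?_)
  · simp only [LinearMap.mul_apply', vecAct_apply, dX_mul]
    ring
  · exact ordGE_mono (by omega) (mul_mem_ordGE (divPow_mem_ordGE (vecAct_mem ha) i hf)
      (divPow_mem_ordGE (vecAct_mem ha) j hg))

/-- `exp(a d/dx)` intertwines `b d/dx` with its transform under the adjoint action. -/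
theorem expTrunc_vecAct_dX {a : Laurent} (ha : a ∈ ordGE 2) {m n : ℤ} {b f : Laurent}
    (hb : b ∈ ordGE m) (hf : f ∈ ordGE n) (J : ℕ) :
    expTrunc J (vecAct a) (b * dX f) - expTrunc J (adAct a) b * dX (expTrunc J (vecAct a) f) ∈
      ordGE (m + n - 1 + J) := by
  refine expTrunc_bilinear ((LinearMap.mul ℂ Laurent).compl₂ dX) (fun f g => ?_) (fun i j hij => ?_)
  · simp only [LinearMap.compl₂_apply, LinearMap.mul_apply', vecAct_apply, adAct_apply, dX_mul]
    ring
  · exact ordGE_mono (by omega) (mul_mem_ordGE (divPow_mem_ordGE (adAct_mem ha) i hb)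
      (dX_mem_ordGE (divPow_mem_ordGE (vecAct_mem ha) j hf)))

theorem expTrunc_vecAct_one (a : Laurent) {J : ℕ} (hJ : 0 < J) : expTrunc J (vecAct a) 1 = 1 := by
  rw [expTrunc_apply, Finset.sum_eq_single 0]
  · exact divPow_zero _ _
  · intro n _ hn
    obtain ⟨k, rfl⟩ := Nat.exists_eq_succ_of_ne_zero hn
    rw [Nat.succ_eq_add_one, divPow_succ_apply, ← apply_divPow, vecAct_apply, dX_one, mul_zero,
      map_zero, smul_zero]
  · intro h
    exact absurd (Finset.mem_range.2 hJ) h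

/-- The series `e^x - 1`. -/
def expSub : Laurent := ofPS (PowerSeries.exp ℂ) - 1

/-- The series `log(1 + x)`. -/
def logL : Laurent := ofPS (PowerSeries.log ℂ)

theorem dX_expSub : dX expSub = 1 + expSub := by
  rw [expSub, map_sub, dX_one, dX_ofPS, PowerSeries.derivative_exp]
  ring

theorem expSub_mem : expSub ∈ ordGE 1 := by
  have : expSub = ofPS (PowerSeries.exp ℂ - 1) := by rw [map_sub, map_one, expSub]
  rw [this]
  exact_mod_cast ofPS_mem_ordGE_of_dvd (n := 1) (by
    rw [pow_one, PowerSeries.X_dvd_iff]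
    simp)

theorem logL_mem : logL ∈ ordGE 1 := by
  exact_mod_cast ofPS_mem_ordGE_of_dvd (n := 1) (by
    rw [pow_one, PowerSeries.X_dvd_iff]
    exact PowerSeries.constantCoeff_log)

theorem lorder_logL : lorder logL = 1 := by
  refine lorder_eq_of_mem logL_mem ?_
  rw [logL, lcoeff_ofPS, if_neg (by norm_num)]
  simp

theorem logL_ne_zero : logL ≠ 0 := by
  intro h
  have := lorder_logL
  have h0 : lorder 0 = 0 := HahnSeries.order_zero
  rw [h, h0] at this
  exact absurd this (by norm_num)

theorem one_add_mul_dX_logL : (1 + mono 1) * dX logL = 1 := by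
  rw [logL, dX_ofPS, ← ofPS_X, ← map_one ofPS, ← map_add, ← map_mul]
  congr 1
  ext n
  rw [add_mul, one_mul, map_add, PowerSeries.deriv_log, PowerSeries.coeff_mk]
  cases n with
  | zero => simp
  | succ n =>
    rw [PowerSeries.coeff_succ_X_mul, PowerSeries.coeff_mk, PowerSeries.coeff_one,
      if_neg (Nat.succ_ne_zero n)]
    simp [pow_succ]

theorem dX_logL_mem : dX logL ∈ ordGE 0 := dX_mem_ordGE logL_mem

/-- If the flow of `-a d/dx` at time one is `e^x - 1`, then `exp(a d/dx)` transforms `d/dx` into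
`(1 + x) d/dx`. -/
theorem expTrunc_adAct_one {a : Laurent} (ha : a ∈ ordGE 2)
    (hflow : ∀ J : ℕ, expSub - expTrunc J (-vecAct a) (mono 1) ∈ ordGE J) {J : ℕ} (hJ : 0 < J) :
    expTrunc J (adAct a) 1 - (1 + mono 1) ∈ ordGE (J - 1) := by
  -- with `E = exp(a d/dx)(e^x - 1) = x`, apply `exp(a d/dx)` to `d/dx (e^x - 1) = 1 + (e^x - 1)`:
  -- the transform `D d/dx` of `d/dx` satisfies `D E' = 1 + E`
  have h1 := expTrunc_vecAct_dX ha one_mem_ordGE expSub_mem J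
  have h2 : expTrunc J (vecAct a) expSub - mono 1 ∈ ordGE J := by
    have e1 := expTrunc_neg (T := vecAct a) (F := ordGE J) hJ (u := mono 1) fun i j hij =>
      ordGE_mono (by omega) (divPow_mem_ordGE (vecAct_mem ha) i
        (divPow_mem_ordGE (neg_vecAct_mem ha) j (mono_mem_ordGE le_rfl)))
    have e2 := expTrunc_mem_ordGE (vecAct_mem ha) J (hflow J)
    have := Submodule.add_mem _ e2 e1
    rwa [map_sub, sub_add_sub_cancel] at this
  have h3 : expTrunc J (adAct a) 1 ∈ ordGE 0 := expTrunc_mem_ordGE (adAct_mem ha) J one_mem_ordGE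
  have h4 := mul_mem_ordGE h3 (dX_mem_ordGE h2)
  rw [one_mul, dX_expSub, map_add, expTrunc_vecAct_one a hJ] at h1
  rw [map_sub, dX_mono_one] at h4
  generalize expTrunc J (vecAct a) expSub = E at *
  generalize expTrunc J (adAct a) 1 = D at *
  have e : D - (1 + mono 1) = (E - mono 1) - (1 + E - D * dX E) - D * (dX E - 1) := by ring
  rw [e]
  exact Submodule.sub_mem _ (Submodule.sub_mem _ (ordGE_mono (by omega) h2)
    (ordGE_mono (by omega) h1)) (ordGE_mono (by omega) h4)

/-- If the flow of `-a d/dx` at time one is `e^x - 1`, then that of `a d/dx` is `log(1 + x)`. -/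
theorem expTrunc_vecAct_mono_one {a : Laurent} (ha : a ∈ ordGE 2)
    (hflow : ∀ J : ℕ, expSub - expTrunc J (-vecAct a) (mono 1) ∈ ordGE J) {J : ℕ} (hJ : 0 < J) :
    expTrunc J (vecAct a) (mono 1) - logL ∈ ordGE J := by
  -- `μ = exp(a d/dx) x` satisfies `(1 + x) μ' = 1`, as the transform of `d/dx x = 1`
  have h1 := expTrunc_vecAct_dX ha one_mem_ordGE (mono_mem_ordGE (le_refl 1)) J
  have hμ : expTrunc J (vecAct a) (mono 1) ∈ ordGE 1 :=
    expTrunc_mem_ordGE (vecAct_mem ha) J (mono_mem_ordGE le_rfl)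
  have h2 := mul_mem_ordGE (expTrunc_adAct_one ha hflow hJ) (dX_mem_ordGE hμ)
  rw [one_mul, dX_mono_one, expTrunc_vecAct_one a hJ] at h1
  generalize expTrunc J (vecAct a) (mono 1) = μ at *
  generalize expTrunc J (adAct a) 1 = D at *
  have h3 : dX (μ - logL) ∈ ordGE (J - 1) := by
    have h4 : (1 + mono 1) * dX (μ - logL) ∈ ordGE (J - 1) := by
      have e : (1 + mono 1) * dX (μ - logL) =
          -(1 - D * dX μ) - (D - (1 + mono 1)) * dX μ + (1 - (1 + mono 1) * dX logL) := by
        rw [map_sub]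
        ring
      rw [e, one_add_mul_dX_logL, sub_self, add_zero]
      exact Submodule.sub_mem _ (Submodule.neg_mem _ (ordGE_mono (by omega) h1))
        (ordGE_mono (by omega) h2)
    have h5 := mul_mem_ordGE dX_logL_mem h4
    rwa [← mul_assoc, mul_comm (dX logL), one_add_mul_dX_logL, one_mul, zero_add] at h5
  intro k hk
  by_cases hk1 : k < 1
  · rw [map_sub, hμ k hk1, logL_mem k hk1, sub_self]
  · have h4 := h3 (k - 1) (by omega)
    rw [lcoeff_dX, sub_add_cancel] at h4
    push_cast at h4
    rw [sub_add_cancel] at h4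
    exact (mul_eq_zero.1 h4).resolve_left (by
      have : k ≠ 0 := by omega
      exact_mod_cast this)

/-- The change of variable `x ↦ log(1 + x)` on monomials, as the flow of a vector field. -/
theorem expTrunc_vecAct_mono {a : Laurent} (ha : a ∈ ordGE 2)
    (hflow : ∀ J : ℕ, expSub - expTrunc J (-vecAct a) (mono 1) ∈ ordGE J) {J : ℕ} (hJ : 0 < J)
    (m : ℤ) : expTrunc J (vecAct a) (mono m) - logL ^ m ∈ ordGE (m + J - 1) := by
  have hμ := expTrunc_vecAct_mono_one ha hflow hJ
  have hμ1 : expTrunc J (vecAct a) (mono 1) ∈ ordGE 1 :=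
    expTrunc_mem_ordGE (vecAct_mem ha) J (mono_mem_ordGE le_rfl)
  have hlog := zpow_mem_ordGE logL_ne_zero lorder_logL
  have hmul := fun m : ℤ => expTrunc_vecAct_mul ha (mono_mem_ordGE (le_refl m))
    (mono_mem_ordGE (le_refl 1)) J
  have hmem := fun m : ℤ => expTrunc_mem_ordGE (vecAct_mem ha) J (mono_mem_ordGE (le_refl m))
  simp only [mono_mul_mono] at hmul
  generalize expTrunc J (vecAct a) (mono 1) = μ at *
  induction m using Int.induction_on with
  | zero =>
    rw [mono_zero, expTrunc_vecAct_one a hJ, zpow_zero, sub_self]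
    exact Submodule.zero_mem _
  | succ m ih =>
    have e : expTrunc J (vecAct a) (mono (m + 1)) - logL ^ ((m : ℤ) + 1) =
        (expTrunc J (vecAct a) (mono (m + 1)) - expTrunc J (vecAct a) (mono m) * μ) +
        (expTrunc J (vecAct a) (mono m) - logL ^ (m : ℤ)) * μ + logL ^ (m : ℤ) * (μ - logL) := by
      rw [zpow_add_one₀ logL_ne_zero]
      ring
    rw [e]
    exact Submodule.add_mem _ (Submodule.add_mem _ (ordGE_mono (by omega) (hmul m))
      (ordGE_mono (by omega) (mul_mem_ordGE ih hμ1)))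
      (ordGE_mono (by omega) (mul_mem_ordGE (hlog m) hμ))
  | pred m ih =>
    have h1 := hmul (-(m : ℤ) - 1)
    rw [sub_add_cancel] at h1
    have h2 : expTrunc J (vecAct a) (mono (-(m : ℤ) - 1)) * logL - logL ^ (-(m : ℤ)) ∈
        ordGE (-(m : ℤ) + J - 1) := by
      have e : expTrunc J (vecAct a) (mono (-(m : ℤ) - 1)) * logL - logL ^ (-(m : ℤ)) =
          -(expTrunc J (vecAct a) (mono (-(m : ℤ) - 1)) * (μ - logL)) -
          (expTrunc J (vecAct a) (mono (-(m : ℤ))) -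
            expTrunc J (vecAct a) (mono (-(m : ℤ) - 1)) * μ) +
          (expTrunc J (vecAct a) (mono (-(m : ℤ))) - logL ^ (-(m : ℤ))) := by
        ring
      rw [e]
      exact Submodule.add_mem _ (Submodule.sub_mem _
        (Submodule.neg_mem _ (ordGE_mono (by omega) (mul_mem_ordGE (hmem _) hμ)))
        (ordGE_mono (by omega) h1)) ih
    have h3 := mul_mem_ordGE (hlog (-1)) h2
    have e : logL ^ (-1 : ℤ) * (expTrunc J (vecAct a) (mono (-(m : ℤ) - 1)) * logL -
        logL ^ (-(m : ℤ))) = expTrunc J (vecAct a) (mono (-(m : ℤ) - 1)) - logL ^ (-(m : ℤ) - 1) := by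
      rw [mul_sub, ← zpow_add₀ logL_ne_zero, mul_left_comm, zpow_neg_one,
        inv_mul_cancel₀ logL_ne_zero, mul_one, add_comm (-1 : ℤ), ← sub_eq_add_neg]
    rw [e] at h3
    exact ordGE_mono (by omega) h3

end Flow

/-! ### Vertex operators of elements of `ℂ((x)) ⊗ V` -/

namespace VertexOperatorAlgebra

open scoped TensorProduct

variable {V : Type*} [AddCommGroup V] [Module ℂ V] (𝒱 : VertexOperatorAlgebra V)

/-- The sum that defines `Res_x h(x) Y(u, x) v` is finite: below by the order of `h`, above by the
weights. -/
theorem finsum_lcoeff_mode_eq_sum {h : Laurent} {s : ℤ} (hh : h ∈ ordGE s) {p q : ℤ} {u v : V}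
    (hu : u ∈ 𝒱.wtLE p) (hv : v ∈ 𝒱.wtLE q) {M : ℤ} (hM : p + q - M - 1 < 𝒱.minWt) :
    ∑ᶠ m : ℤ, lcoeff m h • 𝒱.mode u m v = ∑ m ∈ Finset.Ico s M, lcoeff m h • 𝒱.mode u m v := by
  refine finsum_eq_sum_of_support_subset _ fun m hm => ?_
  by_contra hlt
  simp only [Finset.coe_Ico, Set.mem_Ico, not_and, not_lt] at hlt
  apply hm
  simp only
  by_cases h1 : m < s
  · rw [hh m h1, zero_smul]
  · have := hlt (by omega)
    rw [𝒱.mode_eq_zero hu hv (by omega), smul_zero]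

/-- The operator `Res_x h(x) Y(u, x)`, extended to `w = h ⊗ u ∈ ℂ((x)) ⊗ V` by linearity. -/
def vop : Laurent ⊗[ℂ] V →ₗ[ℂ] Module.End ℂ V :=
  TensorProduct.lift (LinearMap.mk₂ ℂ
    (fun h u =>
      { toFun := fun v => ∑ᶠ m : ℤ, lcoeff m h • 𝒱.mode u m v
        map_add' := fun v v' => by
          obtain ⟨s, hs⟩ := exists_mem_ordGE h
          obtain ⟨p, hu⟩ := 𝒱.exists_mem_wtLE u
          obtain ⟨q, hv⟩ := 𝒱.exists_mem_wtLE v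
          obtain ⟨q', hv'⟩ := 𝒱.exists_mem_wtLE v'
          have hv := 𝒱.wtLE_mono (le_max_left q q') hv
          have hv' := 𝒱.wtLE_mono (le_max_right q q') hv'
          have hM : p + max q q' - (p + max q q' - 𝒱.minWt) - 1 < 𝒱.minWt := by omega
          rw [𝒱.finsum_lcoeff_mode_eq_sum hs hu hv hM, 𝒱.finsum_lcoeff_mode_eq_sum hs hu hv' hM,
            𝒱.finsum_lcoeff_mode_eq_sum hs hu (add_mem hv hv') hM, ← Finset.sum_add_distrib]
          simp only [map_add, smul_add]
        map_smul' := fun c v => by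
          obtain ⟨s, hs⟩ := exists_mem_ordGE h
          obtain ⟨p, hu⟩ := 𝒱.exists_mem_wtLE u
          obtain ⟨q, hv⟩ := 𝒱.exists_mem_wtLE v
          have hM : p + q - (p + q - 𝒱.minWt) - 1 < 𝒱.minWt := by omega
          rw [𝒱.finsum_lcoeff_mode_eq_sum hs hu hv hM,
            𝒱.finsum_lcoeff_mode_eq_sum hs hu (Submodule.smul_mem _ c hv) hM, Finset.smul_sum]
          simp only [map_smul, RingHom.id_apply, smul_comm c] })
    (fun h h' u => by
      ext v
      obtain ⟨s, hs⟩ := exists_mem_ordGE h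
      obtain ⟨s', hs'⟩ := exists_mem_ordGE h'
      have hs := ordGE_mono (min_le_left s s') hs
      have hs' := ordGE_mono (min_le_right s s') hs'
      obtain ⟨p, hu⟩ := 𝒱.exists_mem_wtLE u
      obtain ⟨q, hv⟩ := 𝒱.exists_mem_wtLE v
      have hM : p + q - (p + q - 𝒱.minWt) - 1 < 𝒱.minWt := by omega
      simp only [LinearMap.coe_mk, AddHom.coe_mk, LinearMap.add_apply]
      rw [𝒱.finsum_lcoeff_mode_eq_sum hs hu hv hM, 𝒱.finsum_lcoeff_mode_eq_sum hs' hu hv hM,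
        𝒱.finsum_lcoeff_mode_eq_sum (add_mem hs hs') hu hv hM, ← Finset.sum_add_distrib]
      simp only [map_add, add_smul])
    (fun c h u => by
      ext v
      obtain ⟨s, hs⟩ := exists_mem_ordGE h
      obtain ⟨p, hu⟩ := 𝒱.exists_mem_wtLE u
      obtain ⟨q, hv⟩ := 𝒱.exists_mem_wtLE v
      have hM : p + q - (p + q - 𝒱.minWt) - 1 < 𝒱.minWt := by omega
      simp only [LinearMap.coe_mk, AddHom.coe_mk, LinearMap.smul_apply]
      rw [𝒱.finsum_lcoeff_mode_eq_sum hs hu hv hM,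
        𝒱.finsum_lcoeff_mode_eq_sum (Submodule.smul_mem _ c hs) hu hv hM, Finset.smul_sum]
      simp only [map_smul, smul_assoc])
    (fun h u u' => by
      ext v
      obtain ⟨s, hs⟩ := exists_mem_ordGE h
      obtain ⟨p, hu⟩ := 𝒱.exists_mem_wtLE u
      obtain ⟨p', hu'⟩ := 𝒱.exists_mem_wtLE u'
      have hu := 𝒱.wtLE_mono (le_max_left p p') hu
      have hu' := 𝒱.wtLE_mono (le_max_right p p') hu'
      obtain ⟨q, hv⟩ := 𝒱.exists_mem_wtLE v
      have hM : max p p' + q - (max p p' + q - 𝒱.minWt) - 1 < 𝒱.minWt := by omega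
      simp only [LinearMap.coe_mk, AddHom.coe_mk, LinearMap.add_apply]
      rw [𝒱.finsum_lcoeff_mode_eq_sum hs hu hv hM, 𝒱.finsum_lcoeff_mode_eq_sum hs hu' hv hM,
        𝒱.finsum_lcoeff_mode_eq_sum hs (add_mem hu hu') hv hM, ← Finset.sum_add_distrib]
      simp only [mode_add, smul_add])
    (fun c h u => by
      ext v
      obtain ⟨s, hs⟩ := exists_mem_ordGE h
      obtain ⟨p, hu⟩ := 𝒱.exists_mem_wtLE u
      obtain ⟨q, hv⟩ := 𝒱.exists_mem_wtLE v
      have hM : p + q - (p + q - 𝒱.minWt) - 1 < 𝒱.minWt := by omega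
      simp only [LinearMap.coe_mk, AddHom.coe_mk, LinearMap.smul_apply]
      rw [𝒱.finsum_lcoeff_mode_eq_sum hs hu hv hM,
        𝒱.finsum_lcoeff_mode_eq_sum hs (Submodule.smul_mem _ c hu) hv hM, Finset.smul_sum]
      simp only [mode_smul, smul_comm c]))

theorem vop_tmul (h : Laurent) (u v : V) :
    𝒱.vop (h ⊗ₜ u) v = ∑ᶠ m : ℤ, lcoeff m h • 𝒱.mode u m v := rfl

/-- `Res_x h(x) Y(u, x) v` vanishes if the order of `h` is large compared with the weights. -/
theorem vop_eq_zero {h : Laurent} {s : ℤ} (hh : h ∈ ordGE s) {p q : ℤ} {u v : V}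
    (hu : u ∈ 𝒱.wtLE p) (hv : v ∈ 𝒱.wtLE q) (hs : p + q - s - 1 < 𝒱.minWt) :
    𝒱.vop (h ⊗ₜ u) v = 0 := by
  rw [vop_tmul, 𝒱.finsum_lcoeff_mode_eq_sum hh hu hv hs, Finset.Ico_self, Finset.sum_empty]

theorem vop_mono (m : ℤ) (u v : V) : 𝒱.vop (mono m ⊗ₜ u) v = 𝒱.mode u m v := by
  rw [vop_tmul, finsum_eq_single _ m fun n hn => by rw [lcoeff_mono_of_ne hn, zero_smul],
    lcoeff_mono_same, one_smul]

/-- The linear map `h ↦ Res_x h(x) Y(u, x) v`. -/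
def vopL (u v : V) : Laurent →ₗ[ℂ] V :=
  (LinearMap.applyₗ v) ∘ₗ 𝒱.vop ∘ₗ (TensorProduct.mk ℂ Laurent V).flip u

theorem vopL_apply (u v : V) (h : Laurent) : 𝒱.vopL u v h = 𝒱.vop (h ⊗ₜ u) v := rfl

/-- The operator `∂/∂x ⊗ 1 + 1 ⊗ L(-1)` on `ℂ((x)) ⊗ V`. -/
def tder : Module.End ℂ (Laurent ⊗[ℂ] V) := dX.rTensor V + (𝒱.vir (-1)).lTensor Laurent

theorem tder_tmul (h : Laurent) (u : V) :
    𝒱.tder (h ⊗ₜ u) = dX h ⊗ₜ u + h ⊗ₜ 𝒱.vir (-1) u := rfl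

theorem tder_smul (b : Laurent) (w : Laurent ⊗[ℂ] V) :
    𝒱.tder (b • w) = dX b • w + b • 𝒱.tder w := by
  induction w using TensorProduct.induction_on with
  | zero => simp
  | tmul h u =>
    rw [TensorProduct.smul_tmul', tder_tmul, tder_tmul, smul_add, TensorProduct.smul_tmul',
      TensorProduct.smul_tmul', TensorProduct.smul_tmul', smul_eq_mul, smul_eq_mul, smul_eq_mul,
      dX_mul, TensorProduct.add_tmul, add_assoc]
  | add w w' h h' =>
    rw [smul_add, map_add, h, h', smul_add, map_add, smul_add]
    abel

/-- The residue of a total derivative vanishes. -/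
theorem vop_tder (w : Laurent ⊗[ℂ] V) (v : V) : 𝒱.vop (𝒱.tder w) v = 0 := by
  induction w using TensorProduct.induction_on with
  | zero => simp
  | tmul h u =>
    obtain ⟨p, hu⟩ := 𝒱.exists_mem_wtLE u
    obtain ⟨q, hv⟩ := 𝒱.exists_mem_wtLE v
    have hu1 := 𝒱.vir_mem_wtLE (-1) hu
    refine eq_of_mono (Θ := 𝒱.vopL u v ∘ₗ dX + 𝒱.vopL (𝒱.vir (-1) u) v) (Θ' := 0)
      (M := p + q - 𝒱.minWt + 1) (M' := 0) (fun f hf => ?_) (fun f _ => rfl) (fun m => ?_) h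
    · rw [LinearMap.add_apply, LinearMap.comp_apply, vopL_apply, vopL_apply,
        𝒱.vop_eq_zero (dX_mem_ordGE hf) hu hv (by omega), 𝒱.vop_eq_zero hf hu1 hv (by omega), add_zero]
    · rw [LinearMap.add_apply, LinearMap.comp_apply, dX_mono, map_smul, vopL_apply, vopL_apply,
        vop_mono, vop_mono, vir_neg_one_mode]
      simp
  | add w w' h h' => rw [map_add, map_add, LinearMap.add_apply, h, h', add_zero]

theorem vir_eq_zero {p : ℤ} {u : V} (hu : u ∈ 𝒱.wtLE p) {j : ℤ} (hj : p - j < 𝒱.minWt) :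
    𝒱.vir j u = 0 :=
  𝒱.eq_zero_of_mem_wtLE hj (𝒱.vir_mem_wtLE j hu)

/-- The sum that defines `taylorVir` is finite, because `L(i - 1)` lowers weights. -/
theorem finsum_tmul_vir_eq_sum (b : Laurent) {p : ℤ} {u : V} (hu : u ∈ 𝒱.wtLE p) {M : ℕ}
    (hM : p + 1 - M < 𝒱.minWt) :
    ∑ᶠ i : ℕ, divPow dX i b ⊗ₜ[ℂ] 𝒱.vir ((i : ℤ) - 1) u =
      ∑ i ∈ Finset.range M, divPow dX i b ⊗ₜ[ℂ] 𝒱.vir ((i : ℤ) - 1) u := by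
  refine finsum_eq_sum_of_support_subset _ fun i hi => ?_
  by_contra hlt
  simp only [Finset.coe_range, Set.mem_Iio, not_lt] at hlt
  exact hi (by simp only; rw [𝒱.vir_eq_zero hu (by omega), TensorProduct.tmul_zero])

theorem exists_range_bound (p : ℤ) : ∃ M : ℕ, p + 1 - M < 𝒱.minWt :=
  ⟨(p + 2 - 𝒱.minWt).toNat, by omega⟩

/-! ### Vector fields acting on `ℂ((x)) ⊗ V` -/

/-- The map `u ↦ ∑_i b^{(i)}(x) / i! ⊗ L(i - 1) u`. -/
def taylorVir : Laurent →ₗ[ℂ] V →ₗ[ℂ] Laurent ⊗[ℂ] V :=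
  LinearMap.mk₂ ℂ (fun b u => ∑ᶠ i : ℕ, divPow dX i b ⊗ₜ[ℂ] 𝒱.vir ((i : ℤ) - 1) u)
    (fun b b' u => by
      obtain ⟨p, hu⟩ := 𝒱.exists_mem_wtLE u
      obtain ⟨M, hM⟩ := 𝒱.exists_range_bound p
      rw [𝒱.finsum_tmul_vir_eq_sum _ hu hM, 𝒱.finsum_tmul_vir_eq_sum _ hu hM,
        𝒱.finsum_tmul_vir_eq_sum _ hu hM, ← Finset.sum_add_distrib]
      simp only [map_add, TensorProduct.add_tmul])
    (fun c b u => by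
      obtain ⟨p, hu⟩ := 𝒱.exists_mem_wtLE u
      obtain ⟨M, hM⟩ := 𝒱.exists_range_bound p
      rw [𝒱.finsum_tmul_vir_eq_sum _ hu hM, 𝒱.finsum_tmul_vir_eq_sum _ hu hM, Finset.smul_sum]
      simp only [map_smul, ← TensorProduct.smul_tmul'])
    (fun b u u' => by
      obtain ⟨p, hu⟩ := 𝒱.exists_mem_wtLE u
      obtain ⟨p', hu'⟩ := 𝒱.exists_mem_wtLE u'
      have hu := 𝒱.wtLE_mono (le_max_left p p') hu
      have hu' := 𝒱.wtLE_mono (le_max_right p p') hu'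
      obtain ⟨M, hM⟩ := 𝒱.exists_range_bound (max p p')
      rw [𝒱.finsum_tmul_vir_eq_sum _ hu hM, 𝒱.finsum_tmul_vir_eq_sum _ hu' hM,
        𝒱.finsum_tmul_vir_eq_sum _ (add_mem hu hu') hM, ← Finset.sum_add_distrib]
      simp only [map_add, TensorProduct.tmul_add])
    (fun c b u => by
      obtain ⟨p, hu⟩ := 𝒱.exists_mem_wtLE u
      obtain ⟨M, hM⟩ := 𝒱.exists_range_bound p
      rw [𝒱.finsum_tmul_vir_eq_sum _ hu hM,
        𝒱.finsum_tmul_vir_eq_sum _ (Submodule.smul_mem _ c hu) hM, Finset.smul_sum]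
      simp only [map_smul, TensorProduct.tmul_smul])

/-- The operator `∑_i b^{(i)}(x) / i! ⊗ L(i - 1)` on `ℂ((x)) ⊗ V`. -/
def sig : Laurent →ₗ[ℂ] Module.End ℂ (Laurent ⊗[ℂ] V) :=
  LinearMap.mk₂ ℂ (fun b w => (𝒱.taylorVir b).liftBaseChange Laurent w)
    (fun b b' w => by
      induction w using TensorProduct.induction_on with
      | zero => simp
      | tmul h u => simp
      | add w w' h h' =>
        rw [LinearMap.map_add _ w w', LinearMap.map_add _ w w', LinearMap.map_add _ w w', h, h']
        abel)
    (fun c b w => by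
      induction w using TensorProduct.induction_on with
      | zero => simp
      | tmul h u => simp [smul_comm c]
      | add w w' h h' => rw [map_add, map_add, h, h', smul_add])
    (fun b w w' => map_add _ _ _)
    (fun c b w => by
      rw [← algebraMap_smul Laurent c w, map_smul, algebraMap_smul])

theorem sig_smul (b h : Laurent) (w : Laurent ⊗[ℂ] V) : 𝒱.sig b (h • w) = h • 𝒱.sig b w :=
  map_smul ((𝒱.taylorVir b).liftBaseChange Laurent) h w

theorem sig_tmul (b h : Laurent) {p : ℤ} {u : V} (hu : u ∈ 𝒱.wtLE p) {M : ℕ}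
    (hM : p + 1 - M < 𝒱.minWt) :
    𝒱.sig b (h ⊗ₜ u) =
      ∑ i ∈ Finset.range M, (divPow dX i b * h) ⊗ₜ[ℂ] 𝒱.vir ((i : ℤ) - 1) u := by
  have : 𝒱.sig b (h ⊗ₜ u) = h • 𝒱.taylorVir b u := by simp [sig]
  rw [this, taylorVir, LinearMap.mk₂_apply, 𝒱.finsum_tmul_vir_eq_sum b hu hM, Finset.smul_sum]
  refine Finset.sum_congr rfl fun i _ => ?_
  rw [TensorProduct.smul_tmul', smul_eq_mul, mul_comm]

/-- The commutators of the operators `L(i - 1)`, `i ≥ 0`, have no central term. -/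
theorem vir_comm (i j : ℕ) (v : V) :
    𝒱.vir ((i : ℤ) - 1) (𝒱.vir ((j : ℤ) - 1) v) - 𝒱.vir ((j : ℤ) - 1) (𝒱.vir ((i : ℤ) - 1) v) =
      ((i : ℂ) - j) • 𝒱.vir ((i : ℤ) + j - 2) v := by
  have h := 𝒱.virasoro ((i : ℤ) - 1) ((j : ℤ) - 1) v
  have hc : (if (i : ℤ) - 1 + ((j : ℤ) - 1) = 0 then
      (((((i : ℤ) - 1 : ℤ) : ℂ) ^ 3 - (((i : ℤ) - 1 : ℤ) : ℂ)) / 12 * 𝒱.centralCharge) • v else 0) =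
      0 := by
    split_ifs with h0
    · -- the central term contains the factor `n³ - n`, where `n = i - 1` is `-1`, `0` or `1`
      have : i = 0 ∨ i = 1 ∨ i = 2 := by omega
      rcases this with rfl | rfl | rfl <;> norm_num
    · rfl
  rw [hc, add_zero] at h
  have e : (i : ℤ) - 1 + (j - 1) + 1 = i + j - 2 + 1 := by ring
  rw [e] at h
  refine h.trans ?_
  push_cast
  rw [sub_sub_sub_cancel_right]
  rfl

/-- `b ↦ ∑_i b^{(i)}(x) / i! ⊗ L(i - 1)` is an antihomomorphism of Lie algebras. -/
theorem sig_bracket (a b : Laurent) (w : Laurent ⊗[ℂ] V) :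
    𝒱.sig a (𝒱.sig b w) - 𝒱.sig b (𝒱.sig a w) = -𝒱.sig (adAct a b) w := by
  induction w using TensorProduct.induction_on with
  | zero => simp
  | tmul h u =>
    obtain ⟨p, hu⟩ := 𝒱.exists_mem_wtLE u
    obtain ⟨M, hM⟩ := 𝒱.exists_range_bound (p + 1)
    have hu' : ∀ j : ℕ, 𝒱.vir ((j : ℤ) - 1) u ∈ 𝒱.wtLE (p + 1) := fun j =>
      𝒱.wtLE_mono (by omega) (𝒱.vir_mem_wtLE _ hu)
    have e : ∀ a b : Laurent, 𝒱.sig a (𝒱.sig b (h ⊗ₜ u)) =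
        ∑ j ∈ Finset.range M, ∑ i ∈ Finset.range M, (divPow dX i a * (divPow dX j b * h)) ⊗ₜ[ℂ]
          𝒱.vir ((i : ℤ) - 1) (𝒱.vir ((j : ℤ) - 1) u) := fun a b => by
      rw [𝒱.sig_tmul b h hu (M := M) (by omega), map_sum]
      exact Finset.sum_congr rfl fun j _ => 𝒱.sig_tmul a _ (hu' j) hM
    set G : ℕ → ℕ → Laurent ⊗[ℂ] V := fun i j =>
      (divPow dX i a * divPow dX j b * h) ⊗ₜ[ℂ] 𝒱.vir ((i : ℤ) + j - 2) u with hG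
    have hG0 : ∀ i j, M ≤ i + j → G i j = 0 := fun i j hij => by
      rw [hG]
      simp only
      rw [𝒱.vir_eq_zero hu (by omega), TensorProduct.tmul_zero]
    have e1 : 𝒱.sig a (𝒱.sig b (h ⊗ₜ u)) - 𝒱.sig b (𝒱.sig a (h ⊗ₜ u)) =
        ∑ n ∈ Finset.range (M + 1), ∑ p ∈ antidiagonal n, ((p.1 : ℂ) - p.2) • G p.1 p.2 := by
      rw [Finset.sum_range_succ, Finset.sum_eq_zero (s := antidiagonal M) fun p hp => by
        rw [hG0 _ _ (mem_antidiagonal.1 hp).ge, smul_zero], add_zero,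
        sum_range_antidiagonal (G := fun i j => ((i : ℂ) - j) • G i j) fun i j hij => by
          rw [hG0 i j hij, smul_zero], e, e]
      rw [Finset.sum_comm, ← Finset.sum_sub_distrib]
      refine Finset.sum_congr rfl fun i _ => ?_
      rw [← Finset.sum_sub_distrib]
      refine Finset.sum_congr rfl fun j _ => ?_
      rw [hG]
      simp only
      rw [← TensorProduct.tmul_smul, ← vir_comm, TensorProduct.tmul_sub]
      congr 2
      · ring
      · ring
    rw [e1, Finset.sum_range_succ', Finset.Nat.antidiagonal_zero, Finset.sum_singleton,
      𝒱.sig_tmul _ h hu (M := M) (by omega), ← Finset.sum_neg_distrib]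
    simp only [Nat.cast_zero, sub_self, zero_smul, add_zero]
    refine Finset.sum_congr rfl fun k _ => ?_
    rw [sum_antidiagonal_succ_sub_smul G, divPow_dX_adAct, Finset.sum_mul, TensorProduct.sum_tmul,
      ← Finset.sum_neg_distrib]
    refine Finset.sum_congr rfl fun q hq => ?_
    rw [mem_antidiagonal] at hq
    rw [sub_mul, TensorProduct.sub_tmul, neg_sub, smul_mul_assoc, smul_mul_assoc,
      TensorProduct.smul_tmul', TensorProduct.smul_tmul']
    rw [show ((q.1 + 1 : ℕ) : ℤ) + q.2 - 2 = k - 1 by push_cast; omega,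
      show (q.1 : ℤ) + (q.2 + 1 : ℕ) - 2 = k - 1 by push_cast; omega]
  | add w w' h h' =>
    simp only [map_add, neg_add] at h h' ⊢
    rw [← h, ← h']
    abel

/-- Total derivatives are preserved; the extra terms `i L(i - 2)` from `[L(i - 1), L(-1)]` cancel by
telescoping. -/
theorem sig_tder (b : Laurent) (w : Laurent ⊗[ℂ] V) :
    𝒱.sig b (𝒱.tder w) = 𝒱.tder (𝒱.sig b w) := by
  induction w using TensorProduct.induction_on with
  | zero => simp
  | tmul h u =>
    obtain ⟨p, hu⟩ := 𝒱.exists_mem_wtLE u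
    obtain ⟨M, hM⟩ := 𝒱.exists_range_bound (p + 1)
    have hu' : 𝒱.vir (-1) u ∈ 𝒱.wtLE (p + 1) := by
      simpa only [sub_neg_eq_add] using 𝒱.vir_mem_wtLE (-1) hu
    have hcomm : ∀ i : ℕ, 𝒱.vir ((i : ℤ) - 1) (𝒱.vir (-1) u) =
        𝒱.vir (-1) (𝒱.vir ((i : ℤ) - 1) u) + (i : ℂ) • 𝒱.vir ((i : ℤ) - 2) u := fun i => by
      have := 𝒱.vir_comm i 0 u
      simp only [Nat.cast_zero, zero_sub, sub_zero, add_zero] at this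
      rw [← this, add_sub_cancel]
    rw [tder_tmul, map_add, 𝒱.sig_tmul b _ hu (M := M) (by omega), 𝒱.sig_tmul b _ hu' hM,
      𝒱.sig_tmul b h hu (M := M) (by omega), map_sum, ← Finset.sum_add_distrib, ← sub_eq_zero,
      ← Finset.sum_sub_distrib]
    have e : ∀ i ∈ Finset.range M, (divPow dX i b * dX h) ⊗ₜ[ℂ] 𝒱.vir ((i : ℤ) - 1) u +
        (divPow dX i b * h) ⊗ₜ[ℂ] 𝒱.vir ((i : ℤ) - 1) (𝒱.vir (-1) u) -
        𝒱.tder ((divPow dX i b * h) ⊗ₜ[ℂ] 𝒱.vir ((i : ℤ) - 1) u) =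
        (i : ℂ) • (divPow dX i b * h) ⊗ₜ[ℂ] 𝒱.vir ((i : ℤ) - 2) u -
        ((i + 1 : ℕ) : ℂ) • (divPow dX (i + 1) b * h) ⊗ₜ[ℂ] 𝒱.vir (((i + 1 : ℕ) : ℤ) - 2) u := by
      intro i _
      rw [tder_tmul, hcomm, dX_mul, ← divPow_succ, TensorProduct.tmul_add, TensorProduct.add_tmul,
        TensorProduct.tmul_smul, smul_mul_assoc, ← TensorProduct.smul_tmul',
        show ((i + 1 : ℕ) : ℤ) - 2 = i - 1 by push_cast; ring]
      push_cast
      abel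
    rw [Finset.sum_congr rfl e, Finset.sum_range_sub' (fun i : ℕ => (i : ℂ) • (divPow dX i b * h) ⊗ₜ[ℂ]
      𝒱.vir ((i : ℤ) - 2) u), 𝒱.vir_eq_zero hu (j := (M : ℤ) - 2) (by omega)]
    simp
  | add w w' h h' => simp only [map_add, h, h']

/-- The operator through which the field `∑_N b_N L(N - 1)` acts on the argument of a vertex
operator; see `virSeries_vop`.  The second term does not affect vertex operators; it makes the
action of order one in `x`. -/
def rho : Laurent →ₗ[ℂ] Module.End ℂ (Laurent ⊗[ℂ] V) :=
  LinearMap.mk₂ ℂ (fun (b : Laurent) (w : Laurent ⊗[ℂ] V) => 𝒱.sig b w - 𝒱.tder (b • w))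
    (fun b b' w => by
      rw [add_smul, map_add, map_add, LinearMap.add_apply]
      abel)
    (fun c b w => by rw [smul_assoc, map_smul, map_smul, LinearMap.smul_apply, smul_sub])
    (fun b w w' => by
      rw [smul_add, map_add, map_add]
      abel)
    (fun c b w => by rw [smul_comm, map_smul, map_smul, smul_sub])

theorem rho_apply (b : Laurent) (w : Laurent ⊗[ℂ] V) :
    𝒱.rho b w = 𝒱.sig b w - 𝒱.tder (b • w) := rfl

/-- `b ↦ -ρ_b` is a representation of the Lie algebra of vector fields `b d/dx`. -/
theorem rho_bracket (a b : Laurent) (w : Laurent ⊗[ℂ] V) :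
    𝒱.rho a (𝒱.rho b w) - 𝒱.rho b (𝒱.rho a w) = -𝒱.rho (adAct a b) w := by
  have h1 := 𝒱.sig_bracket a b w
  have h2 : 𝒱.tder (a • 𝒱.tder (b • w)) - 𝒱.tder (b • 𝒱.tder (a • w)) =
      𝒱.tder (adAct a b • w) := by
    rw [← map_sub, tder_smul, tder_smul, smul_add, smul_add, smul_smul, smul_smul, smul_smul,
      smul_smul, mul_comm b a, add_sub_add_right_eq_sub, ← sub_smul, adAct_apply, mul_comm b]
  simp only [rho_apply, map_sub, sig_tder, sig_smul]
  have h3 : 𝒱.sig (adAct a b) w = 𝒱.sig b (𝒱.sig a w) - 𝒱.sig a (𝒱.sig b w) := by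
    rw [← neg_sub, h1, neg_neg]
  rw [← h2, h3]
  abel

/-- `ρ_a` is a differential operator of order one. -/
theorem rho_smul (a h : Laurent) (w : Laurent ⊗[ℂ] V) :
    𝒱.rho a (h • w) = h • 𝒱.rho a w - (a * dX h) • w := by
  rw [rho_apply, rho_apply, sig_smul, smul_comm a h, tder_smul, smul_sub, smul_smul, mul_comm a]
  abel

/-- The operator `∑_i a_i L(i - 1)` attached to `a = ∑_i a_i x^i`. -/
def virSeries (a : Laurent) : Module.End ℂ V := 𝒱.vop (a ⊗ₜ 𝒱.conf)

theorem exists_virSeries_eq_zero (v : V) : ∃ M : ℤ, ∀ a ∈ ordGE M, 𝒱.virSeries a v = 0 := by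
  obtain ⟨p, hp⟩ := 𝒱.exists_mem_wtLE 𝒱.conf
  obtain ⟨q, hq⟩ := 𝒱.exists_mem_wtLE v
  exact ⟨p + q - 𝒱.minWt, fun a ha => 𝒱.vop_eq_zero ha hp hq (by omega)⟩

/-- The commutator of `∑_i a_i L(i - 1)` with a vertex operator. -/
theorem virSeries_vop {a : Laurent} (ha : a ∈ ordGE 0) (w : Laurent ⊗[ℂ] V) (v : V) :
    𝒱.virSeries a (𝒱.vop w v) - 𝒱.vop w (𝒱.virSeries a v) = 𝒱.vop (𝒱.sig a w) v := by
  induction w using TensorProduct.induction_on with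
  | zero => simp
  | tmul h u =>
    obtain ⟨p, hu⟩ := 𝒱.exists_mem_wtLE u
    obtain ⟨q, hv⟩ := 𝒱.exists_mem_wtLE v
    obtain ⟨q', hv'⟩ := 𝒱.exists_mem_wtLE (𝒱.virSeries a v)
    obtain ⟨R, hR⟩ := 𝒱.exists_range_bound p
    have hvir : ∀ i : ℕ, 𝒱.vir ((i : ℤ) - 1) u ∈ 𝒱.wtLE (p + 1) := fun i =>
      𝒱.wtLE_mono (by omega) (𝒱.vir_mem_wtLE _ hu)
    -- By continuity it suffices to consider monomials `h = x^m` and `a = x^N`, for which the claim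
    -- is the commutator formula.
    refine eq_of_mono
      (Θ := 𝒱.virSeries a ∘ₗ 𝒱.vopL u v - 𝒱.vopL u (𝒱.virSeries a v))
      (Θ' := (LinearMap.applyₗ v ∘ₗ 𝒱.vop ∘ₗ 𝒱.sig a) ∘ₗ (TensorProduct.mk ℂ Laurent V).flip u)
      (M := max (p + q - 𝒱.minWt) (p + q' - 𝒱.minWt)) (M' := p + 1 + q - 𝒱.minWt)
      (fun f hf => ?_) (fun f hf => ?_) (fun m => ?_) h
    · rw [LinearMap.sub_apply, LinearMap.comp_apply, vopL_apply, vopL_apply,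
        𝒱.vop_eq_zero hf hu hv (by omega), 𝒱.vop_eq_zero hf hu hv' (by omega), map_zero, sub_zero]
    · change 𝒱.vop (𝒱.sig a (f ⊗ₜ u)) v = 0
      rw [𝒱.sig_tmul a f hu hR, map_sum, LinearMap.sum_apply]
      refine Finset.sum_eq_zero fun i _ => ?_
      have := mul_mem_ordGE (divPow_dX_mem_zero i ha) hf
      exact 𝒱.vop_eq_zero this (hvir i) hv (by omega)
    · change 𝒱.virSeries a (𝒱.vop (mono m ⊗ₜ u) v) - 𝒱.vop (mono m ⊗ₜ u) (𝒱.virSeries a v) =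
        𝒱.vop (𝒱.sig a (mono m ⊗ₜ u)) v
      rw [vop_mono, vop_mono]
      obtain ⟨M₁, h1⟩ := 𝒱.exists_virSeries_eq_zero (𝒱.mode u m v)
      obtain ⟨M₂, h2⟩ := 𝒱.exists_virSeries_eq_zero v
      refine eq_of_mono_of_mem
        (Θ := 𝒱.vopL 𝒱.conf (𝒱.mode u m v) - 𝒱.mode u m ∘ₗ 𝒱.vopL 𝒱.conf v)
        (Θ' := (LinearMap.applyₗ v ∘ₗ 𝒱.vop) ∘ₗ 𝒱.sig.flip (mono m ⊗ₜ u))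
        (M := max M₁ M₂) (M' := p + 1 + q - 𝒱.minWt + R - m) (s := 0)
        (fun f hf => ?_) (fun f hf => ?_) (fun n hn => ?_) ha
      · rw [LinearMap.sub_apply, LinearMap.comp_apply]
        have e1 := h1 f (ordGE_mono (le_max_left _ _) hf)
        have e2 := h2 f (ordGE_mono (le_max_right _ _) hf)
        rw [virSeries] at e1 e2
        rw [vopL_apply, vopL_apply, e1, e2, map_zero, sub_zero]
      · change 𝒱.vop (𝒱.sig f (mono m ⊗ₜ u)) v = 0
        rw [𝒱.sig_tmul f _ hu hR, map_sum, LinearMap.sum_apply]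
        refine Finset.sum_eq_zero fun i hi => ?_
        have := mul_mem_ordGE (divPow_dX_mem i hf) (mono_mem_ordGE (le_refl m))
        have hi := Finset.mem_range.1 hi
        exact 𝒱.vop_eq_zero this (hvir i) hv (by omega)
      · obtain ⟨N, rfl⟩ := Int.eq_ofNat_of_zero_le hn
        change 𝒱.vop (mono N ⊗ₜ 𝒱.conf) (𝒱.mode u m v) -
          𝒱.mode u m (𝒱.vop (mono N ⊗ₜ 𝒱.conf) v) = 𝒱.vop (𝒱.sig (mono N) (mono m ⊗ₜ u)) v
        rw [vop_mono, vop_mono, conf_commutator, 𝒱.sig_tmul _ _ hu (M := max R (N + 1)) (by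
          have := le_max_left R (N + 1)
          omega), map_sum, LinearMap.sum_apply]
        refine Finset.sum_subset_zero_on_sdiff ?_ ?_ ?_
        · intro i hi
          rw [Finset.mem_range] at hi ⊢
          exact lt_of_lt_of_le hi (le_max_right _ _)
        · intro i hi
          rw [Finset.mem_sdiff, Finset.mem_range, Finset.mem_range, not_lt] at hi
          rw [divPow_dX_mono, Ring.choose_natCast, Nat.choose_eq_zero_of_lt (by omega)]
          simp
        · intro i hi
          rw [divPow_dX_mono, Ring.choose_natCast, smul_mul_assoc, ← TensorProduct.smul_tmul',
            map_smul, LinearMap.smul_apply, mono_mul_mono, vop_mono, vir, sub_add_cancel,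
            show (N : ℤ) - i + m = m + N - i by ring, Int.cast_natCast, Nat.cast_smul_eq_nsmul]
  | add w w' h h' =>
    simp only [map_add, LinearMap.add_apply]
    rw [← h, ← h']
    abel

/-- The operators `ρ_a` and `∑_i a^{(i)} / i! ⊗ L(i - 1)` differ by a total derivative. -/
theorem vop_rho (a : Laurent) (w : Laurent ⊗[ℂ] V) (v : V) :
    𝒱.vop (𝒱.rho a w) v = 𝒱.vop (𝒱.sig a w) v := by
  rw [rho_apply, map_sub, LinearMap.sub_apply, vop_tder, sub_zero]

/-! ### The filtration of `ℂ((x)) ⊗ V` by order minus weight -/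

/-- The span of the tensors `h ⊗ u` with `h ∈ x^s ℂ[[x]]` and `u` of weight at most `s - d`. -/
def filt (d : ℤ) : Submodule ℂ (Laurent ⊗[ℂ] V) :=
  Submodule.span ℂ {w | ∃ (s : ℤ) (h : Laurent) (u : V), h ∈ ordGE s ∧ u ∈ 𝒱.wtLE (s - d) ∧
    w = h ⊗ₜ u}

theorem tmul_mem_filt {h : Laurent} {s q d : ℤ} {u : V} (hh : h ∈ ordGE s) (hu : u ∈ 𝒱.wtLE q)
    (hd : q + d ≤ s) : h ⊗ₜ[ℂ] u ∈ 𝒱.filt d :=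
  Submodule.subset_span ⟨s, h, u, hh, 𝒱.wtLE_mono (by omega) hu, rfl⟩

/-- A linear condition on the filtration may be checked on pure tensors. -/
theorem map_mem_of_filt {E : Type*} [AddCommGroup E] [Module ℂ E] {T : Laurent ⊗[ℂ] V →ₗ[ℂ] E}
    {d : ℤ} {W : Submodule ℂ E}
    (hT : ∀ (s : ℤ) (h : Laurent) (u : V), h ∈ ordGE s → u ∈ 𝒱.wtLE (s - d) → T (h ⊗ₜ u) ∈ W)
    {w : Laurent ⊗[ℂ] V} (hw : w ∈ 𝒱.filt d) : T w ∈ W := by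
  have : 𝒱.filt d ≤ W.comap T := by
    refine Submodule.span_le.2 ?_
    rintro _ ⟨s, h, u, hh, hu, rfl⟩
    exact hT s h u hh hu
  exact this hw

theorem filt_mono {d e : ℤ} (h : d ≤ e) : 𝒱.filt e ≤ 𝒱.filt d := fun _ hw =>
  𝒱.map_mem_of_filt (T := LinearMap.id) (fun _ _ _ hh hu => 𝒱.tmul_mem_filt hh hu (by omega)) hw

/-- Elements deep in the filtration act by zero on any given vector. -/
theorem vop_eq_zero_of_mem_filt {w : Laurent ⊗[ℂ] V} {d q : ℤ} {v : V} (hw : w ∈ 𝒱.filt d)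
    (hv : v ∈ 𝒱.wtLE q) (hd : q - d - 1 < 𝒱.minWt) : 𝒱.vop w v = 0 :=
  (Submodule.mem_bot ℂ).1 (𝒱.map_mem_of_filt (T := LinearMap.applyₗ v ∘ₗ 𝒱.vop)
    (fun _ _ _ hh hu => (Submodule.mem_bot ℂ).2 (𝒱.vop_eq_zero hh hu hv (by omega))) hw)

theorem smul_mem_filt {b : Laurent} {N d : ℤ} (hb : b ∈ ordGE N) {w : Laurent ⊗[ℂ] V}
    (hw : w ∈ 𝒱.filt d) : b • w ∈ 𝒱.filt (N + d) :=
  𝒱.map_mem_of_filt (T := DistribSMul.toLinearMap ℂ (Laurent ⊗[ℂ] V) b)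
    (fun _ _ _ hh hu => 𝒱.tmul_mem_filt (mul_mem_ordGE hb hh) hu (by omega)) hw

theorem tder_mem_filt {d : ℤ} {w : Laurent ⊗[ℂ] V} (hw : w ∈ 𝒱.filt d) :
    𝒱.tder w ∈ 𝒱.filt (d - 1) :=
  𝒱.map_mem_of_filt (T := 𝒱.tder) (fun _ _ _ hh hu => Submodule.add_mem _
    (𝒱.tmul_mem_filt (dX_mem_ordGE hh) hu (by omega))
    (𝒱.tmul_mem_filt hh (𝒱.vir_mem_wtLE (-1) hu) (by omega))) hw

theorem sig_mem_filt {b : Laurent} {N d : ℤ} (hb : b ∈ ordGE N) {w : Laurent ⊗[ℂ] V}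
    (hw : w ∈ 𝒱.filt d) : 𝒱.sig b w ∈ 𝒱.filt (N + d - 1) := by
  refine 𝒱.map_mem_of_filt (T := 𝒱.sig b) (fun s h u hh hu => ?_) hw
  obtain ⟨M, hM⟩ := 𝒱.exists_range_bound (s - d)
  rw [𝒱.sig_tmul b h hu hM]
  exact Submodule.sum_mem _ fun i _ => 𝒱.tmul_mem_filt (mul_mem_ordGE (divPow_dX_mem i hb) hh)
    (𝒱.vir_mem_wtLE _ hu) (by omega)

/-- For `b ∈ x^N ℂ[[x]]`, the operator `ρ_b` has degree `N - 1`; for `N ≥ 2` it raises the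
filtration, so that `exp(-ρ_b)` converges. -/
theorem rho_mem_filt {b : Laurent} {N d : ℤ} (hb : b ∈ ordGE N) {w : Laurent ⊗[ℂ] V}
    (hw : w ∈ 𝒱.filt d) : 𝒱.rho b w ∈ 𝒱.filt (N + d - 1) :=
  Submodule.sub_mem _ (𝒱.sig_mem_filt hb hw) (𝒱.tder_mem_filt (𝒱.smul_mem_filt hb hw))

/-- The coefficient of `x^p`. -/
def tcoeff (p : ℤ) : Laurent ⊗[ℂ] V →ₗ[ℂ] V := TensorProduct.lid ℂ V ∘ₗ (lcoeff p).rTensor V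

theorem tcoeff_tmul (p : ℤ) (h : Laurent) (u : V) : tcoeff p (h ⊗ₜ[ℂ] u) = lcoeff p h • u := rfl

theorem tcoeff_mem {d : ℤ} {w : Laurent ⊗[ℂ] V} (hw : w ∈ 𝒱.filt d) (p : ℤ) :
    tcoeff p w ∈ 𝒱.wtLE (p - d) := by
  refine 𝒱.map_mem_of_filt (T := tcoeff p) (fun s h u hh hu => ?_) hw
  rw [tcoeff_tmul]
  by_cases hp : p < s
  · rw [hh p hp, zero_smul]
    exact Submodule.zero_mem _
  · exact Submodule.smul_mem _ _ (𝒱.wtLE_mono (by omega) hu)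

end VertexOperatorAlgebra

/-- The subspace `ℂ[[x]] ⊗ V`. -/
def regTensor (V : Type*) [AddCommGroup V] [Module ℂ V] : Submodule ℂ (TensorProduct ℂ Laurent V) :=
  Submodule.span ℂ {w | ∃ (h : Laurent) (u : V), h ∈ ordGE 0 ∧ w = h ⊗ₜ u}

namespace VertexOperatorAlgebra

open scoped TensorProduct

variable {V : Type*} [AddCommGroup V] [Module ℂ V] (𝒱 : VertexOperatorAlgebra V)

/-- Modulo the filtration, an element of `ℂ[[x]] ⊗ V` is a polynomial in `x`. -/
theorem exists_sub_sum_mem_filt {w : Laurent ⊗[ℂ] V} (hw : w ∈ regTensor V) (d : ℤ) :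
    ∃ N₀ : ℕ, ∀ N : ℕ, N₀ ≤ N →
      w - ∑ n ∈ Finset.range N, mono n ⊗ₜ tcoeff n w ∈ 𝒱.filt d := by
  induction hw using Submodule.span_induction with
  | mem w hw =>
    obtain ⟨h, u, hh, rfl⟩ := hw
    obtain ⟨q, hq⟩ := 𝒱.exists_mem_wtLE u
    refine ⟨(q + d).toNat, fun N hN => ?_⟩
    have e : h ⊗ₜ[ℂ] u - ∑ n ∈ Finset.range N, mono n ⊗ₜ[ℂ] tcoeff n (h ⊗ₜ[ℂ] u) =
        (h - ∑ p ∈ Finset.Ico (0 : ℤ) N, lcoeff p h • mono p) ⊗ₜ[ℂ] u := by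
      rw [TensorProduct.sub_tmul, TensorProduct.sum_tmul, Finset.range_eq_Ico]
      congr 1
      refine Finset.sum_bij (fun n _ => (n : ℤ)) (by simp) (by simp) (fun p hp => ?_) (fun n _ => ?_)
      · rw [Finset.mem_Ico] at hp
        exact ⟨p.toNat, by rw [Finset.mem_Ico]; omega, by omega⟩
      · rw [tcoeff_tmul, TensorProduct.tmul_smul, TensorProduct.smul_tmul']
    rw [e]
    exact 𝒱.tmul_mem_filt (sub_sum_mem_ordGE hh N) hq (by omega)
  | zero => exact ⟨0, fun N _ => by simp⟩
  | add w w' _ _ h h' =>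
    obtain ⟨N, hN⟩ := h
    obtain ⟨N', hN'⟩ := h'
    refine ⟨max N N', fun n hn => ?_⟩
    have := Submodule.add_mem _ (hN n (le_trans (le_max_left _ _) hn))
      (hN' n (le_trans (le_max_right _ _) hn))
    simpa only [map_add, TensorProduct.tmul_add, Finset.sum_add_distrib, sub_add_sub_comm] using this
  | smul c w _ h =>
    obtain ⟨N, hN⟩ := h
    refine ⟨N, fun n hn => ?_⟩
    have := Submodule.smul_mem _ c (hN n hn)
    simpa only [map_smul, TensorProduct.tmul_smul, ← Finset.smul_sum, smul_sub] using this

theorem virSeries_eq_finsum {a : Laurent} (ha : a ∈ ordGE 0) (u : V) :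
    𝒱.virSeries a u = ∑ᶠ i : ℕ, lcoeff i a • 𝒱.vir ((i : ℤ) - 1) u := by
  rw [virSeries, vop_tmul, finsum_eq_finsum_comp (e := fun i : ℕ => (i : ℤ)) Nat.cast_injective]
  · exact finsum_congr fun i => by rw [vir, sub_add_cancel]
  · intro k hk
    have : 0 ≤ k := by
      by_contra hlt
      exact hk (by rw [ha k (not_le.1 hlt), zero_smul])
    exact ⟨k.toNat, Int.toNat_of_nonneg this⟩

theorem virSeries_eq_sum {a : Laurent} (ha : a ∈ ordGE 0) {p : ℤ} {u : V} (hu : u ∈ 𝒱.wtLE p)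
    {M : ℕ} (hM : p + 1 - M < 𝒱.minWt) :
    𝒱.virSeries a u = ∑ i ∈ Finset.range M, lcoeff i a • 𝒱.vir ((i : ℤ) - 1) u := by
  rw [virSeries_eq_finsum 𝒱 ha]
  refine finsum_eq_sum_of_support_subset _ fun i hi => ?_
  by_contra hlt
  simp only [Finset.coe_range, Set.mem_Iio, not_lt] at hlt
  exact hi (by simp only; rw [𝒱.vir_eq_zero hu (by omega), smul_zero])

theorem virSeries_mem_wtLE {a : Laurent} (ha : a ∈ ordGE 2) {p : ℤ} {u : V} (hu : u ∈ 𝒱.wtLE p) :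
    𝒱.virSeries a u ∈ 𝒱.wtLE (p - 1) := by
  obtain ⟨M, hM⟩ := 𝒱.exists_range_bound p
  rw [𝒱.virSeries_eq_sum (ordGE_mono (by norm_num) ha) hu hM]
  refine Submodule.sum_mem _ fun i _ => ?_
  by_cases hi : i < 2
  · rw [ha i (by omega), zero_smul]
    exact Submodule.zero_mem _
  · exact Submodule.smul_mem _ _ (𝒱.wtLE_mono (by omega) (𝒱.vir_mem_wtLE _ hu))

/-- If `a` vanishes to second order, `ρ_a` preserves `ℂ[[x]] ⊗ V` and acts on constant terms by
`L_a`. -/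
theorem rho_mem_regTensor {a : Laurent} (ha : a ∈ ordGE 2) {w : Laurent ⊗[ℂ] V}
    (hw : w ∈ regTensor V) :
    𝒱.rho a w ∈ regTensor V ∧ tcoeff 0 (𝒱.rho a w) = 𝒱.virSeries a (tcoeff 0 w) := by
  have ha0 : a ∈ ordGE 0 := ordGE_mono (by norm_num) ha
  induction hw using Submodule.span_induction with
  | mem w hw =>
    obtain ⟨h, u, hh, rfl⟩ := hw
    obtain ⟨p, hu⟩ := 𝒱.exists_mem_wtLE u
    obtain ⟨M, hM⟩ := 𝒱.exists_range_bound p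
    have hah : a * h ∈ ordGE 2 := by simpa using mul_mem_ordGE ha hh
    have hd := fun i : ℕ => divPow_dX_mem_zero i ha0
    rw [rho_apply, TensorProduct.smul_tmul', smul_eq_mul, tder_tmul, 𝒱.sig_tmul a h hu hM]
    constructor
    · refine Submodule.sub_mem _ (Submodule.sum_mem _ fun i _ => Submodule.subset_span
        ⟨_, _, by simpa using mul_mem_ordGE (hd i) hh, rfl⟩) (Submodule.add_mem _
        (Submodule.subset_span ⟨_, _, ordGE_mono (by norm_num) (dX_mem_ordGE hah), rfl⟩)
        (Submodule.subset_span ⟨_, _, ordGE_mono (by norm_num) hah, rfl⟩))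
    · rw [map_sub, map_add, tcoeff_tmul, tcoeff_tmul, dX_mem_ordGE hah 0 (by norm_num),
        hah 0 (by norm_num), zero_smul, zero_smul, add_zero, sub_zero, tcoeff_tmul, map_smul,
        𝒱.virSeries_eq_sum ha0 hu hM, map_sum, Finset.smul_sum]
      refine Finset.sum_congr rfl fun i _ => ?_
      rw [tcoeff_tmul, lcoeff_zero_mul (hd i) hh, lcoeff_divPow_dX, zero_add, Ring.choose_natCast,
        Nat.choose_self, smul_smul, mul_comm]
      simp
  | zero => simp
  | add w w' _ _ h h' =>
    exact ⟨by rw [map_add]; exact Submodule.add_mem _ h.1 h'.1, by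
      rw [map_add, map_add, h.2, h'.2, map_add, map_add]⟩
  | smul c w _ h =>
    exact ⟨by rw [map_smul]; exact Submodule.smul_mem _ _ h.1, by
      rw [map_smul, map_smul, h.2, map_smul, map_smul]⟩

/-! ### Conjugation of vertex operators by exponentials of Virasoro operators -/

/-- The action of the flow of `a d/dx` on the element `1 ⊗ u` of `ℂ((x)) ⊗ V`. -/
def flowElt (a : Laurent) (J : ℕ) (u : V) : Laurent ⊗[ℂ] V :=
  expTrunc J (-𝒱.rho a) (1 ⊗ₜ u)

variable {a : Laurent} (ha : a ∈ ordGE 2)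
include ha

theorem neg_rho_mem_filt (d : ℤ) (w : Laurent ⊗[ℂ] V) (hw : w ∈ 𝒱.filt d) :
    (-𝒱.rho a) w ∈ 𝒱.filt (d + 1) := by
  refine Submodule.neg_mem _ ?_
  have := 𝒱.rho_mem_filt ha hw
  rwa [show 2 + d - 1 = d + 1 by ring] at this

theorem divPow_neg_rho_mem {q : ℤ} {u : V} (hu : u ∈ 𝒱.wtLE q) (m : ℤ) (j : ℕ) :
    divPow (-𝒱.rho a) j (mono m ⊗ₜ u) ∈ 𝒱.filt (m - q + j) := by
  have := divPow_mem (𝒱.neg_rho_mem_filt ha) j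
    (𝒱.tmul_mem_filt (mono_mem_ordGE (le_refl m)) hu (d := m - q) (by omega))
  rwa [mul_one] at this

theorem flowElt_mem_filt {q : ℤ} {u : V} (hu : u ∈ 𝒱.wtLE q) (J : ℕ) :
    𝒱.flowElt a J u ∈ 𝒱.filt (-q) := by
  rw [flowElt, expTrunc_apply]
  refine Submodule.sum_mem _ fun j _ => ?_
  have := 𝒱.divPow_neg_rho_mem ha hu 0 j
  exact 𝒱.filt_mono (by omega) this

/-- `exp(-ρ_a)(1 ⊗ u)` has no pole, and its constant term is `e^{-L_a} u`. -/
theorem flowElt_regular (J : ℕ) (u : V) : 𝒱.flowElt a J u ∈ regTensor V ∧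
    tcoeff 0 (𝒱.flowElt a J u) = expTrunc J (-𝒱.virSeries a) u := by
  have key : ∀ j, divPow (-𝒱.rho a) j (1 ⊗ₜ u) ∈ regTensor V ∧
      tcoeff 0 (divPow (-𝒱.rho a) j (1 ⊗ₜ u)) = divPow (-𝒱.virSeries a) j u := by
    intro j
    induction j with
    | zero =>
      rw [divPow_zero, divPow_zero, tcoeff_tmul, ← mono_zero, lcoeff_mono_same, one_smul]
      exact ⟨Submodule.subset_span ⟨_, _, one_mem_ordGE, rfl⟩, rfl⟩
    | succ j ih =>
      obtain ⟨h1, h2⟩ := 𝒱.rho_mem_regTensor ha ih.1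
      rw [divPow_succ_apply, divPow_succ_apply, LinearMap.neg_apply, LinearMap.neg_apply, map_smul,
        map_neg, h2, ih.2]
      exact ⟨Submodule.smul_mem _ _ (Submodule.neg_mem _ h1), rfl⟩
  rw [flowElt, expTrunc_apply, expTrunc_apply, map_sum]
  exact ⟨Submodule.sum_mem _ fun j _ => (key j).1, Finset.sum_congr rfl fun j _ => (key j).2⟩

omit ha

/-- `ρ_1 = -∂/∂x ⊗ 1`: translation acts trivially on constant elements. -/
theorem rho_one (u : V) : 𝒱.rho 1 (1 ⊗ₜ u) = 0 := by
  obtain ⟨p, hu⟩ := 𝒱.exists_mem_wtLE u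
  obtain ⟨M, hM⟩ := 𝒱.exists_range_bound p
  rw [rho_apply, one_smul, tder_tmul, dX_one, TensorProduct.zero_tmul, zero_add,
    𝒱.sig_tmul 1 1 hu (M := M + 1) (by omega), Finset.sum_range_succ', Finset.sum_eq_zero]
  · rw [divPow_zero, one_mul, zero_add, Nat.cast_zero, zero_sub, sub_self]
  · intro i _
    rw [divPow_succ_apply, ← apply_divPow, dX_one, map_zero, smul_zero, zero_mul,
      TensorProduct.zero_tmul]

/-- On `f = (1 + x) w`, the operator `(1 + x) ρ_{1 + x}` becomes `L(0) - (1 + x) d/dx`. -/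
theorem smul_rho_one_add (w : Laurent ⊗[ℂ] V) :
    (1 + mono 1) • 𝒱.rho (1 + mono 1) w =
      (𝒱.vir 0).lTensor Laurent ((1 + mono 1) • w) -
        (1 + mono 1) • dX.rTensor V ((1 + mono 1) • w) := by
  induction w using TensorProduct.induction_on with
  | zero => simp
  | tmul h u =>
    obtain ⟨p, hu⟩ := 𝒱.exists_mem_wtLE u
    obtain ⟨M, hM⟩ := 𝒱.exists_range_bound p
    have hd1 : divPow dX 1 (1 + mono 1) = 1 := by
      rw [divPow_one, map_add, dX_one, dX_mono_one, zero_add]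
    have hd2 : ∀ i : ℕ, divPow dX (i + 1 + 1) (1 + mono 1) = 0 := fun i => by
      rw [divPow_succ_apply, divPow_succ_apply, ← apply_divPow, map_add dX, dX_one, dX_mono_one,
        zero_add, map_smul, ← apply_divPow, dX_one, map_zero, smul_zero, smul_zero]
    rw [rho_apply, 𝒱.sig_tmul _ h hu (M := M + 1 + 1) (by omega), Finset.sum_range_succ',
      Finset.sum_range_succ', Finset.sum_eq_zero fun i _ => by
        rw [hd2, zero_mul, TensorProduct.zero_tmul], zero_add, zero_add, hd1, divPow_zero, one_mul]
    simp only [TensorProduct.smul_tmul', smul_eq_mul, tder_tmul, LinearMap.lTensor_tmul,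
      LinearMap.rTensor_tmul, smul_sub, smul_add, Nat.cast_one, sub_self, Nat.cast_zero, zero_sub]
    abel
  | add w w' h h' =>
    simp only [smul_add, map_add] at h h' ⊢
    rw [h, h']
    abel

theorem tcoeff_mono_smul (m p : ℤ) (w : Laurent ⊗[ℂ] V) :
    tcoeff p (mono m • w) = tcoeff (p - m) w := by
  induction w using TensorProduct.induction_on with
  | zero => simp
  | tmul h u => rw [TensorProduct.smul_tmul', smul_eq_mul, tcoeff_tmul, tcoeff_tmul, lcoeff_mono_mul]
  | add w w' h h' => rw [smul_add, map_add, map_add, h, h']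

theorem tcoeff_lTensor (p : ℤ) (T : Module.End ℂ V) (w : Laurent ⊗[ℂ] V) :
    tcoeff p (T.lTensor Laurent w) = T (tcoeff p w) := by
  induction w using TensorProduct.induction_on with
  | zero => simp
  | tmul h u => rw [LinearMap.lTensor_tmul, tcoeff_tmul, tcoeff_tmul, map_smul]
  | add w w' h h' => rw [map_add, map_add, map_add, map_add, h, h']

theorem tcoeff_rTensor_dX (p : ℤ) (w : Laurent ⊗[ℂ] V) :
    tcoeff p (dX.rTensor V w) = ((p : ℂ) + 1) • tcoeff (p + 1) w := by
  induction w using TensorProduct.induction_on with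
  | zero => simp
  | tmul h u => rw [LinearMap.rTensor_tmul, tcoeff_tmul, tcoeff_tmul, lcoeff_dX, smul_smul]
  | add w w' h h' => rw [map_add, map_add, map_add, h, h', smul_add]

include ha

variable (hflow : ∀ J : ℕ, expSub - expTrunc J (-vecAct a) (mono 1) ∈ ordGE J)
include hflow

/-- `ρ_{1 + x}` kills `exp(-ρ_a)(1 ⊗ u)`, modulo the filtration: it is the transform under the flow
of `ρ_1`, which kills `1 ⊗ u`. -/
theorem rho_one_add_flowElt_mem {q : ℤ} {u : V} (hu : u ∈ 𝒱.wtLE q) {J : ℕ} (hJ : 0 < J) :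
    𝒱.rho (1 + mono 1) (𝒱.flowElt a J u) ∈ 𝒱.filt (J - q - 2) := by
  have h1 := expTrunc_bilinear (J := J) (F := 𝒱.filt (J - q - 2)) (u := (1 : Laurent))
    (v := (1 : Laurent) ⊗ₜ[ℂ] u)
    𝒱.rho (T := -𝒱.rho a) (T₁ := adAct a) (T₂ := -𝒱.rho a) (fun b w => by
      have := 𝒱.rho_bracket a b w
      simp only [LinearMap.neg_apply, map_neg]
      rw [sub_eq_iff_eq_add] at this
      rw [this]
      abel) (fun i j hij => by
        have := 𝒱.rho_mem_filt (divPow_mem_ordGE (adAct_mem ha) i one_mem_ordGE)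
          (𝒱.divPow_neg_rho_mem ha hu 0 j)
        exact 𝒱.filt_mono (by omega) this)
  rw [rho_one, map_zero, zero_sub] at h1
  have h2 := 𝒱.rho_mem_filt (expTrunc_adAct_one ha hflow hJ) (𝒱.flowElt_mem_filt ha hu J)
  rw [map_sub, LinearMap.sub_apply] at h2
  have h3 := Submodule.sub_mem _ (Submodule.neg_mem _ h1)
    (𝒱.filt_mono (d := J - q - 2) (by omega) h2)
  rw [neg_neg, ← flowElt, sub_sub_cancel] at h3
  exact h3

/-- The coefficients of `(1 + x) exp(-ρ_a)(1 ⊗ u)` are those of `(1 + x)^{L(0)} e^{-L_a} u`: both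
series solve `(1 + x) d/dx f = L(0) f`. -/
theorem tcoeff_flowElt_sub_mem {q : ℤ} {u : V} (hu : u ∈ 𝒱.wtLE q) {J : ℕ} (hJ : 0 < J) (n : ℕ) :
    tcoeff n ((1 + mono 1) • 𝒱.flowElt a J u) -
      binomOp (𝒱.vir 0) n (expTrunc J (-𝒱.virSeries a) u) ∈ 𝒱.wtLE (n - (J - q - 3)) := by
  obtain ⟨hreg, h0⟩ := 𝒱.flowElt_regular ha J u
  have hr := 𝒱.rho_one_add_flowElt_mem ha hflow hu hJ
  induction n with
  | zero =>
    rw [binomOp_zero, ← h0, add_smul, one_smul, map_add, tcoeff_mono_smul, Nat.cast_zero,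
      Module.End.one_apply, add_sub_cancel_left]
    have : ∀ w ∈ regTensor V, tcoeff (0 - 1) w = 0 := by
      intro w hw
      induction hw using Submodule.span_induction with
      | mem w hw =>
        obtain ⟨h, u, hh, rfl⟩ := hw
        rw [tcoeff_tmul, hh _ (by norm_num), zero_smul]
      | zero => exact map_zero _
      | add w w' _ _ h h' => rw [map_add, h, h', add_zero]
      | smul c w _ h => rw [map_smul, h, smul_zero]
    rw [this _ hreg]
    exact Submodule.zero_mem _
  | succ n ih =>
    have hn : ((n : ℂ) + 1) ≠ 0 := by exact_mod_cast Nat.succ_ne_zero n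
    set E := (1 + mono 1) • 𝒱.flowElt a J u with hE
    set u' := expTrunc J (-𝒱.virSeries a) u
    have h1 := 𝒱.smul_mem_filt (b := 1 + mono 1) (N := 0)
      (Submodule.add_mem _ one_mem_ordGE (mono_mem_ordGE (by norm_num))) hr
    rw [smul_rho_one_add, ← hE] at h1
    have h2 := 𝒱.tcoeff_mem h1 n
    rw [map_sub, tcoeff_lTensor, add_smul, one_smul, map_add, tcoeff_mono_smul, tcoeff_rTensor_dX,
      tcoeff_rTensor_dX, sub_add_cancel] at h2
    push_cast at h2 ⊢
    rw [sub_add_cancel] at h2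
    -- the coefficient of `x^n` of `(1 + x) f' = L(0) f` is the recursion `(n + 1) f_{n+1} = (L(0) -
    -- n) f_n` of the coefficients `binom(L(0), n) f_0`
    have h3 := binomOp_succ (𝒱.vir 0) n u'
    have e : tcoeff ((n : ℤ) + 1) E - binomOp (𝒱.vir 0) (n + 1) u' =
        ((n : ℂ) + 1)⁻¹ • ((𝒱.vir 0 - (n : ℂ) • 1) (tcoeff n E - binomOp (𝒱.vir 0) n u') -
          (𝒱.vir 0 (tcoeff n E) - (((n : ℂ) + 1) • tcoeff ((n : ℤ) + 1) E +
            (n : ℂ) • tcoeff n E))) := by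
      rw [eq_inv_smul_iff₀ hn, smul_sub, h3]
      simp only [LinearMap.sub_apply, LinearMap.smul_apply, Module.End.one_apply, map_sub]
      abel
    rw [e]
    refine Submodule.smul_mem _ _ (Submodule.sub_mem _ ?_ (𝒱.wtLE_mono (by omega) h2))
    have h4 := 𝒱.vir_mem_wtLE 0 ih
    rw [sub_zero] at h4
    exact 𝒱.wtLE_mono (by omega) (Submodule.sub_mem _ h4 (Submodule.smul_mem _ _ ih))

/-- The element `exp(-ρ_a)(1 ⊗ u)` is `(1 + x)^{-1} (1 + x)^{L(0)} e^{-L_a} u`, modulo the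
filtration. -/
theorem exists_flowElt_sub_mem {q : ℤ} {u : V} (hu : u ∈ 𝒱.wtLE q) {J : ℕ} (hJ : 0 < J) :
    ∃ N₀ : ℕ, ∀ N : ℕ, N₀ ≤ N → 𝒱.flowElt a J u - ∑ n ∈ Finset.range N,
      (dX logL * mono n) ⊗ₜ binomOp (𝒱.vir 0) n (expTrunc J (-𝒱.virSeries a) u) ∈
        𝒱.filt (J - q - 3) := by
  have hreg : (1 + mono 1) • 𝒱.flowElt a J u ∈ regTensor V := by
    have : regTensor V ≤ (regTensor V).comap
        (DistribSMul.toLinearMap ℂ (Laurent ⊗[ℂ] V) (1 + mono 1)) := by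
      refine Submodule.span_le.2 ?_
      rintro _ ⟨h, u, hh, rfl⟩
      refine Submodule.subset_span ⟨(1 + mono 1) * h, u, ?_, rfl⟩
      simpa using mul_mem_ordGE (Submodule.add_mem _ one_mem_ordGE
        (mono_mem_ordGE (n := 0) (p := 1) (by norm_num))) hh
    exact this (𝒱.flowElt_regular ha J u).1
  obtain ⟨N₀, hN₀⟩ := 𝒱.exists_sub_sum_mem_filt hreg (J - q - 3)
  refine ⟨N₀, fun N hN => ?_⟩
  have h1 := Submodule.add_mem _ (hN₀ N hN) (Submodule.sum_mem _ (t := Finset.range N)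
    fun n _ => 𝒱.tmul_mem_filt (mono_mem_ordGE (le_refl (n : ℤ)))
      (𝒱.tcoeff_flowElt_sub_mem ha hflow hu hJ n) (d := J - q - 3) (by omega))
  have h2 := 𝒱.smul_mem_filt dX_logL_mem h1
  simp only [TensorProduct.tmul_sub, Finset.sum_sub_distrib] at h2
  rw [sub_add_sub_cancel, smul_sub, smul_smul, mul_comm (dX logL), one_add_mul_dX_logL, one_smul,
    Finset.smul_sum, zero_add] at h2
  exact h2

omit hflow in
theorem expTrunc_virSeries_mem {q : ℤ} {u : V} (hu : u ∈ 𝒱.wtLE q) (J : ℕ) :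
    expTrunc J (-𝒱.virSeries a) u ∈ 𝒱.wtLE q := by
  rw [expTrunc_apply]
  refine Submodule.sum_mem _ fun j _ => ?_
  have := divPow_mem (W := 𝒱.wtLE) (d := -1) (T := -𝒱.virSeries a)
    (fun k u hu => Submodule.neg_mem _ (𝒱.virSeries_mem_wtLE ha hu)) j hu
  exact 𝒱.wtLE_mono (by omega) this

/-- Conjugation of a vertex operator by `e^{-L_a}`, if the flow of `-a d/dx` is `e^x - 1`: the
operator `Y(u, x)` becomes `Y((1 + y)^{L(0)} e^{-L_a} u, y)` under the substitution
`x = log(1 + y)`. -/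
theorem exists_expTrunc_mode (u v : V) (m : ℤ) : ∃ M : ℕ, ∀ J N : ℕ, M ≤ J → M ≤ N →
    expTrunc J (-𝒱.virSeries a) (𝒱.mode u m v) = ∑ n ∈ Finset.range N,
      𝒱.vop ((logL ^ m * dX logL * mono n) ⊗ₜ
        binomOp (𝒱.vir 0) n (expTrunc J (-𝒱.virSeries a) u)) (expTrunc J (-𝒱.virSeries a) v) := by
  obtain ⟨q, hu⟩ := 𝒱.exists_mem_wtLE u
  obtain ⟨r, hv⟩ := 𝒱.exists_mem_wtLE v
  refine ⟨(q + r + 4 - m - 𝒱.minWt).toNat + 1, fun J N hJ hN => ?_⟩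
  have hJ0 : 0 < J := by omega
  have hu' := 𝒱.expTrunc_virSeries_mem ha hu J
  have hv' := 𝒱.expTrunc_virSeries_mem ha hv J
  have hlog := zpow_mem_ordGE logL_ne_zero lorder_logL m
  have ha0 : a ∈ ordGE 0 := ordGE_mono (by norm_num) ha
  -- `e^{-L_a}` applied to a mode: the flow acts on the mode and on `v`
  have h1 : expTrunc J (-𝒱.virSeries a) (𝒱.vop (mono m ⊗ₜ u) v) =
      𝒱.vop (expTrunc J (-𝒱.rho a) (mono m ⊗ₜ u)) (expTrunc J (-𝒱.virSeries a) v) := by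
    have := expTrunc_bilinear (J := J) (F := ⊥) (u := mono m ⊗ₜ[ℂ] u) (v := v) 𝒱.vop
      (T := -𝒱.virSeries a) (T₁ := -𝒱.rho a) (T₂ := -𝒱.virSeries a) (fun w v => by
        have := 𝒱.virSeries_vop ha0 w v
        rw [← vop_rho, sub_eq_iff_eq_add] at this
        simp only [LinearMap.neg_apply, map_neg]
        rw [this, neg_add]) (fun i j hij => by
        have hw := divPow_mem (W := 𝒱.wtLE) (d := -1) (T := -𝒱.virSeries a)
          (fun k u hu => Submodule.neg_mem _ (𝒱.virSeries_mem_wtLE ha hu)) j hv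
        exact (Submodule.mem_bot ℂ).2 (𝒱.vop_eq_zero_of_mem_filt
          (𝒱.divPow_neg_rho_mem ha hu m i) hw (by omega)))
    exact sub_eq_zero.1 ((Submodule.mem_bot ℂ).1 this)
  -- `exp(-ρ_a)(x^m ⊗ u)` is the product of the flow of `a d/dx` on `x^m` and `exp(-ρ_a)(1 ⊗ u)`
  have h2 := expTrunc_bilinear (J := J) (F := 𝒱.filt (m + J - q - 3)) (u := mono m)
    (v := (1 : Laurent) ⊗ₜ[ℂ] u)
    (Algebra.lsmul ℂ ℂ (Laurent ⊗[ℂ] V)).toLinearMap (T := -𝒱.rho a) (T₁ := vecAct a)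
    (T₂ := -𝒱.rho a) (fun b w => by
      change (-𝒱.rho a) (b • w) = (vecAct a b) • w + b • (-𝒱.rho a) w
      rw [LinearMap.neg_apply, LinearMap.neg_apply, rho_smul, vecAct_apply, smul_neg]
      abel) (fun i j hij => 𝒱.filt_mono (by omega)
        (𝒱.smul_mem_filt (divPow_mem_ordGE (vecAct_mem ha) i (mono_mem_ordGE (le_refl m)))
          (𝒱.divPow_neg_rho_mem ha hu 0 j)))
  -- the first factor is `log(1 + x)^m`, and `(1 + x)^{-1}` in the second is the derivative of
  -- `log(1 + x)`
  have h3 := 𝒱.smul_mem_filt (expTrunc_vecAct_mono ha hflow hJ0 m) (𝒱.flowElt_mem_filt ha hu J)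
  obtain ⟨N₀, hN₀⟩ := 𝒱.exists_flowElt_sub_mem ha hflow hu hJ0
  have h4 := 𝒱.smul_mem_filt hlog (hN₀ (max N N₀) (le_max_right _ _))
  change expTrunc J (-𝒱.rho a) (mono m • (1 ⊗ₜ[ℂ] u)) -
    expTrunc J (vecAct a) (mono m) • 𝒱.flowElt a J u ∈ _ at h2
  rw [sub_smul (expTrunc J (vecAct a) (mono m)) (logL ^ m) (𝒱.flowElt a J u)] at h3
  rw [smul_sub] at h4
  have h5 := Submodule.add_mem _ (Submodule.add_mem _ h2 (𝒱.filt_mono (by omega) h3))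
    (𝒱.filt_mono (by omega) h4)
  rw [sub_add_sub_cancel, sub_add_sub_cancel, TensorProduct.smul_tmul', smul_eq_mul, mul_one] at h5
  have h6 := 𝒱.vop_eq_zero_of_mem_filt h5 hv' (by omega)
  rw [map_sub, LinearMap.sub_apply, sub_eq_zero] at h6
  rw [← vop_mono, h1, h6, Finset.smul_sum, map_sum, LinearMap.sum_apply]
  refine Eq.trans (Finset.sum_congr rfl fun n _ => ?_) (Finset.sum_subset
    (Finset.range_subset_range.2 (le_max_left N N₀)) fun n _ hn => ?_).symm
  · rw [TensorProduct.smul_tmul', smul_eq_mul, mul_assoc]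
  · rw [Finset.mem_range, not_lt] at hn
    have := mul_mem_ordGE (mul_mem_ordGE hlog dX_logL_mem) (mono_mem_ordGE (le_refl (n : ℤ)))
    exact 𝒱.vop_eq_zero this (binomOp_mem (fun u hu => by
      simpa only [sub_zero] using 𝒱.vir_mem_wtLE 0 hu) n hu') hv' (by omega)

end VertexOperatorAlgebra

/-! ### The change of coordinate `e^{2 π √-1 y} - 1` -/

section Flow

/-- The vector field `∑_{j ≥ 1} A_j y^{j+1}`. -/
def coordSeries : ℂ⟦X⟧ := existsUnique_vectorField.choose

theorem X_sq_dvd_coordSeries : (PowerSeries.X : ℂ⟦X⟧) ^ 2 ∣ coordSeries :=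
  existsUnique_vectorField.choose_spec.1.1

theorem flow_neg_coordSeries : flow (-coordSeries) = expCoord :=
  existsUnique_vectorField.choose_spec.1.2

theorem derivative_rescale (c : ℂ) (f : ℂ⟦X⟧) :
    PowerSeries.derivative ℂ (PowerSeries.rescale c f) =
      c • PowerSeries.rescale c (PowerSeries.derivative ℂ f) := by
  ext n
  rw [PowerSeries.coeff_derivative, PowerSeries.coeff_rescale, PowerSeries.coeff_smul,
    PowerSeries.coeff_rescale, PowerSeries.coeff_derivative, smul_eq_mul, pow_succ]
  ring

/-- The vector field `∑_{j ≥ 1} A_j y^{j+1}` in the coordinate `x = 2 π √-1 y`. -/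
def coordField : ℂ⟦X⟧ := twoPiI • PowerSeries.rescale twoPiI⁻¹ coordSeries

theorem coeff_coordField (n : ℕ) :
    PowerSeries.coeff n coordField = twoPiI ^ (1 - n : ℤ) * PowerSeries.coeff n coordSeries := by
  rw [coordField, PowerSeries.coeff_smul, PowerSeries.coeff_rescale, smul_eq_mul, ← mul_assoc,
    zpow_sub₀ twoPiI_ne_zero, zpow_one, zpow_natCast, inv_pow, div_eq_mul_inv]

theorem X_sq_dvd_coordField : (PowerSeries.X : ℂ⟦X⟧) ^ 2 ∣ coordField :=
  PowerSeries.X_pow_dvd_iff.2 fun m hm => by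
    rw [coeff_coordField, PowerSeries.X_pow_dvd_iff.1 X_sq_dvd_coordSeries m hm, mul_zero]

theorem coordField_mem : ofPS coordField ∈ ordGE 2 := by
  exact_mod_cast ofPS_mem_ordGE_of_dvd X_sq_dvd_coordField

/-- The substitution `x = 2 π √-1 y` in the iterates that define the flow. -/
theorem iterate_coordField (k : ℕ) :
    (fun f : ℂ⟦X⟧ => -coordField * PowerSeries.derivative ℂ f)^[k] PowerSeries.X =
      twoPiI • PowerSeries.rescale twoPiI⁻¹
        ((fun f : ℂ⟦X⟧ => -coordSeries * PowerSeries.derivative ℂ f)^[k] PowerSeries.X) := by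
  induction k with
  | zero =>
    ext n
    rw [Function.iterate_zero_apply, Function.iterate_zero_apply, PowerSeries.coeff_smul,
      PowerSeries.coeff_rescale, PowerSeries.coeff_X]
    split_ifs with h
    · subst h
      rw [pow_one, mul_one, smul_eq_mul, mul_inv_cancel₀ twoPiI_ne_zero]
    · simp
  | succ k ih =>
    rw [Function.iterate_succ_apply', Function.iterate_succ_apply', ih]
    generalize (fun f : ℂ⟦X⟧ => -coordSeries * PowerSeries.derivative ℂ f)^[k] PowerSeries.X = f
    rw [Derivation.map_smul, derivative_rescale, smul_inv_smul₀ twoPiI_ne_zero, coordField, map_mul, map_neg,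
      neg_mul, neg_mul, smul_neg, smul_mul_assoc]

/-- Each coefficient of the flow is a finite sum, of any sufficient length. -/
theorem coeff_flow_eq_sum {a : ℂ⟦X⟧} (ha : (PowerSeries.X : ℂ⟦X⟧) ^ 2 ∣ a) {n J : ℕ} (h : n < J) :
    PowerSeries.coeff n (flow a) = ∑ k ∈ Finset.range J, (k.factorial : ℂ)⁻¹ *
      PowerSeries.coeff n
        ((fun f : ℂ⟦X⟧ => a * PowerSeries.derivative ℂ f)^[k] PowerSeries.X) := by
  rw [flow, PowerSeries.coeff_mk]
  refine finsum_eq_sum_of_support_subset _ fun k hk => ?_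
  by_contra hlt
  simp only [Finset.coe_range, Set.mem_Iio, not_lt] at hlt
  refine hk ?_
  simp only
  rw [PowerSeries.X_pow_dvd_iff.1 (X_pow_dvd_iterate ha k) n (by omega), mul_zero]

theorem neg_vecAct_pow_ofPS (b f : ℂ⟦X⟧) (k : ℕ) : ((-vecAct (ofPS b)) ^ k) (ofPS f) =
    ofPS ((fun f : ℂ⟦X⟧ => -b * PowerSeries.derivative ℂ f)^[k] f) := by
  induction k with
  | zero => rfl
  | succ k ih =>
    rw [pow_succ', Module.End.mul_apply, ih, Function.iterate_succ_apply', LinearMap.neg_apply,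
      vecAct_apply, dX_ofPS, map_mul, map_neg, neg_mul]

/-- The flow of `-∑_{j ≥ 1} A_j y^{j+1} d/dy`, written in the coordinate `x = 2 π √-1 y`, is
`e^x - 1`. -/
theorem expSub_sub_expTrunc_mem (J : ℕ) :
    expSub - expTrunc J (-vecAct (ofPS coordField)) (mono 1) ∈ ordGE J := by
  have hA : (PowerSeries.X : ℂ⟦X⟧) ^ 2 ∣ -coordSeries := (dvd_neg).2 X_sq_dvd_coordSeries
  intro n hn
  rw [map_sub, sub_eq_zero, expTrunc_apply, map_sum, ← ofPS_X]
  by_cases h0 : n < 0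
  · rw [expSub_mem n (by omega), Finset.sum_eq_zero]
    intro k _
    rw [divPow, LinearMap.smul_apply, neg_vecAct_pow_ofPS, map_smul, lcoeff_ofPS, if_pos h0,
      smul_zero]
  obtain ⟨n, rfl⟩ := Int.eq_ofNat_of_zero_le (not_lt.1 h0)
  have h1 := congrArg (PowerSeries.coeff n) flow_neg_coordSeries
  rw [coeff_flow_eq_sum hA (J := J) (by omega)] at h1
  have h2 : lcoeff n expSub = twoPiI * (twoPiI⁻¹ ^ n * PowerSeries.coeff n expCoord) := by
    rw [expSub, ← map_one ofPS, ← map_sub, lcoeff_ofPS, if_neg h0, Int.natAbs_natCast, expCoord,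
      PowerSeries.coeff_smul, map_sub, map_sub, PowerSeries.coeff_rescale, smul_eq_mul,
      PowerSeries.coeff_one]
    have hc := twoPiI_ne_zero
    split_ifs with h
    · subst h
      field_simp
    · rw [inv_pow]
      field_simp
      rw [sub_zero, sub_zero]
  rw [h2, ← h1, Finset.mul_sum, Finset.mul_sum]
  refine Finset.sum_congr rfl fun k _ => ?_
  rw [divPow, LinearMap.smul_apply, neg_vecAct_pow_ofPS, map_smul, lcoeff_ofPS, if_neg h0,
    Int.natAbs_natCast, iterate_coordField, PowerSeries.coeff_smul, PowerSeries.coeff_rescale,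
    smul_eq_mul, smul_eq_mul]
  ring

end Flow

namespace VertexOperatorAlgebra

open scoped TensorProduct

variable {V : Type*} [AddCommGroup V] [Module ℂ V] (𝒱 : VertexOperatorAlgebra V)

/-- The operator `(2 π √-1)^{L(0)}`. -/
def rescaleOp : Module.End ℂ V := scalarPow twoPiI (𝒱.vir 0) 𝒱.isInternal_vir_zero

theorem rescaleOp_apply {k : ℤ} {v : V} (hv : v ∈ (𝒱.vir 0).eigenspace (k : ℂ)) :
    𝒱.rescaleOp v = twoPiI ^ k • v :=
  diagOp_apply 𝒱.isInternal_vir_zero _ hv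

theorem eq_of_eigenspace {V' : Type*} [AddCommGroup V'] [Module ℂ V'] {S T : V →ₗ[ℂ] V'}
    (h : ∀ k : ℤ, ∀ v ∈ (𝒱.vir 0).eigenspace (k : ℂ), S v = T v) (v : V) : S v = T v :=
  eq_of_iSup_eq_top 𝒱.isInternal_vir_zero.submodule_iSup_eq_top h v

/-- Conjugation by `(2 π √-1)^{L(0)}` rescales the coordinate. -/
theorem rescaleOp_mode (u : V) (m : ℤ) (v : V) :
    𝒱.rescaleOp (𝒱.mode u m v) =
      twoPiI ^ (-m - 1) • 𝒱.mode (𝒱.rescaleOp u) m (𝒱.rescaleOp v) := by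
  refine 𝒱.eq_of_eigenspace (S := 𝒱.rescaleOp ∘ₗ (𝒱.modeBilin m).flip v)
    (T := twoPiI ^ (-m - 1) • (𝒱.modeBilin m).flip (𝒱.rescaleOp v) ∘ₗ 𝒱.rescaleOp)
    (fun k u hu => ?_) u
  change 𝒱.rescaleOp (𝒱.mode u m v) =
    twoPiI ^ (-m - 1) • 𝒱.mode (𝒱.rescaleOp u) m (𝒱.rescaleOp v)
  refine 𝒱.eq_of_eigenspace (S := 𝒱.rescaleOp ∘ₗ 𝒱.mode u m)
    (T := twoPiI ^ (-m - 1) • 𝒱.mode (𝒱.rescaleOp u) m ∘ₗ 𝒱.rescaleOp) (fun l v hv => ?_) v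
  change 𝒱.rescaleOp (𝒱.mode u m v) =
    twoPiI ^ (-m - 1) • 𝒱.mode (𝒱.rescaleOp u) m (𝒱.rescaleOp v)
  rw [𝒱.rescaleOp_apply (𝒱.mode_mem_eigenspace hu hv m), 𝒱.rescaleOp_apply hu,
    𝒱.rescaleOp_apply hv, mode_smul, map_smul, smul_smul, smul_smul, ← zpow_add₀ twoPiI_ne_zero,
    ← zpow_add₀ twoPiI_ne_zero]
  congr 2
  ring

theorem rescaleOp_vir (j : ℤ) (v : V) :
    𝒱.rescaleOp (𝒱.vir j v) = twoPiI ^ (-j) • 𝒱.vir j (𝒱.rescaleOp v) := by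
  refine 𝒱.eq_of_eigenspace (S := 𝒱.rescaleOp ∘ₗ 𝒱.vir j)
    (T := twoPiI ^ (-j) • 𝒱.vir j ∘ₗ 𝒱.rescaleOp) (fun l v hv => ?_) v
  change 𝒱.rescaleOp (𝒱.vir j v) = twoPiI ^ (-j) • 𝒱.vir j (𝒱.rescaleOp v)
  rw [𝒱.rescaleOp_apply (𝒱.vir_mem_eigenspace j l hv), 𝒱.rescaleOp_apply hv, map_smul, smul_smul,
    ← zpow_add₀ twoPiI_ne_zero]
  congr 2
  ring

theorem rescaleOp_commute {S : Module.End ℂ V} (h : ∀ v, S (𝒱.vir 0 v) = 𝒱.vir 0 (S v)) (v : V) :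
    S (𝒱.rescaleOp v) = 𝒱.rescaleOp (S v) :=
  diagOp_commute 𝒱.isInternal_vir_zero _ (fun k v hv => by
    rw [Module.End.mem_eigenspace_iff] at hv ⊢
    rw [← h, hv, map_smul]) v

theorem rescaleOp_mem_wtLE {n : ℤ} {v : V} (hv : v ∈ 𝒱.wtLE n) : 𝒱.rescaleOp v ∈ 𝒱.wtLE n :=
  𝒱.mem_wtLE_of_commute (fun v => by simpa using 𝒱.rescaleOp_vir 0 v) hv

theorem rescaleOp_bijective : Function.Bijective 𝒱.rescaleOp := by
  have h : ∀ v, scalarPow twoPiI⁻¹ (𝒱.vir 0) 𝒱.isInternal_vir_zero (𝒱.rescaleOp v) = v :=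
    𝒱.eq_of_eigenspace (S := scalarPow twoPiI⁻¹ (𝒱.vir 0) 𝒱.isInternal_vir_zero ∘ₗ 𝒱.rescaleOp)
      (T := LinearMap.id) fun k v hv => by
        rw [LinearMap.comp_apply, 𝒱.rescaleOp_apply hv, map_smul, scalarPow, diagOp_apply 𝒱.isInternal_vir_zero _ hv,
          smul_smul, ← mul_zpow, mul_inv_cancel₀ twoPiI_ne_zero, one_zpow, one_smul]
        rfl
  have h' : ∀ v, 𝒱.rescaleOp (scalarPow twoPiI⁻¹ (𝒱.vir 0) 𝒱.isInternal_vir_zero v) = v :=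
    𝒱.eq_of_eigenspace (S := 𝒱.rescaleOp ∘ₗ scalarPow twoPiI⁻¹ (𝒱.vir 0) 𝒱.isInternal_vir_zero)
      (T := LinearMap.id) fun k v hv => by
        rw [LinearMap.comp_apply, scalarPow, diagOp_apply 𝒱.isInternal_vir_zero _ hv, map_smul, 𝒱.rescaleOp_apply hv,
          smul_smul, ← mul_zpow, inv_mul_cancel₀ twoPiI_ne_zero, one_zpow, one_smul]
        rfl
  exact ⟨Function.LeftInverse.injective h, Function.RightInverse.surjective h'⟩

theorem virPlus_apply (v : V) :
    𝒱.virPlus v = ∑ᶠ j : ℕ, coordCoeff (j + 1) • 𝒱.vir (j + 1) v := rfl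

/-- `L_+(A)` is the Virasoro operator of the vector field `∑_{j ≥ 1} A_j y^{j+1} d/dy`. -/
theorem virPlus_eq : 𝒱.virPlus = 𝒱.virSeries (ofPS coordSeries) := by
  ext v
  rw [virPlus_apply, 𝒱.virSeries_eq_finsum (ofPS_mem_ordGE _)]
  refine ((finsum_eq_finsum_comp (e := fun j : ℕ => j + 2) (add_left_injective 2) ?_).trans ?_).symm
  swap
  · refine finsum_congr fun j => ?_
    rw [lcoeff_ofPS, if_neg (by omega), Int.natAbs_natCast, coordCoeff, coordSeries]
    rw [show ((j + 2 : ℕ) : ℤ) - 1 = (j : ℤ) + 1 by push_cast; ring]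
  · intro k hk
    by_contra hlt
    apply hk
    have hk2 : k < 2 := by
      by_contra h2
      exact hlt ⟨k - 2, by simp only; omega⟩
    rw [lcoeff_ofPS, if_neg (by omega), Int.natAbs_natCast,
      PowerSeries.X_pow_dvd_iff.1 X_sq_dvd_coordSeries k hk2, zero_smul]

/-- Conjugation by `(2 π √-1)^{L(0)}` rescales the vector field from the coordinate `y` to the
coordinate `x = 2 π √-1 y`. -/
theorem rescaleOp_virPlus (v : V) :
    𝒱.rescaleOp (𝒱.virPlus v) = 𝒱.virSeries (ofPS coordField) (𝒱.rescaleOp v) := by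
  obtain ⟨p, hp⟩ := 𝒱.exists_mem_wtLE v
  obtain ⟨M, hM⟩ := 𝒱.exists_range_bound p
  rw [virPlus_eq, 𝒱.virSeries_eq_sum (ofPS_mem_ordGE _) hp hM,
    𝒱.virSeries_eq_sum (ofPS_mem_ordGE _) (𝒱.rescaleOp_mem_wtLE hp) hM, map_sum]
  refine Finset.sum_congr rfl fun i _ => ?_
  rw [map_smul, rescaleOp_vir, lcoeff_ofPS, lcoeff_ofPS, if_neg (by omega), if_neg (by omega),
    Int.natAbs_natCast, coeff_coordField, smul_smul, neg_sub, mul_comm]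

/-- On every vector, `𝒰(1)` is a truncated exponential composed with `(2 π √-1)^{L(0)}`. -/
theorem opU_eq {p : ℤ} {v : V} (hv : v ∈ 𝒱.wtLE p) {J : ℕ} (hJ : p - J < 𝒱.minWt) :
    𝒱.opU v = expTrunc J (-𝒱.virSeries (ofPS coordField)) (𝒱.rescaleOp v) := by
  have hA : ofPS coordSeries ∈ ordGE 2 := by
    exact_mod_cast ofPS_mem_ordGE_of_dvd X_sq_dvd_coordSeries
  have h0 : ((-𝒱.virPlus) ^ J) v = 0 := by
    have : ∀ j : ℕ, ((-𝒱.virPlus) ^ j) v ∈ 𝒱.wtLE (p - j) := by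
      intro j
      induction j with
      | zero => simpa using hv
      | succ j ih =>
        rw [pow_succ', Module.End.mul_apply, LinearMap.neg_apply, virPlus_eq]
        rw [virPlus_eq] at ih
        have := 𝒱.virSeries_mem_wtLE hA ih
        rw [show p - ((j + 1 : ℕ) : ℤ) = p - j - 1 by push_cast; ring]
        exact Submodule.neg_mem _ this
    exact 𝒱.eq_zero_of_mem_wtLE hJ (this J)
  change 𝒱.rescaleOp (evalSeries _ _ _ v) = _
  rw [evalSeries_exp_eq 𝒱.locallyNilpotent_neg_virPlus h0]
  exact expTrunc_intertwine 𝒱.rescaleOp (fun v => by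
    rw [LinearMap.neg_apply, LinearMap.neg_apply, map_neg, rescaleOp_virPlus]) J v

theorem opU_mem_wtLE {p : ℤ} {v : V} (hv : v ∈ 𝒱.wtLE p) : 𝒱.opU v ∈ 𝒱.wtLE p := by
  rw [𝒱.opU_eq hv (J := (p - 𝒱.minWt + 1).toNat) (by omega)]
  exact 𝒱.expTrunc_virSeries_mem coordField_mem (𝒱.rescaleOp_mem_wtLE hv) _

end VertexOperatorAlgebra

/-- The series `(1 / 2 π √-1) log(1 + x)`. -/
def logC : Laurent := twoPiI⁻¹ • logL

theorem logC_zpow (m : ℤ) : logC ^ m = twoPiI ^ (-m) • logL ^ m := by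
  rw [logC, Algebra.smul_def, mul_zpow, ← map_zpow₀, ← Algebra.smul_def, zpow_neg, inv_zpow]

namespace VertexOperatorAlgebra

open scoped TensorProduct

variable {V : Type*} [AddCommGroup V] [Module ℂ V] (𝒱 : VertexOperatorAlgebra V)

/-- The operator `𝒰(1)` transforms `Y(u, x)` into `Y((1 + y)^{L(0)} 𝒰(1) u, y)`, under the
substitution `x = (1 / 2 π √-1) log(1 + y)`. -/
theorem exists_opU_mode (u v : V) (m : ℤ) : ∃ M : ℕ, ∀ N : ℕ, M ≤ N →
    𝒱.opU (𝒱.mode u m v) = ∑ n ∈ Finset.range N,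
      𝒱.vop ((logC ^ m * dX logC * mono n) ⊗ₜ binomOp (𝒱.vir 0) n (𝒱.opU u)) (𝒱.opU v) := by
  obtain ⟨p, hu⟩ := 𝒱.exists_mem_wtLE u
  obtain ⟨q, hv⟩ := 𝒱.exists_mem_wtLE v
  obtain ⟨M, hM⟩ := 𝒱.exists_expTrunc_mode coordField_mem expSub_sub_expTrunc_mem (𝒱.rescaleOp u)
    (𝒱.rescaleOp v) m
  refine ⟨M, fun N hN => ?_⟩
  set J := max M (max (p - 𝒱.minWt + 1).toNat (max (q - 𝒱.minWt + 1).toNat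
    (p + q - m - 1 - 𝒱.minWt + 1).toNat)) with hJ
  rw [𝒱.opU_eq hu (J := J) (by omega), 𝒱.opU_eq hv (J := J) (by omega),
    𝒱.opU_eq (𝒱.mode_mem_wtLE hu hv m) (J := J) (by omega), rescaleOp_mode, map_smul,
    hM J N (le_max_left _ _) hN, Finset.smul_sum]
  refine Finset.sum_congr rfl fun n _ => ?_
  have e : logC ^ m * dX logC * mono n =
      twoPiI ^ (-m - 1) • (logL ^ m * dX logL * mono n) := by
    rw [logC_zpow, logC, map_smul, smul_mul_smul_comm, smul_mul_assoc, zpow_sub₀ twoPiI_ne_zero,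
      zpow_one, div_eq_mul_inv]
  rw [e, ← TensorProduct.smul_tmul', map_smul, LinearMap.smul_apply]

end VertexOperatorAlgebra

/-! ### Change of variable in residues -/

section Residue

/-- The leading coefficient of a product. -/
theorem lcoeff_add_mul {m n : ℤ} {f g : Laurent} (hf : f ∈ ordGE m) (hg : g ∈ ordGE n) :
    lcoeff (m + n) (f * g) = lcoeff m f * lcoeff n g := by
  have hf' : mono (-m) * f ∈ ordGE 0 := by
    simpa using mul_mem_ordGE (mono_mem_ordGE (le_refl (-m))) hf
  have hg' : mono (-n) * g ∈ ordGE 0 := by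
    simpa using mul_mem_ordGE (mono_mem_ordGE (le_refl (-n))) hg
  have h := lcoeff_zero_mul hf' hg'
  rw [mul_mul_mul_comm, mono_mul_mono, lcoeff_mono_mul, lcoeff_mono_mul, lcoeff_mono_mul] at h
  rwa [show 0 - (-m + -n) = m + n by ring, zero_sub, zero_sub, neg_neg, neg_neg] at h

variable {ℓ : Laurent} (h0 : ℓ ≠ 0) (h1 : lorder ℓ = 1)
include h0 h1

theorem lcoeff_zpow_ne_zero (n : ℤ) : lcoeff n (ℓ ^ n) ≠ 0 := by
  have h : lorder (ℓ ^ n) = n := by rw [lorder_zpow h0, h1, mul_one]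
  have := HahnSeries.coeff_order_eq_zero.not.2
    (show (ℓ ^ n : LaurentSeries ℂ) ≠ 0 from zpow_ne_zero n h0)
  change lcoeff (lorder (ℓ ^ n)) (ℓ ^ n) ≠ 0 at this
  rwa [h] at this

/-- The residue of `ℓ^k dℓ`, for a local coordinate `ℓ`. -/
theorem lcoeff_zpow_mul_dX (k : ℤ) :
    lcoeff (-1) (ℓ ^ k * dX ℓ) = if k = -1 then 1 else 0 := by
  split_ifs with hk
  · subst hk
    have hℓ := zpow_mem_ordGE h0 h1 1
    have hi := zpow_mem_ordGE h0 h1 (-1)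
    rw [zpow_one] at hℓ
    have e1 := lcoeff_add_mul hi (dX_mem_ordGE hℓ)
    have e2 := lcoeff_add_mul hi hℓ
    rw [zpow_neg_one, inv_mul_cancel₀ h0, neg_add_cancel, ← mono_zero, lcoeff_mono_same] at e2
    rw [sub_self, add_zero, lcoeff_dX, Int.cast_zero, zero_add, one_mul, zero_add] at e1
    rw [e1, zpow_neg_one, ← e2]
  · have hk' : ((k + 1 : ℤ) : ℂ) ≠ 0 := by
      have : k + 1 ≠ 0 := by omega
      exact_mod_cast this
    have h := dX_zpow h0 (k + 1)
    rw [add_sub_cancel_right, ← inv_smul_eq_iff₀ hk'] at h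
    rw [← h, map_smul, lcoeff_dX]
    simp

/-- Expansion of a Laurent series `f` in powers of a local coordinate `ℓ`: the coefficient of
`ℓ^m dℓ` in `f dx` is the residue of `f ℓ^{-m-1}`. -/
theorem sub_sum_zpow_mem_ordGE {f : Laurent} {s : ℤ} (hf : f ∈ ordGE s) (M : ℤ) :
    f - ∑ m ∈ Finset.Ico s M, lcoeff (-1) (f * ℓ ^ (-m - 1)) • (ℓ ^ m * dX ℓ) ∈ ordGE M := by
  set r := f - ∑ m ∈ Finset.Ico s M, lcoeff (-1) (f * ℓ ^ (-m - 1)) • (ℓ ^ m * dX ℓ) with hr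
  have hdℓ : dX ℓ ∈ ordGE 0 := by
    have := dX_mem_ordGE (zpow_mem_ordGE h0 h1 1)
    rwa [zpow_one] at this
  have hrs : r ∈ ordGE s := by
    refine Submodule.sub_mem _ hf (Submodule.sum_mem _ fun m hm => Submodule.smul_mem _ _ ?_)
    have hm := Finset.mem_Ico.1 hm
    exact ordGE_mono (by omega) (mul_mem_ordGE (zpow_mem_ordGE h0 h1 m) hdℓ)
  have hres : ∀ k ∈ Finset.Ico s M, lcoeff (-1) (r * ℓ ^ (-k - 1)) = 0 := by
    intro k hk
    rw [hr, sub_mul, map_sub, Finset.sum_mul, map_sum, Finset.sum_eq_single k]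
    · rw [smul_mul_assoc, map_smul, mul_right_comm, ← zpow_add₀ h0,
        lcoeff_zpow_mul_dX h0 h1, if_pos (by ring), smul_eq_mul, mul_one, sub_self]
    · intro m _ hm
      rw [smul_mul_assoc, map_smul, mul_right_comm, ← zpow_add₀ h0,
        lcoeff_zpow_mul_dX h0 h1, if_neg (by omega), smul_zero]
    · intro h
      exact absurd hk h
  have key : ∀ n : ℕ, s + n ≤ max s M → r ∈ ordGE (s + n) := by
    intro n
    induction n with
    | zero => intro _; simpa using hrs
    | succ n ih =>
      intro hn
      push_cast at hn ⊢
      have h2 := ih (by omega)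
      have h3 := lcoeff_add_mul h2 (zpow_mem_ordGE h0 h1 (-(s + n) - 1))
      rw [show s + (n : ℤ) + (-(s + n) - 1) = -1 by ring,
        hres _ (Finset.mem_Ico.2 ⟨by omega, by omega⟩)] at h3
      have h4 := (mul_eq_zero.1 h3.symm).resolve_right (lcoeff_zpow_ne_zero h0 h1 _)
      intro k hk
      by_cases hk' : k < s + n
      · exact h2 k hk'
      · rw [show k = s + n by omega, h4]
  exact ordGE_mono (by omega) (key (max s M - s).toNat (by omega))

/-- Change of variable in residues: a linear functional of `f` that depends on finitely many
coefficients is computed from the residues of `f ℓ^{-m-1}`. -/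
theorem apply_eq_sum_residue {E : Type*} [AddCommGroup E] [Module ℂ E] {Θ : Laurent →ₗ[ℂ] E}
    {M s : ℤ} (hΘ : ∀ f ∈ ordGE M, Θ f = 0) {f : Laurent} (hf : f ∈ ordGE s) :
    Θ f = ∑ m ∈ Finset.Ico s M, lcoeff (-1) (f * ℓ ^ (-m - 1)) • Θ (ℓ ^ m * dX ℓ) := by
  have := hΘ _ (sub_sum_zpow_mem_ordGE h0 h1 hf M)
  rw [map_sub, map_sum, sub_eq_zero] at this
  rw [this]
  exact Finset.sum_congr rfl fun m _ => map_smul _ _ _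

omit h0 h1

theorem logC_ne_zero : logC ≠ 0 := smul_ne_zero (inv_ne_zero twoPiI_ne_zero) logL_ne_zero

theorem lorder_logC : lorder logC = 1 := by
  have hmem : logC ∈ ordGE 1 := Submodule.smul_mem _ _ logL_mem
  refine lorder_eq_of_mem hmem ?_
  rw [logC, map_smul, smul_eq_mul]
  refine mul_ne_zero (inv_ne_zero twoPiI_ne_zero) ?_
  have := lcoeff_zpow_ne_zero logL_ne_zero lorder_logL 1
  rwa [zpow_one] at this

theorem logY_eq : logY = (logC : LaurentSeries ℂ) := by
  have h : ofPS (twoPiI⁻¹ • PowerSeries.log ℂ) = logC := by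
    refine laurent_ext fun n => ?_
    rw [logC, map_smul (lcoeff n), logL, lcoeff_ofPS, lcoeff_ofPS]
    split_ifs
    · simp
    · rw [PowerSeries.coeff_smul]
  exact h

theorem coeff_single_mul_logY_zpow (k m : ℤ) :
    (HahnSeries.single k (1 : ℂ) * logY ^ (-m - 1)).coeff (-1) =
      lcoeff (-1) (mono k * logC ^ (-m - 1)) := by
  rw [logY_eq]
  rfl

theorem orderOne_logY : OrderOne logY := by
  intro k m h
  rw [coeff_single_mul_logY_zpow]
  exact mul_mem_ordGE (mono_mem_ordGE (le_refl k))
    (zpow_mem_ordGE logC_ne_zero lorder_logC _) _ (by omega)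

/-- The residue with `(1 / 2 π √-1) log(1 + y)` in place of `y`, as a finite sum. -/
theorem resY_logY_eq_sum {V : Type*} [AddCommGroup V] [Module ℂ V] {𝒱 : VertexOperatorAlgebra V}
    {B : Module.End ℂ V} (hB : 𝒱.PreservesWt B) (s : ℤ) {p q : ℤ} {u v : V} (hu : u ∈ 𝒱.wtLE p)
    (hv : v ∈ 𝒱.wtLE q) {N : ℕ} (hN : p + q - s - N - 1 < 𝒱.minWt) :
    resY 𝒱 logY (shift s (onePlusPow B u)) v = ∑ j ∈ Finset.range N, ∑ m ∈ Finset.Ico s (s + N),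
      lcoeff (-1) (mono (s + j) * logC ^ (-m - 1)) • 𝒱.mode (binomOp B j u) m v := by
  rw [resY, ← Finset.sum_product', finsum_eq_finsum_comp
    (e := fun x : ℕ × ℤ => (s + (x.1 : ℤ), x.2)) (fun x y hxy => ?_) (fun x hx => ?_),
    finsum_eq_sum_of_support_subset (s := Finset.range N ×ˢ Finset.Ico s (s + N))]
  · refine Finset.sum_congr rfl fun x _ => ?_
    rw [coeff_single_mul_logY_zpow, shift, onePlusPow, if_pos (by omega), add_sub_cancel_left,
      Int.toNat_natCast]
  · intro x hx
    rw [Function.mem_support] at hx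
    have h1 : x.2 < s + N := by
      by_contra hlt
      apply hx
      rw [𝒱.mode_eq_zero (shift_onePlusPow_mem hB hu s _) hv (by omega), smul_zero]
    have h2 : s + (x.1 : ℤ) ≤ x.2 := by
      by_contra hlt
      apply hx
      rw [orderOne_logY _ _ (not_le.1 hlt), zero_smul]
    simp only [Finset.coe_product, Set.mem_prod, Finset.mem_coe, Finset.mem_range, Finset.mem_Ico]
    omega
  · have := Prod.ext_iff.1 hxy
    exact Prod.ext (by simpa using this.1) this.2
  · have : s ≤ x.1 := by
      by_contra hlt
      apply hx
      rw [shift_onePlusPow_eq_zero _ _ _ _ (not_le.1 hlt), 𝒱.mode_zero, smul_zero]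
    exact ⟨((x.1 - s).toNat, x.2), Prod.ext (by simp only; omega) rfl⟩

end Residue

/-! ### The isomorphism induced by `𝒰(1)` -/

namespace VertexOperatorAlgebra

open scoped TensorProduct

variable {V : Type*} [AddCommGroup V] [Module ℂ V] (𝒱 : VertexOperatorAlgebra V)

/-- `𝒰(1)` commutes with every operator that commutes with the Virasoro operators, such as `g`. -/
theorem opU_commute {S : Module.End ℂ V} (h : ∀ n v, S (𝒱.vir n v) = 𝒱.vir n (S v)) (v : V) :
    S (𝒱.opU v) = 𝒱.opU (S v) := by
  change S (𝒱.rescaleOp _) = 𝒱.rescaleOp _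
  rw [𝒱.rescaleOp_commute (h 0)]
  congr 1
  refine evalSeries_intertwine _ _ _ (fun v => ?_) v
  rw [LinearMap.neg_apply, LinearMap.neg_apply, map_neg, virPlus_apply, virPlus_apply,
    map_finsum S (𝒱.finite_support_vir (fun j => coordCoeff (j + 1)) v)]
  simp only [map_smul, h]

/-- The operator `𝒰(1)` carries the residues `Res_y y^s Y((1 + y)^P u, (1 / 2 π √-1) log(1 + y))`
to the twisted modes attached to `L(0) + P`. -/
theorem opU_resY {P B : Module.End ℂ V} (hB : 𝒱.PreservesWt B) (hBP : B = 𝒱.vir 0 + P)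
    (hP : ∀ n v, P (𝒱.vir n v) = 𝒱.vir n (P v)) (s : ℤ) (u v : V) :
    𝒱.opU (resY 𝒱 logY (shift s (onePlusPow P u)) v) = tmode hB s (𝒱.opU u) (𝒱.opU v) := by
  have hPW : 𝒱.PreservesWt P := fun n v hv => 𝒱.mem_wtLE_of_commute (hP 0) hv
  have hL : 𝒱.PreservesWt (𝒱.vir 0) := fun n v hv => by simpa using 𝒱.vir_mem_wtLE 0 hv
  obtain ⟨p, hu⟩ := 𝒱.exists_mem_wtLE u
  obtain ⟨q, hv⟩ := 𝒱.exists_mem_wtLE v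
  have hu' := 𝒱.opU_mem_wtLE hu
  have hv' := 𝒱.opU_mem_wtLE hv
  have hcomm : ∀ j, 𝒱.opU (binomOp P j u) = binomOp P j (𝒱.opU u) := fun j =>
    binomOp_intertwine 𝒱.opU (fun u => (𝒱.opU_commute hP u).symm) j u
  obtain ⟨N, hN⟩ := exists_bound (𝒱 := 𝒱) s hu hv
  have hbin : ∀ j n : ℕ, binomOp (𝒱.vir 0) n (binomOp P j (𝒱.opU u)) ∈ 𝒱.wtLE p := fun j n =>
    hL.binomOp_mem n (hPW.binomOp_mem j hu')
  choose K hK using fun (j : ℕ) (m : ℤ) => 𝒱.exists_opU_mode (binomOp P j u) v m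
  -- a common bound for the cutoffs of the finitely many modes that occur
  set N' : ℕ := N + ∑ j ∈ Finset.range N, ∑ m ∈ Finset.Ico s (s + N), K j m with hN'
  have hKN : ∀ j ∈ Finset.range N, ∀ m ∈ Finset.Ico s (s + N), K j m ≤ N' := fun j hj m hm =>
    le_trans ((Finset.single_le_sum (f := fun m => K j m) (fun _ _ => Nat.zero_le _) hm).trans
      (Finset.single_le_sum (f := fun j => ∑ m ∈ Finset.Ico s (s + N), K j m)
        (fun _ _ => Nat.zero_le _) hj)) (Nat.le_add_left _ _)
  have hG : ∀ j n : ℕ, N ≤ n + j →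
      𝒱.mode (binomOp (𝒱.vir 0) n (binomOp P j (𝒱.opU u))) (s + j + n) (𝒱.opU v) = 0 :=
    fun j n hjn => 𝒱.mode_eq_zero (hbin j n) hv' (by omega)
  rw [resY_logY_eq_sum hPW s hu hv (N := N) (by omega), map_sum]
  have step : ∀ j ∈ Finset.range N, 𝒱.opU (∑ m ∈ Finset.Ico s (s + N),
      lcoeff (-1) (mono (s + j) * logC ^ (-m - 1)) • 𝒱.mode (binomOp P j u) m v) =
      ∑ n ∈ Finset.range N,
        𝒱.mode (binomOp (𝒱.vir 0) n (binomOp P j (𝒱.opU u))) (s + j + n) (𝒱.opU v) := by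
    intro j hj
    -- expansion of `y^{s+j}` in powers of `(1 / 2 π √-1) log(1 + y)` inside the residue
    have hΘ : ∀ n : ℕ, 𝒱.mode (binomOp (𝒱.vir 0) n (binomOp P j (𝒱.opU u))) (s + j + n) (𝒱.opU v) =
        ∑ m ∈ Finset.Ico s (s + N), lcoeff (-1) (mono (s + j) * logC ^ (-m - 1)) •
          𝒱.vop ((logC ^ m * dX logC * mono n) ⊗ₜ
            binomOp (𝒱.vir 0) n (binomOp P j (𝒱.opU u))) (𝒱.opU v) := by
      intro n
      have := apply_eq_sum_residue logC_ne_zero lorder_logC (M := s + N) (s := s)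
        (Θ := 𝒱.vopL (binomOp (𝒱.vir 0) n (binomOp P j (𝒱.opU u))) (𝒱.opU v) ∘ₗ
          LinearMap.mulRight ℂ (mono n)) (fun f hf => by
            rw [LinearMap.comp_apply, LinearMap.mulRight_apply, vopL_apply]
            have := mul_mem_ordGE hf (mono_mem_ordGE (le_refl (n : ℤ)))
            exact 𝒱.vop_eq_zero this (hbin j n) hv' (by omega))
        (mono_mem_ordGE (n := s) (p := s + j) (by omega))
      simp only [LinearMap.comp_apply, LinearMap.mulRight_apply, vopL_apply, mono_mul_mono,
        vop_mono] at this
      exact this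
    rw [map_sum]
    calc _ = ∑ m ∈ Finset.Ico s (s + N), ∑ n ∈ Finset.range N',
          lcoeff (-1) (mono (s + j) * logC ^ (-m - 1)) •
          𝒱.vop ((logC ^ m * dX logC * mono n) ⊗ₜ
            binomOp (𝒱.vir 0) n (binomOp P j (𝒱.opU u))) (𝒱.opU v) := by
          refine Finset.sum_congr rfl fun m hm => ?_
          rw [map_smul, hK j m N' (hKN j hj m hm), Finset.smul_sum, hcomm]
      _ = ∑ n ∈ Finset.range N',
          𝒱.mode (binomOp (𝒱.vir 0) n (binomOp P j (𝒱.opU u))) (s + j + n) (𝒱.opU v) := by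
          rw [Finset.sum_comm]
          exact Finset.sum_congr rfl fun n _ => (hΘ n).symm
      _ = _ := by
          refine (Finset.sum_subset (Finset.range_subset_range.2 (Nat.le_add_right N _))
            fun n _ hn => hG j n ?_).symm
          rw [Finset.mem_range] at hn
          omega
  rw [Finset.sum_congr rfl step, Finset.sum_comm, ← sum_range_antidiagonal
    (G := fun n j => 𝒱.mode (binomOp (𝒱.vir 0) n (binomOp P j (𝒱.opU u))) (s + j + n) (𝒱.opU v))
    (fun n j hnj => hG j n hnj), tmode_eq_sum hB hu' hv' hN]
  refine Finset.sum_congr rfl fun k _ => ?_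
  subst hBP
  -- `(1 + y)^{L(0)} (1 + y)^P = (1 + y)^{L(0) + P}`, as `L(0)` and `P` commute
  rw [binomOp_add (fun v => (hP 0 v).symm), mode_sum]
  refine Finset.sum_congr rfl fun x hx => ?_
  rw [← mem_antidiagonal.1 hx]
  push_cast
  rw [add_right_comm, add_assoc]

theorem opU_vac : 𝒱.opU 𝒱.vac = 𝒱.vac := by
  have h0 : ∀ n : ℤ, -1 ≤ n → 𝒱.vir n 𝒱.vac = 0 := fun n hn =>
    (𝒱.creation 𝒱.conf).2 (n + 1) (by omega)
  have h1 : ((-𝒱.virPlus) ^ 1) 𝒱.vac = 0 := by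
    rw [pow_one, LinearMap.neg_apply, virPlus_apply, finsum_eq_zero_of_forall_eq_zero, neg_zero]
    intro j
    rw [h0 _ (by omega), smul_zero]
  change 𝒱.rescaleOp (evalSeries _ _ _ 𝒱.vac) = 𝒱.vac
  rw [evalSeries_exp_eq 𝒱.locallyNilpotent_neg_virPlus h1, expTrunc_apply, Finset.sum_range_one,
    divPow_zero, 𝒱.rescaleOp_apply (k := 0), zpow_zero, one_smul]
  rw [Module.End.mem_eigenspace_iff, h0 0 (by norm_num), Int.cast_zero, zero_smul]

theorem opU_bijective : Function.Bijective 𝒱.opU := by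
  have hT := 𝒱.locallyNilpotent_neg_virPlus
  have hT' : LocallyNilpotent (-(-𝒱.virPlus)) := hT.neg
  have h := evalSeries_exp_neg hT hT'
  have h' := evalSeries_exp_neg hT' (hT'.neg)
  simp only [neg_neg] at h'
  have hb : Function.Bijective (evalSeries (PowerSeries.exp ℂ) (-𝒱.virPlus) hT) := by
    refine ⟨Function.LeftInverse.injective (g := evalSeries (PowerSeries.exp ℂ) (-(-𝒱.virPlus)) hT')
      fun v => ?_, Function.RightInverse.surjective h⟩
    have := h' v
    simpa only [neg_neg] using this
  exact 𝒱.rescaleOp_bijective.comp hb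

end VertexOperatorAlgebra

namespace VOAAut

variable {V : Type*} [AddCommGroup V] [Module ℂ V] {𝒱 : VertexOperatorAlgebra V} (g : VOAAut 𝒱)

theorem opU_resY_opP (s : ℤ) (u v : V) :
    𝒱.opU (resY 𝒱 logY (shift s (onePlusPow g.opP u)) v) = g.tm s (𝒱.opU u) (𝒱.opU v) :=
  𝒱.opU_resY g.preservesWt_opL_add_opN g.opL_add_opN (fun n v => (g.opP_vir n v).symm) s u v

theorem opU_bullet (u v : V) : 𝒱.opU (g.bullet u v) = g.star (𝒱.opU u) (𝒱.opU v) :=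
  (g.opU_resY_opP (-1) u v).trans (g.star_eq _ _).symm

theorem opU_opD (v : V) : 𝒱.opU (g.opD v) = g.opD (𝒱.opU v) :=
  g.opD_commute (fun v => (𝒱.opU_commute (S := g.op) g.op_vir v).symm) v

/-- `𝒰(1)` maps `Õ_g(V)` onto `O_g(V)`: it maps generators to generators, and is surjective on the
arguments `u` and `v`. -/
theorem map_opU_tildeO : g.tildeO.map 𝒱.opU = g.ordO := by
  have key : ∀ (n : ℤ) (u v : V), 𝒱.opU (resY 𝒱 logY (shift (-n)
      (varPow (𝒱.vir 0 - g.opL + g.opA) g.isInternal_opL_sub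
        (onePlusPow (g.opL - 𝒱.vir 0 + g.opN) u))) v) =
      g.tm (-n) (𝒱.opU u - g.opD (𝒱.opU u)) (𝒱.opU v) +
        g.tm (1 - n) (g.opD (𝒱.opU u)) (𝒱.opU v) := by
    intro n u v
    have := g.resY_varPow orderOne_logY g.preservesWt_opP g.opP_opD n u v
    rw [opP] at this
    rw [this, map_add, ← opU_opD, ← map_sub, ← opU_resY_opP, ← opU_resY_opP]
    rfl
  rw [tildeO, Submodule.map_span, ordO_eq]
  congr 1
  ext z
  constructor
  · rintro ⟨_, ⟨n, u, v, hn, rfl⟩, rfl⟩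
    exact ⟨n, 𝒱.opU u, 𝒱.opU v, hn, key n u v⟩
  · rintro ⟨n, u, v, hn, rfl⟩
    obtain ⟨u, rfl⟩ := 𝒱.opU_bijective.2 u
    obtain ⟨v, rfl⟩ := 𝒱.opU_bijective.2 v
    exact ⟨_, ⟨n, u, v, hn, rfl⟩, key n u v⟩

end VOAAut

end TwistedZhu

end

theorem corollary4p2 {V : Type*} [AddCommGroup V] [Module ℂ V]
    (𝒱 : TwistedZhu.VertexOperatorAlgebra V) (g : TwistedZhu.VOAAut 𝒱) :
    ∃ (mulA : g.OrdA →ₗ[ℂ] g.OrdA →ₗ[ℂ] g.OrdA)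
      (mulT : g.TildeA →ₗ[ℂ] g.TildeA →ₗ[ℂ] g.TildeA)
      (Φ : g.TildeA ≃ₗ[ℂ] g.OrdA),
      (∀ u v : V, mulA (g.ordO.mkQ u) (g.ordO.mkQ v) = g.ordO.mkQ (g.star u v)) ∧
      TwistedZhu.IsAssociativeAlgebra mulA (g.ordO.mkQ 𝒱.vac) ∧
      (∀ u v : V, mulT (g.tildeO.mkQ u) (g.tildeO.mkQ v) = g.tildeO.mkQ (g.bullet u v)) ∧
      TwistedZhu.IsAssociativeAlgebra mulT (g.tildeO.mkQ 𝒱.vac) ∧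
      (∀ u : V, Φ (g.tildeO.mkQ u) = g.ordO.mkQ (𝒱.opU u)) ∧
      (∀ x y : g.TildeA, Φ (mulT x y) = mulA (Φ x) (Φ y)) ∧
      Φ (g.tildeO.mkQ 𝒱.vac) = g.ordO.mkQ 𝒱.vac := by
  obtain ⟨mulA, hA, hA'⟩ := g.exists_mul_ordA
  let U : V ≃ₗ[ℂ] V := LinearEquiv.ofBijective 𝒱.opU 𝒱.opU_bijective
  let Φ : g.TildeA ≃ₗ[ℂ] g.OrdA := Submodule.Quotient.equiv g.tildeO g.ordO U g.map_opU_tildeO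
  have hΦ : ∀ u : V, Φ (g.tildeO.mkQ u) = g.ordO.mkQ (𝒱.opU u) := fun _ => rfl
  -- the product of `Ã_g(V)`, transported along `Φ`; it is induced by `•_g` because of `opU_bullet`
  let mulT : g.TildeA →ₗ[ℂ] g.TildeA →ₗ[ℂ] g.TildeA :=
    LinearMap.compr₂ (mulA.compl₁₂ Φ.toLinearMap Φ.toLinearMap) Φ.symm.toLinearMap
  have hmul : ∀ x y, Φ (mulT x y) = mulA (Φ x) (Φ y) := fun x y => Φ.apply_symm_apply _
  have hvac : Φ (g.tildeO.mkQ 𝒱.vac) = g.ordO.mkQ 𝒱.vac := by rw [hΦ, 𝒱.opU_vac]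
  refine ⟨mulA, mulT, Φ, hA, hA', fun u v => ?_, ⟨fun x y z => ?_, fun x => ?_, fun x => ?_⟩, hΦ,
    hmul, hvac⟩
  · apply Φ.injective
    rw [hmul, hΦ, hΦ, hΦ, hA, g.opU_bullet]
  · apply Φ.injective
    rw [hmul, hmul, hmul, hmul, hA'.assoc]
  · apply Φ.injective
    rw [hmul, hvac, hA'.one_mul]
  · apply Φ.injective
    rw [hmul, hvac, hA'.mul_one]
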